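/- **Setting.** Consider the real plant $\dot x = Ax+B_1w+B_2u$, $z=C_1x+D_{12}u$, $y=C_2x+D_{21}w$, i.e. the transfer matrix $$\mathcal P=\begin{bmatrix}\mathcal P_{11}&\mathcal P_{12}\\ \mathcal P_{21}&\mathcal P_{22}\end{bmatrix}=\begin{bmatrix}0&D_{12}\\D_{21}&0\end{bmatrix}+\begin{bmatrix}C_1\\C_2\end{bmatrix}(sI-A)^{-1}\begin{bmatrix}B_1&B_2\end{bmatrix},$$ assume that this realization is minimal, and that $$A=\begin{bmatrix}A_{11}&0\\A_{21}&A_{22}\end{bmatrix},\quad B_2=\begin{bmatrix}B_{11}&0\\B_{21}&B_{22}\end{bmatrix},\quad C_2=\begin{bmatrix}C_{11}&0\\C_{21}&C_{22}\end{bmatrix},$$ where $A_{ij}\in\mathbb R^{n_i\times n_j}$, $B_{ij}\in\mathbb R^{n_i\times m_j}$, $C_{ij}\in\mathbb R^{k_i\times n_j}$ and $n_1,n_2\neq0$. Put $n=n_1+n_2$. Other matrices are partitioned conformably; $M_{ij}$ denotes the $(i,j)$ block, $E_1=\begin{bmatrix}I&0\end{bmatrix}^{\mathsf T}$ and $E_2=\begin{bmatrix}0&I\end{bmatrix}^{\mathsf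 T}$. Put $Q=C_1^{\mathsf T}C_1$, $S=C_1^{\mathsf T}D_{12}$, $R=D_{12}^{\mathsf T}D_{12}$, $W=B_1B_1^{\mathsf T}$, $U=D_{21}B_1^{\mathsf T}$, $V=D_{21}D_{21}^{\mathsf T}$. Assume: $R>0$ and $V>0$; $(A_{ii},B_{ii})$ is stabilizable and $(C_{ii},A_{ii})$ is detectable for $i=1,2$; for all $\omega\in\mathbb R$, $\begin{bmatrix}A-i\omega I&B_2\\C_1&D_{12}\end{bmatrix}$ has full column rank and $\begin{bmatrix}A-i\omega I&B_1\\C_2&D_{21}\end{bmatrix}$ has full row rank. A proper real rational $\mathcal K$ *stabilizes* $\mathcal P$ if $I-\mathcal P_{22}(\infty)\mathcal K(\infty)$ is nonsingular and the map $(w,u_1,u_2)\mapsto(z,y_1,y_2)$ defined by $z=\mathcal P_{11}w+\mathcal P_{12}y_2$, $y_1=\mathcal P_{21}w+\mathcal P_{22}y_2+u_1$, $y_2=\mathcal Ky_1+u_2$ is proper and has no poles with nonnegative real part. Let $F_\ell(\mathcal P,\mathcal K)=\mathcal P_{11}+\mathcal P_{12}\mathcal K(I-\mathcal P_{22}\mathcal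 K)^{-1}\mathcal P_{21}$ and $\|\mathcal G\|_2^2=\frac1{2\pi}\int_{-\infty}^{\infty}\operatorname{tr}\big(\mathcal G(i\omega)^*\mathcal G(i\omega)\big)\,d\omega\in[0,\infty]$. The *centralized problem* is to minimize $\|F_\ell(\mathcal P,\mathcal K)\|_2$ over all stabilizing $\mathcal K$; the *two-player problem* is the same with the additional constraint that $\mathcal K$ is block-lower-triangular (the block $\mathcal K_{12}$, of size $m_1\times k_2$, is zero). Write $(X,K)=\mathrm{are}(A,B,C,D)$ if $A^{\mathsf T}X+XA+C^{\mathsf T}C-(XB+C^{\mathsf T}D)(D^{\mathsf T}D)^{-1}(B^{\mathsf T}X+D^{\mathsf T}C)=0$, $K=-(D^{\mathsf T}D)^{-1}(B^{\mathsf T}X+D^{\mathsf T}C)$, and $A+BK$ is Hurwitz. Let $$(X,K)=\mathrm{are}(A,B_2,C_1,D_{12}),\qquad (Y,L^{\mathsf T})=\mathrm{are}(A^{\mathsf T},C_2^{\mathsf T},B_1^{\mathsf T},D_{21}^{\mathsf T}),$$ $$(\tilde X,J)=\mathrm{are}(A_{22},B_{22},C_1E_2,D_{12}E_2),\qquad (\tilde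 Y,M^{\mathsf T})=\mathrm{are}(A_{11}^{\mathsf T},C_{11}^{\mathsf T},B_1^{\mathsf T}E_1,D_{21}^{\mathsf T}E_1).$$ Let $\Phi,\Psi\in\mathbb R^{n_2\times n_1}$ satisfy $$(A_{22}+B_{22}J)^{\mathsf T}\Phi+\Phi(A_{11}+MC_{11})-(\tilde X-X_{22})(\Psi C_{11}^{\mathsf T}+U_{12}^{\mathsf T})V_{11}^{-1}C_{11}+\tilde XA_{21}+J^{\mathsf T}S_{12}^{\mathsf T}+Q_{21}-X_{21}MC_{11}=0,$$ $$(A_{22}+B_{22}J)\Psi+\Psi(A_{11}+MC_{11})^{\mathsf T}-B_{22}R_{22}^{-1}(B_{22}^{\mathsf T}\Phi+S_{12}^{\mathsf T})(\tilde Y-Y_{11})+A_{21}\tilde Y+U_{12}^{\mathsf T}M^{\mathsf T}+W_{21}-B_{22}JY_{21}=0,$$ and put $$\hat K=\begin{bmatrix}0&0\\-R_{22}^{-1}(B_{22}^{\mathsf T}\Phi+S_{12}^{\mathsf T})&J\end{bmatrix},\quad \hat L=\begin{bmatrix}M&0\\-(\Psi C_{11}^{\mathsf T}+U_{12}^{\mathsf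 T})V_{11}^{-1}&0\end{bmatrix},\quad \hat A=A+B_2\hat K+\hat LC_2.$$ Let $\hat X,\hat Y\in\mathbb R^{n\times n}$ be the solutions of $$\hat A(\hat Y-Y)+(\hat Y-Y)\hat A^{\mathsf T}+(\hat L-L)V(\hat L-L)^{\mathsf T}=0,\qquad \hat A^{\mathsf T}(\hat X-X)+(\hat X-X)\hat A+(\hat K-K)^{\mathsf T}R(\hat K-K)=0.$$ Finally let $\mathcal K_{\rm opt}=C_o(sI-A_o)^{-1}B_o$, where $$A_o=\begin{bmatrix}A+B_2K+\hat LC_2&0\\B_2K-B_2\hat K&A+LC_2+B_2\hat K\end{bmatrix},\quad B_o=\begin{bmatrix}-\hat L\\-L\end{bmatrix},\quad C_o=\begin{bmatrix}K-\hat K&\hat K\end{bmatrix}.$$ **Theorem.** $\mathcal K_{\rm opt}$ is optimal for the two-player problem, the centralized problem has an optimal controller, and for every optimal centralized controller $\mathcal K_{\rm cen}$ the costs $\|F_\ell(\mathcal P,\mathcal K_{\rm opt})\|_2$ and $\|F_\ell(\mathcal P,\mathcal K_{\rm cen})\|_2$ are finite and the additional cost $$\Delta=\|F_\ell(\mathcal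 P,\mathcal K_{\rm opt})\|_2^2-\|F_\ell(\mathcal P,\mathcal K_{\rm cen})\|_2^2$$ satisfies $$\Delta=\big\|D_{12}(\hat K-K)(sI-\hat A)^{-1}(\hat L-L)D_{21}\big\|_2^2=\operatorname{tr}\big((\hat Y-Y)(\hat K-K)^{\mathsf T}R(\hat K-K)\big)=\operatorname{tr}\big((\hat X-X)(\hat L-L)V(\hat L-L)^{\mathsf T}\big),$$ where the norm on the right is finite. -/

import Mathlib

open Matrix

noncomputable section

/-! ### Rational transfer matrices -/

/-- A scalar real rational function is proper. -/
def RatProper (f : RatFunc ℝ) : Prop := f.num.degree ≤ f.denom.degree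

/-- A scalar real rational function has no pole in the closed right half-plane. -/
def RatStable (f : RatFunc ℝ) : Prop :=
  ∀ s : ℂ, 0 ≤ s.re → f.denom.eval₂ (algebraMap ℝ ℂ) s ≠ 0

/-- Value at infinity of a proper rational function (the denominator is monic). -/
def ratAtInfty (f : RatFunc ℝ) : ℝ := f.num.coeff f.denom.natDegree

/-- `G` is a matrix of proper real rational functions. -/
def IsProperTF {a b : Type*} (G : Matrix a b (RatFunc ℝ)) : Prop :=
  ∀ i j, RatProper (G i j)

/-- `G` is a stable proper real rational transfer matrix. -/
def IsStableTF {a b : Type*} (G : Matrix a b (RatFunc ℝ)) : Prop :=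
  ∀ i j, RatProper (G i j) ∧ RatStable (G i j)

/-- The transfer matrix `D + C (sI - A)⁻¹ B` of the realization `(A, B, C, D)`. -/
def transferFn {n a b : Type*} [Fintype n] [DecidableEq n]
    (A : Matrix n n ℝ) (B : Matrix n b ℝ) (C : Matrix a n ℝ) (D : Matrix a b ℝ) :
    Matrix a b (RatFunc ℝ) :=
  D.map RatFunc.C +
    C.map RatFunc.C * (Matrix.scalar n RatFunc.X - A.map RatFunc.C)⁻¹ * B.map RatFunc.C

/-- The value of a rational transfer matrix at a complex point. -/
def evalTF {a b : Type*} (G : Matrix a b (RatFunc ℝ)) (s : ℂ) : Matrix a b ℂ :=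
  G.map (RatFunc.eval (algebraMap ℝ ℂ) s)

/-- The norm `‖G‖₂ = ((1 / 2π) ∫ tr (G(iω)* G(iω)) dω)^{1/2}`, with value `∞` if the integral
diverges. -/
def h2Norm {a b : Type*} [Fintype a] [Fintype b] (G : Matrix a b (RatFunc ℝ)) : ENNReal :=
  (ENNReal.ofReal (1 / (2 * Real.pi)) *
    ∫⁻ ω : ℝ, ENNReal.ofReal
      (((evalTF G (ω * Complex.I))ᴴ * evalTF G (ω * Complex.I)).trace).re) ^ (1 / 2 : ℝ)

/-! ### State-space notions -/

/-- All complex eigenvalues have strictly negative real part. -/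
def IsHurwitz {n : Type*} [Fintype n] [DecidableEq n] (A : Matrix n n ℝ) : Prop :=
  ∀ μ ∈ spectrum ℂ (A.map (algebraMap ℝ ℂ)), μ.re < 0

/-- `(A, B)` is stabilizable. -/
def IsStabilizable {n m : Type*} [Fintype n] [DecidableEq n] [Fintype m]
    (A : Matrix n n ℝ) (B : Matrix n m ℝ) : Prop :=
  ∃ F : Matrix m n ℝ, IsHurwitz (A + B * F)

/-- `(C, A)` is detectable. -/
def IsDetectable {n k : Type*} [Fintype n] [DecidableEq n] [Fintype k]
    (C : Matrix k n ℝ) (A : Matrix n n ℝ) : Prop :=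
  ∃ H : Matrix n k ℝ, IsHurwitz (A + H * C)

/-- `(A, B, C, D)` has the least state dimension among all realizations of its transfer matrix. -/
def IsMinimalRealization {n a b : Type*} [Fintype n] [DecidableEq n]
    (A : Matrix n n ℝ) (B : Matrix n b ℝ) (C : Matrix a n ℝ) (D : Matrix a b ℝ) : Prop :=
  ∀ (r : ℕ) (A' : Matrix (Fin r) (Fin r) ℝ) (B' : Matrix (Fin r) b ℝ)
    (C' : Matrix a (Fin r) ℝ) (D' : Matrix a b ℝ),
    transferFn A' B' C' D' = transferFn A B C D → Fintype.card n ≤ r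

/-- `(X, K) = are(A, B, C, D)`: `X` is the stabilizing solution of the algebraic Riccati equation
and `K` is the associated gain. -/
def IsARE {n b c : Type*} [Fintype n] [DecidableEq n] [Fintype b] [DecidableEq b] [Fintype c]
    (A : Matrix n n ℝ) (B : Matrix n b ℝ) (C : Matrix c n ℝ) (D : Matrix c b ℝ)
    (X : Matrix n n ℝ) (K : Matrix b n ℝ) : Prop :=
  Aᵀ * X + X * A + Cᵀ * C - (X * B + Cᵀ * D) * (Dᵀ * D)⁻¹ * (Bᵀ * X + Dᵀ * C) = 0 ∧
  IsHurwitz (A - B * (Dᵀ * D)⁻¹ * (Bᵀ * X + Dᵀ * C)) ∧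
  K = -((Dᵀ * D)⁻¹ * (Bᵀ * X + Dᵀ * C))

/-- `[A - iωI, B; C, D]`. -/
def pencil {n a b : Type*} [DecidableEq n]
    (A : Matrix n n ℝ) (B : Matrix n b ℝ) (C : Matrix a n ℝ) (D : Matrix a b ℝ) (ω : ℝ) :
    Matrix (n ⊕ a) (n ⊕ b) ℂ :=
  fromBlocks (A.map (algebraMap ℝ ℂ) - ((ω : ℂ) * Complex.I) • (1 : Matrix n n ℂ))
    (B.map (algebraMap ℝ ℂ)) (C.map (algebraMap ℝ ℂ)) (D.map (algebraMap ℝ ℂ))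

/-! ### Feedback interconnection of a four-block plant `G` with a controller `K` -/

section Feedback

variable {q p k m : Type*} [Fintype k] [DecidableEq k] [Fintype m] [DecidableEq m]

/-- The lower linear fractional transformation `G₁₁ + G₁₂ K (I - G₂₂ K)⁻¹ G₂₁`. -/
def lowerLFT (G : Matrix (q ⊕ k) (p ⊕ m) (RatFunc ℝ)) (K : Matrix m k (RatFunc ℝ)) :
    Matrix q p (RatFunc ℝ) :=
  G.toBlocks₁₁ + G.toBlocks₁₂ * K * (1 - G.toBlocks₂₂ * K)⁻¹ * G.toBlocks₂₁

/-- The map `(w, u₁, u₂) ↦ (z, y₁, y₂)` of the loop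
`z = G₁₁ w + G₁₂ y₂`, `y₁ = G₂₁ w + G₂₂ y₂ + u₁`, `y₂ = K y₁ + u₂`. -/
def closedLoop (G : Matrix (q ⊕ k) (p ⊕ m) (RatFunc ℝ)) (K : Matrix m k (RatFunc ℝ)) :
    Matrix (q ⊕ (k ⊕ m)) (p ⊕ (k ⊕ m)) (RatFunc ℝ) :=
  let S : Matrix k k (RatFunc ℝ) := (1 - G.toBlocks₂₂ * K)⁻¹
  let y₁ : Matrix k (p ⊕ (k ⊕ m)) (RatFunc ℝ) :=
    fromCols (S * G.toBlocks₂₁) (fromCols S (S * G.toBlocks₂₂))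
  let y₂ : Matrix m (p ⊕ (k ⊕ m)) (RatFunc ℝ) :=
    K * y₁ + fromCols 0 (fromCols 0 1)
  let z : Matrix q (p ⊕ (k ⊕ m)) (RatFunc ℝ) :=
    fromCols G.toBlocks₁₁ 0 + G.toBlocks₁₂ * y₂
  fromRows z (fromRows y₁ y₂)

/-- `K` stabilizes `G`: the loop is well-posed, i.e. `I - G₂₂(∞) K(∞)` is nonsingular, and
`(w, u₁, u₂) ↦ (z, y₁, y₂)` is stable. -/
def Stabilizes (G : Matrix (q ⊕ k) (p ⊕ m) (RatFunc ℝ)) (K : Matrix m k (RatFunc ℝ)) : Prop :=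
  IsUnit (1 - G.toBlocks₂₂.map ratAtInfty * K.map ratAtInfty) ∧ IsStableTF (closedLoop G K)

/-- The proper controllers that stabilize `G`. -/
def centralizedControllers (G : Matrix (q ⊕ k) (p ⊕ m) (RatFunc ℝ)) :
    Set (Matrix m k (RatFunc ℝ)) :=
  {K | IsProperTF K ∧ Stabilizes G K}

/-- `K` minimizes `‖lowerLFT G K‖₂` over the set `S` of controllers. -/
def IsH2Optimal [Fintype q] [Fintype p] (G : Matrix (q ⊕ k) (p ⊕ m) (RatFunc ℝ))
    (S : Set (Matrix m k (RatFunc ℝ))) (K : Matrix m k (RatFunc ℝ)) : Prop :=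
  K ∈ S ∧ ∀ K' ∈ S, h2Norm (lowerLFT G K) ≤ h2Norm (lowerLFT G K')

end Feedback

/-- The proper block-lower-triangular controllers that stabilize `G`. -/
def twoPlayerControllers {q p k₁ k₂ m₁ m₂ : Type*}
    [Fintype k₁] [DecidableEq k₁] [Fintype k₂] [DecidableEq k₂]
    [Fintype m₁] [DecidableEq m₁] [Fintype m₂] [DecidableEq m₂]
    (G : Matrix (q ⊕ (k₁ ⊕ k₂)) (p ⊕ (m₁ ⊕ m₂)) (RatFunc ℝ)) :
    Set (Matrix (m₁ ⊕ m₂) (k₁ ⊕ k₂) (RatFunc ℝ)) :=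
  {K | IsProperTF K ∧ K.toBlocks₁₂ = 0 ∧ Stabilizes G K}

/-! ### The two-player plant -/

/-- State-space data of a plant with block-lower-triangular `A`, `B₂`, `C₂`. -/
structure TwoPlayerPlant (n₁ n₂ m₁ m₂ k₁ k₂ p q : Type*) where
  A₁₁ : Matrix n₁ n₁ ℝ
  A₂₁ : Matrix n₂ n₁ ℝ
  A₂₂ : Matrix n₂ n₂ ℝ
  B₁₁ : Matrix n₁ m₁ ℝ
  B₂₁ : Matrix n₂ m₁ ℝ
  B₂₂ : Matrix n₂ m₂ ℝ
  C₁₁ : Matrix k₁ n₁ ℝ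
  C₂₁ : Matrix k₂ n₁ ℝ
  C₂₂ : Matrix k₂ n₂ ℝ
  /-- Input matrix of the exogenous input. -/
  B₁ : Matrix (n₁ ⊕ n₂) p ℝ
  /-- Output matrix of the regulated output. -/
  C₁ : Matrix q (n₁ ⊕ n₂) ℝ
  D₁₂ : Matrix q (m₁ ⊕ m₂) ℝ
  D₂₁ : Matrix (k₁ ⊕ k₂) p ℝ

namespace TwoPlayerPlant

variable {n₁ n₂ m₁ m₂ k₁ k₂ p q : Type*} (P : TwoPlayerPlant n₁ n₂ m₁ m₂ k₁ k₂ p q)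

def A : Matrix (n₁ ⊕ n₂) (n₁ ⊕ n₂) ℝ := fromBlocks P.A₁₁ 0 P.A₂₁ P.A₂₂

def B₂ : Matrix (n₁ ⊕ n₂) (m₁ ⊕ m₂) ℝ := fromBlocks P.B₁₁ 0 P.B₂₁ P.B₂₂

def C₂ : Matrix (k₁ ⊕ k₂) (n₁ ⊕ n₂) ℝ := fromBlocks P.C₁₁ 0 P.C₂₁ P.C₂₂

/-- `[B₁, B₂]`. -/
def B : Matrix (n₁ ⊕ n₂) (p ⊕ (m₁ ⊕ m₂)) ℝ := fromCols P.B₁ P.B₂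

/-- `[C₁; C₂]`. -/
def C : Matrix (q ⊕ (k₁ ⊕ k₂)) (n₁ ⊕ n₂) ℝ := fromRows P.C₁ P.C₂

/-- `[0, D₁₂; D₂₁, 0]`. -/
def D : Matrix (q ⊕ (k₁ ⊕ k₂)) (p ⊕ (m₁ ⊕ m₂)) ℝ := fromBlocks 0 P.D₁₂ P.D₂₁ 0

/-- The transfer matrix of the plant, `(w, u) ↦ (z, y)`. -/
def tf [Fintype n₁] [DecidableEq n₁] [Fintype n₂] [DecidableEq n₂] :
    Matrix (q ⊕ (k₁ ⊕ k₂)) (p ⊕ (m₁ ⊕ m₂)) (RatFunc ℝ) :=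
  transferFn P.A P.B P.C P.D

def Q [Fintype q] : Matrix (n₁ ⊕ n₂) (n₁ ⊕ n₂) ℝ := P.C₁ᵀ * P.C₁

def S [Fintype q] : Matrix (n₁ ⊕ n₂) (m₁ ⊕ m₂) ℝ := P.C₁ᵀ * P.D₁₂

def R [Fintype q] : Matrix (m₁ ⊕ m₂) (m₁ ⊕ m₂) ℝ := P.D₁₂ᵀ * P.D₁₂

def W [Fintype p] : Matrix (n₁ ⊕ n₂) (n₁ ⊕ n₂) ℝ := P.B₁ * P.B₁ᵀ

def U [Fintype p] : Matrix (k₁ ⊕ k₂) (n₁ ⊕ n₂) ℝ := P.D₂₁ * P.B₁ᵀ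

def V [Fintype p] : Matrix (k₁ ⊕ k₂) (k₁ ⊕ k₂) ℝ := P.D₂₁ * P.D₂₁ᵀ

section Gains

variable [Fintype n₁] [Fintype n₂] [Fintype m₁] [Fintype m₂] [DecidableEq m₂]
  [Fintype k₁] [DecidableEq k₁] [Fintype k₂] [Fintype p] [Fintype q]

/-- The simultaneous linear equations for `Φ` and `Ψ`. -/
def CoupledEquations (X Y : Matrix (n₁ ⊕ n₂) (n₁ ⊕ n₂) ℝ)
    (Xt : Matrix n₂ n₂ ℝ) (J : Matrix m₂ n₂ ℝ) (Yt : Matrix n₁ n₁ ℝ) (M : Matrix n₁ k₁ ℝ)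
    (Φ Ψ : Matrix n₂ n₁ ℝ) : Prop :=
  (P.A₂₂ + P.B₂₂ * J)ᵀ * Φ + Φ * (P.A₁₁ + M * P.C₁₁)
      - (Xt - X.toBlocks₂₂) * (Ψ * P.C₁₁ᵀ + P.U.toBlocks₁₂ᵀ) * P.V.toBlocks₁₁⁻¹ * P.C₁₁
      + (Xt * P.A₂₁ + Jᵀ * P.S.toBlocks₁₂ᵀ + P.Q.toBlocks₂₁ - X.toBlocks₂₁ * M * P.C₁₁) = 0 ∧
  (P.A₂₂ + P.B₂₂ * J) * Ψ + Ψ * (P.A₁₁ + M * P.C₁₁)ᵀ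
      - P.B₂₂ * P.R.toBlocks₂₂⁻¹ * (P.B₂₂ᵀ * Φ + P.S.toBlocks₁₂ᵀ) * (Yt - Y.toBlocks₁₁)
      + (P.A₂₁ * Yt + P.U.toBlocks₁₂ᵀ * Mᵀ + P.W.toBlocks₂₁ - P.B₂₂ * J * Y.toBlocks₂₁) = 0

/-- The gain `K̂`. -/
def Khat (J : Matrix m₂ n₂ ℝ) (Φ : Matrix n₂ n₁ ℝ) : Matrix (m₁ ⊕ m₂) (n₁ ⊕ n₂) ℝ :=
  fromBlocks 0 0 (-(P.R.toBlocks₂₂⁻¹ * (P.B₂₂ᵀ * Φ + P.S.toBlocks₁₂ᵀ))) J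

/-- The gain `L̂`. -/
def Lhat (M : Matrix n₁ k₁ ℝ) (Ψ : Matrix n₂ n₁ ℝ) : Matrix (n₁ ⊕ n₂) (k₁ ⊕ k₂) ℝ :=
  fromBlocks M 0 (-((Ψ * P.C₁₁ᵀ + P.U.toBlocks₁₂ᵀ) * P.V.toBlocks₁₁⁻¹)) 0

/-- `Â = A + B₂ K̂ + L̂ C₂`. -/
def Ahat (Kh : Matrix (m₁ ⊕ m₂) (n₁ ⊕ n₂) ℝ) (Lh : Matrix (n₁ ⊕ n₂) (k₁ ⊕ k₂) ℝ) :
    Matrix (n₁ ⊕ n₂) (n₁ ⊕ n₂) ℝ :=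
  P.A + P.B₂ * Kh + Lh * P.C₂

/-- The two-player controller built from the gains `K`, `L`, `K̂`, `L̂`. -/
def Kopt [DecidableEq n₁] [DecidableEq n₂]
    (K Kh : Matrix (m₁ ⊕ m₂) (n₁ ⊕ n₂) ℝ) (L Lh : Matrix (n₁ ⊕ n₂) (k₁ ⊕ k₂) ℝ) :
    Matrix (m₁ ⊕ m₂) (k₁ ⊕ k₂) (RatFunc ℝ) :=
  transferFn
    (fromBlocks (P.A + P.B₂ * K + Lh * P.C₂) 0
      (P.B₂ * K - P.B₂ * Kh) (P.A + L * P.C₂ + P.B₂ * Kh))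
    (fromRows (-Lh) (-L)) (fromCols (K - Kh) Kh) 0

end Gains

end TwoPlayerPlant

end

/-!
The proof works with the Youla parametrization in the coordinates given by the centralized gains
`K` and `L`. The closed loop of every proper controller is `T₁₁ + T₁₂ Q T₂₁`, where `Q` is the map
from the innovation `y - C₂ x̂` to the residual `u - K x̂`, and `Q` is stable if the controller
stabilizes the plant (`StatePlant.lowerLFT_eq_youla`, `StatePlant.isStableTF_youla`). By the Riccati
equations, `T₁₂` is inner up to the weight `R`, `T₂₁` is co-inner up to the weight `V`, and
`T₂₁ T₁₁* T₁₂` is stable and strictly proper. Orthogonality of `H₂` and its para-conjugate, which is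
Cauchy's theorem (`integral_imaginary_axis_eq_zero`), then makes `T₁₁` orthogonal to all `T₁₂ Q T₂₁`
of finite norm (`StatePlant.h2Inner_nomTF_eq_zero`). Hence `Q = 0` is optimal for the centralized
problem, and the additional cost of a stabilizing controller of finite cost is
`‖T₁₂ Q T₂₁‖² = ‖D₁₂ Q D₂₁‖²`.

The two-player controller is the observer-based controller with parameter
`Qₒ = (K̂ - K) (sI - Â)⁻¹ (L̂ - L)` (`StatePlant.lowerLFT_controller`), which gives the formulas for
the additional cost, with traces from the two Gramians (`h2Inner_gramian`, `trace_gramian_eq`).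

For its optimality, the admissible perturbations of the closed loop are `T₁₂ (G Δ G') T₂₁` with `Δ`
stable and block lower triangular, where `G` and `G'` come from the passage to block-diagonal gains
built from `J`, from `M`, and from gains given by the stabilizability and detectability of the
remaining diagonal blocks. Such a `Δ` is the sum of a part that reads only the first measurement and
a part from the second measurement to the second input (`IsLower.eq_add`). On the first part, the
right factor of the perturbation is the first row of `G'`, a change of observer gain for the first
subsystem alone; on the second part, the left factor is the second column of `G`, a change of
feedback gain for the second subsystem alone. The Riccati equations for `Ỹ` and `X̃`, together with
the coupled equations for `Φ` and `Ψ`, say precisely that `[Ỹ - Y₁₁; Ψ - Y₂₁]` and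
`[Φ - X₂₁, X̃ - X₂₂]` solve the Sylvester equations linking these factors to `Qₒ`
(`TwoPlayerPlant.sylvester_estimation`, `TwoPlayerPlant.sylvester_control`). Multiplied by such a
factor, the para-conjugate of `Qₒ` becomes stable, and orthogonality to both parts follows
(`StatePlant.h2Inner_paramTF_eq_zero_of_left`, `StatePlant.h2Inner_paramTF_eq_zero_of_right`).
-/

set_option linter.unusedSectionVars false

noncomputable section

/-! ### The valuation at infinity and stable rational functions -/

section RationalFunctions

/-- The valuation of `ℝ(s)` at the point at infinity. Proper rational functions are those of
valuation at most one, strictly proper ones those of valuation less than one. -/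
def infVal : Valuation (RatFunc ℝ) (WithZero (Multiplicative ℤ)) := by
  classical exact RatFunc.inftyValuation ℝ

theorem infVal_of_ne_zero {f : RatFunc ℝ} (hf : f ≠ 0) : infVal f = WithZero.exp f.intDegree := by
  classical exact RatFunc.inftyValuation_of_nonzero ℝ hf

theorem one_lt_infVal_X : 1 < infVal RatFunc.X := by
  classical
  have : infVal RatFunc.X = WithZero.exp 1 := RatFunc.inftyValuation.X ℝ
  rw [this, ← WithZero.exp_zero, WithZero.exp_lt_exp]
  norm_num

theorem infVal_C_le (c : ℝ) : infVal (RatFunc.C c) ≤ 1 := by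
  classical
  by_cases hc : c = 0
  · simp [hc]
  · exact (RatFunc.inftyValuation.C ℝ hc).le

theorem ratProper_iff {f : RatFunc ℝ} : RatProper f ↔ infVal f ≤ 1 := by
  by_cases hf : f = 0
  · simp [hf, RatProper]
  · rw [infVal_of_ne_zero hf, ← WithZero.exp_zero, WithZero.exp_le_exp, RatProper,
      Polynomial.degree_eq_natDegree (RatFunc.num_ne_zero hf),
      Polynomial.degree_eq_natDegree (RatFunc.denom_ne_zero f), RatFunc.intDegree]
    rw [Nat.cast_le]
    omega

theorem infVal_lt_one_iff {f : RatFunc ℝ} : infVal f < 1 ↔ f.num.degree < f.denom.degree := by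
  by_cases hf : f = 0
  · simp [hf]
  · rw [infVal_of_ne_zero hf, ← WithZero.exp_zero, WithZero.exp_lt_exp,
      Polynomial.degree_eq_natDegree (RatFunc.num_ne_zero hf),
      Polynomial.degree_eq_natDegree (RatFunc.denom_ne_zero f), RatFunc.intDegree]
    rw [Nat.cast_lt]
    omega

theorem infVal_lt_one_iff_ratAtInfty {f : RatFunc ℝ} (hf : RatProper f) :
    infVal f < 1 ↔ ratAtInfty f = 0 := by
  rw [infVal_lt_one_iff, ratAtInfty]
  constructor
  · intro h
    apply Polynomial.coeff_eq_zero_of_degree_lt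
    rwa [← Polynomial.degree_eq_natDegree (RatFunc.denom_ne_zero f)]
  · intro h
    rw [Polynomial.degree_eq_natDegree (RatFunc.denom_ne_zero f), Polynomial.degree_lt_iff_coeff_zero]
    intro m hm
    rcases hm.eq_or_lt with rfl | hm
    · exact h
    · apply Polynomial.coeff_eq_zero_of_degree_lt
      refine lt_of_le_of_lt hf ?_
      rw [Polynomial.degree_eq_natDegree (RatFunc.denom_ne_zero f)]
      exact_mod_cast hm

theorem infVal_mul_X_le_one {f : RatFunc ℝ} (hf : infVal f < 1) :
    infVal (f * (RatFunc.X + 1)) ≤ 1 := by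
  classical
  rw [map_mul]
  have hX : infVal (RatFunc.X + 1) = WithZero.exp 1 := by
    rw [Valuation.map_add_eq_of_lt_left _ (by rw [map_one]; exact one_lt_infVal_X)]
    exact RatFunc.inftyValuation.X ℝ
  by_cases h0 : f = 0
  · simp [h0]
  rw [hX, infVal_of_ne_zero h0, ← WithZero.exp_add, ← WithZero.exp_zero, WithZero.exp_le_exp]
  rw [infVal_of_ne_zero h0, ← WithZero.exp_zero, WithZero.exp_lt_exp] at hf
  omega

/-- Evaluation of a real rational function at a complex point. -/
abbrev evalRat (s : ℂ) (f : RatFunc ℝ) : ℂ := RatFunc.eval (algebraMap ℝ ℂ) s f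

theorem ratStable_of_denom_dvd {f : RatFunc ℝ} {d : Polynomial ℝ} (h : f.denom ∣ d)
    (hd : ∀ s : ℂ, 0 ≤ s.re → d.eval₂ (algebraMap ℝ ℂ) s ≠ 0) : RatStable f := by
  intro s hs h0
  obtain ⟨e, rfl⟩ := h
  exact hd s hs (by rw [Polynomial.eval₂_mul, h0, zero_mul])

theorem RatStable.add {f g : RatFunc ℝ} (hf : RatStable f) (hg : RatStable g) :
    RatStable (f + g) :=
  ratStable_of_denom_dvd (RatFunc.denom_add_dvd f g) fun s hs => by
    rw [Polynomial.eval₂_mul]; exact mul_ne_zero (hf s hs) (hg s hs)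

theorem RatStable.mul {f g : RatFunc ℝ} (hf : RatStable f) (hg : RatStable g) :
    RatStable (f * g) :=
  ratStable_of_denom_dvd (RatFunc.denom_mul_dvd f g) fun s hs => by
    rw [Polynomial.eval₂_mul]; exact mul_ne_zero (hf s hs) (hg s hs)

theorem ratStable_C (c : ℝ) : RatStable (RatFunc.C c) := by
  intro s _; simp

theorem ratStable_zero : RatStable 0 := by simpa using ratStable_C 0

theorem ratStable_one : RatStable 1 := by simpa using ratStable_C 1

theorem ratStable_X : RatStable RatFunc.X := by
  intro s _; simp

theorem RatStable.sum {ι : Type*} {t : Finset ι} {f : ι → RatFunc ℝ}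
    (h : ∀ i ∈ t, RatStable (f i)) : RatStable (∑ i ∈ t, f i) := by
  classical
  induction t using Finset.induction_on with
  | empty => simpa using ratStable_zero
  | insert a t ha ih =>
    rw [Finset.sum_insert ha]
    exact (h a (by simp)).add (ih fun i hi => h i (by simp [hi]))

theorem evalRat_add {f g : RatFunc ℝ} (hf : RatStable f) (hg : RatStable g) {s : ℂ}
    (hs : 0 ≤ s.re) : evalRat s (f + g) = evalRat s f + evalRat s g :=
  RatFunc.eval_add _ _ (hf s hs) (hg s hs)

theorem evalRat_mul {f g : RatFunc ℝ} (hf : RatStable f) (hg : RatStable g) {s : ℂ}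
    (hs : 0 ≤ s.re) : evalRat s (f * g) = evalRat s f * evalRat s g :=
  RatFunc.eval_mul _ _ (hf s hs) (hg s hs)

theorem evalRat_sum {ι : Type*} {t : Finset ι} {f : ι → RatFunc ℝ}
    (h : ∀ i ∈ t, RatStable (f i)) {s : ℂ} (hs : 0 ≤ s.re) :
    evalRat s (∑ i ∈ t, f i) = ∑ i ∈ t, evalRat s (f i) := by
  classical
  induction t using Finset.induction_on with
  | empty => simp [evalRat]
  | insert a t ha ih =>
    rw [Finset.sum_insert ha, Finset.sum_insert ha, evalRat_add (h a (by simp))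
      (RatStable.sum fun i hi => h i (by simp [hi])) hs, ih fun i hi => h i (by simp [hi])]

/-! ### Analytic behaviour in the closed right half-plane -/

open Filter Topology Bornology

/-- Substituting `1 / s` turns the point at infinity into the point `0`, where the reflected
denominator takes the value `1`. -/
theorem tendsto_evalRat_cobounded {f : RatFunc ℝ} (hf : RatProper f) :
    Tendsto (fun s => evalRat s f) (cobounded ℂ) (𝓝 (ratAtInfty f : ℂ)) := by
  set N := f.denom.natDegree with hN
  have hnum : f.num.natDegree ≤ N := Polynomial.natDegree_le_natDegree hf
  let h : ℂ → ℂ := fun t => (f.num.reflect N).eval₂ (algebraMap ℝ ℂ) t /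
    (f.denom.reflect N).eval₂ (algebraMap ℝ ℂ) t
  have hev : ∀ p : Polynomial ℝ, (p.reflect N).eval₂ (algebraMap ℝ ℂ) 0 = (p.coeff N : ℂ) := by
    intro p
    rw [Polynomial.eval₂_at_zero, Polynomial.coeff_reflect, Polynomial.revAt_le N.zero_le,
      Nat.sub_zero]
    rfl
  have hd : (f.denom.reflect N).eval₂ (algebraMap ℝ ℂ) 0 = 1 := by
    rw [hev]
    have : f.denom.coeff N = 1 := RatFunc.monic_denom f
    simp [this]
  have hcont : ContinuousAt h 0 := by
    refine ContinuousAt.div ?_ ?_ (by rw [hd]; exact one_ne_zero)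
    · exact ((f.num.reflect N).continuous_eval₂ _).continuousAt
    · exact ((f.denom.reflect N).continuous_eval₂ _).continuousAt
  have h0 : h 0 = (ratAtInfty f : ℂ) := by
    change _ / _ = _
    rw [hd, hev, div_one]; rfl
  have hlim : Tendsto (fun s : ℂ => h s⁻¹) (cobounded ℂ) (𝓝 (ratAtInfty f : ℂ)) := by
    rw [← h0]
    exact hcont.tendsto.comp tendsto_inv₀_cobounded
  refine hlim.congr' ?_
  have hne : ∀ᶠ s : ℂ in cobounded ℂ, s ≠ 0 := eventually_ne_cobounded 0
  filter_upwards [hne] with s hs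
  have key : ∀ p : Polynomial ℝ, p.natDegree ≤ N →
      p.eval₂ (algebraMap ℝ ℂ) s = (p.reflect N).eval₂ (algebraMap ℝ ℂ) s⁻¹ * s ^ N := by
    intro p hp
    let _ : Invertible s := invertibleOfNonzero hs
    have := Polynomial.eval₂_reflect_mul_pow (algebraMap ℝ ℂ) s N p hp
    rw [invOf_eq_inv] at this
    exact this.symm
  change _ / _ = _ / _
  rw [key _ hnum, key _ le_rfl, mul_div_mul_right _ _ (pow_ne_zero _ hs)]

theorem differentiableAt_evalRat {f : RatFunc ℝ} (hf : RatStable f) {s : ℂ} (hs : 0 ≤ s.re) :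
    DifferentiableAt ℂ (fun s => evalRat s f) s := by
  have : (fun s => evalRat s f) = fun s => f.num.aeval s / f.denom.aeval s := rfl
  rw [this]
  exact (Polynomial.differentiable_aeval _ _).div (Polynomial.differentiable_aeval _ _) (hf s hs)

theorem exists_bound_evalRat {f : RatFunc ℝ} (hp : RatProper f) (hf : RatStable f) :
    ∃ c : ℝ, ∀ s : ℂ, 0 ≤ s.re → ‖evalRat s f‖ ≤ c := by
  have h1 : ∀ᶠ s in cobounded ℂ, ‖evalRat s f‖ < ‖(ratAtInfty f : ℂ)‖ + 1 :=
    (tendsto_evalRat_cobounded hp).norm.eventually (gt_mem_nhds (lt_add_one _))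
  obtain ⟨r, hr⟩ : ∃ r : ℝ, ∀ s : ℂ, r < ‖s‖ → ‖evalRat s f‖ < ‖(ratAtInfty f : ℂ)‖ + 1 := by
    obtain ⟨r, _, hr⟩ := (Filter.hasBasis_cobounded_norm (E := ℂ)).eventually_iff.1 h1
    exact ⟨r, fun s hs => hr (by simpa using hs.le)⟩
  have hK : IsCompact (Metric.closedBall (0 : ℂ) r ∩ {s : ℂ | 0 ≤ s.re}) :=
    (isCompact_closedBall _ _).inter_right (isClosed_le continuous_const Complex.continuous_re)
  obtain ⟨c, hc⟩ := hK.exists_bound_of_continuousOn (f := fun s => evalRat s f)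
    fun s hs => (differentiableAt_evalRat hf hs.2).continuousAt.continuousWithinAt
  refine ⟨max c (‖(ratAtInfty f : ℂ)‖ + 1), fun s hs => ?_⟩
  by_cases h : ‖s‖ ≤ r
  · exact (hc s ⟨by simpa using h, hs⟩).trans (le_max_left _ _)
  · exact (hr s (not_le.1 h)).le.trans (le_max_right _ _)

theorem norm_add_one_le {s : ℂ} (hs : 0 ≤ s.re) : Real.sqrt (1 + ‖s‖ ^ 2) ≤ ‖s + 1‖ := by
  apply Real.sqrt_le_iff.2 ⟨norm_nonneg _, ?_⟩
  rw [← Complex.normSq_eq_norm_sq, ← Complex.normSq_eq_norm_sq, Complex.normSq_apply,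
    Complex.normSq_apply]
  simp
  nlinarith

/-- Stable strictly proper functions decay like `1 / |s|` in the right half-plane, since their
products with `s + 1` are bounded. -/
theorem exists_decay_evalRat {f : RatFunc ℝ} (hp : infVal f < 1) (hf : RatStable f) :
    ∃ c : ℝ, 0 ≤ c ∧ ∀ s : ℂ, 0 ≤ s.re → ‖evalRat s f‖ ≤ c / Real.sqrt (1 + ‖s‖ ^ 2) := by
  have h1 : RatStable (RatFunc.X + 1) := ratStable_X.add ratStable_one
  obtain ⟨c, hc⟩ := exists_bound_evalRat (ratProper_iff.2 (infVal_mul_X_le_one hp)) (hf.mul h1)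
  refine ⟨c, (norm_nonneg _).trans (hc 0 (by simp)), fun s hs => ?_⟩
  have hpos : 0 < Real.sqrt (1 + ‖s‖ ^ 2) := Real.sqrt_pos.2 (by positivity)
  rw [le_div_iff₀ hpos]
  refine le_trans ?_ (hc s hs)
  rw [evalRat_mul hf h1 hs, evalRat_add ratStable_X ratStable_one hs, norm_mul]
  simp only [evalRat, RatFunc.eval_X, RatFunc.eval_one]
  exact mul_le_mul_of_nonneg_left (norm_add_one_le hs) (norm_nonneg _)

open MeasureTheory

theorem integrable_of_quadratic_decay {f : ℝ → ℂ} (hc : Continuous f) {c : ℝ}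
    (hb : ∀ ω, ‖f ω‖ ≤ c / (1 + ω ^ 2)) : Integrable f := by
  refine Integrable.mono' (g := fun ω => c * (1 + ω ^ 2)⁻¹)
    (integrable_inv_one_add_sq.const_mul c) hc.aestronglyMeasurable (ae_of_all _ fun ω => ?_)
  simpa [div_eq_mul_inv] using hb ω

/-- Cauchy's theorem on the rectangles with vertices `± iT`, `T ± iT`. -/
theorem integral_imaginary_axis_eq_zero {f : ℂ → ℂ}
    (hd : ∀ s : ℂ, 0 ≤ s.re → DifferentiableAt ℂ f s) {c : ℝ} (hc0 : 0 ≤ c)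
    (hb : ∀ s : ℂ, 0 ≤ s.re → ‖f s‖ ≤ c / (1 + ‖s‖ ^ 2)) :
    ∫ ω : ℝ, f (ω * Complex.I) = 0 := by
  have hcont : Continuous fun ω : ℝ => f (ω * Complex.I) := by
    rw [continuous_iff_continuousAt]
    intro ω
    exact ContinuousAt.comp (f := fun ω : ℝ => (ω : ℂ) * Complex.I)
      (hd _ (by simp)).continuousAt (by fun_prop)
  have hint : Integrable fun ω : ℝ => f (ω * Complex.I) :=
    integrable_of_quadratic_decay hcont (c := c) fun ω => by
      simpa using hb (ω * Complex.I) (by simp)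
  have hlim : Tendsto (fun T : ℝ => ∫ ω in (-T)..T, f (ω * Complex.I)) atTop
      (𝓝 (∫ ω : ℝ, f (ω * Complex.I))) :=
    intervalIntegral_tendsto_integral hint tendsto_neg_atTop_atBot tendsto_id
  refine tendsto_nhds_unique hlim ?_
  refine squeeze_zero_norm' (a := fun T => 4 * c / T) ?_ ?_
  · filter_upwards [eventually_gt_atTop 0] with T hT
    have H := Complex.integral_boundary_rect_eq_zero_of_differentiableOn f
      (⟨0, -T⟩ : ℂ) (⟨T, T⟩ : ℂ) (fun s hs => by
        have : 0 ≤ s.re := by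
          have := hs.1
          simp only [Set.mem_preimage, Set.uIcc_of_le hT.le] at this
          exact this.1
        exact (hd s this).differentiableWithinAt)
    simp only [Complex.ofReal_neg, Complex.ofReal_zero, zero_add, smul_eq_mul] at H
    have hside : ∀ s : ℂ, 0 ≤ s.re → T ≤ ‖s‖ → ‖f s‖ ≤ c / T ^ 2 := by
      intro s hs hTs
      refine (hb s hs).trans ?_
      apply div_le_div_of_nonneg_left hc0 (by positivity)
      nlinarith
    have b1 : ‖∫ x : ℝ in (0 : ℝ)..T, f (x + -T * Complex.I)‖ ≤ c / T ^ 2 * |T - 0| := by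
      apply intervalIntegral.norm_integral_le_of_norm_le_const
      intro x hx
      rw [Set.uIoc_of_le hT.le] at hx
      apply hside _ (by simpa using hx.1.le)
      refine le_trans ?_ (Complex.abs_im_le_norm _)
      simp [abs_of_pos hT]
    have b2 : ‖∫ x : ℝ in (0 : ℝ)..T, f (x + T * Complex.I)‖ ≤ c / T ^ 2 * |T - 0| := by
      apply intervalIntegral.norm_integral_le_of_norm_le_const
      intro x hx
      rw [Set.uIoc_of_le hT.le] at hx
      apply hside _ (by simpa using hx.1.le)
      refine le_trans ?_ (Complex.abs_im_le_norm _)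
      simp [abs_of_pos hT]
    have b3 : ‖∫ y : ℝ in (-T)..T, f (T + y * Complex.I)‖ ≤ c / T ^ 2 * |T - -T| := by
      apply intervalIntegral.norm_integral_le_of_norm_le_const
      intro x hx
      apply hside _ (by simpa using hT.le)
      refine le_trans ?_ (Complex.abs_re_le_norm _)
      simp [abs_of_pos hT]
    have hI : ‖∫ ω in (-T)..T, f (ω * Complex.I)‖
        = ‖Complex.I * ∫ ω in (-T)..T, f (ω * Complex.I)‖ := by simp
    have heq : Complex.I * ∫ ω in (-T)..T, f (ω * Complex.I) =
        (∫ x : ℝ in (0 : ℝ)..T, f (x + -T * Complex.I)) -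
        (∫ x : ℝ in (0 : ℝ)..T, f (x + T * Complex.I)) +
        Complex.I * ∫ y : ℝ in (-T)..T, f (T + y * Complex.I) := by
      linear_combination -H
    rw [hI, heq]
    have h3 : ‖Complex.I * ∫ y : ℝ in (-T)..T, f (T + y * Complex.I)‖ ≤ c / T ^ 2 * |T - -T| := by
      simpa using b3
    refine (norm_add_le _ _).trans ((add_le_add ((norm_sub_le _ _).trans
      (add_le_add b1 b2)) h3).trans (le_of_eq ?_))
    rw [abs_of_pos (by linarith), abs_of_pos (by linarith)]
    field_simp
    ring
  · exact tendsto_const_nhds.div_atTop tendsto_id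

/-- The orthogonality of `H₂` and its para-conjugate, in scalar form. -/
theorem integral_mul_evalRat_eq_zero {f g : RatFunc ℝ} (hf : RatStable f) (hf' : infVal f < 1)
    (hg : RatStable g) (hg' : infVal g < 1) :
    ∫ ω : ℝ, evalRat (ω * Complex.I) f * evalRat (ω * Complex.I) g = 0 := by
  obtain ⟨c, hc0, hc⟩ := exists_decay_evalRat hf' hf
  obtain ⟨d, hd0, hd⟩ := exists_decay_evalRat hg' hg
  refine integral_imaginary_axis_eq_zero (f := fun s => evalRat s f * evalRat s g)
    (fun s hs => (differentiableAt_evalRat hf hs).mul (differentiableAt_evalRat hg hs))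
    (c := c * d) (by positivity) fun s hs => ?_
  rw [norm_mul]
  refine (mul_le_mul (hc s hs) (hd s hs) (norm_nonneg _) (by positivity)).trans (le_of_eq ?_)
  rw [div_mul_div_comm, Real.mul_self_sqrt (by positivity)]

theorem continuous_evalRat {f : RatFunc ℝ} (hf : RatStable f) :
    Continuous fun ω : ℝ => evalRat (ω * Complex.I) f := by
  rw [continuous_iff_continuousAt]
  intro ω
  exact ContinuousAt.comp (f := fun ω : ℝ => (ω : ℂ) * Complex.I)
    (g := fun s => evalRat s f) (differentiableAt_evalRat hf (by simp)).continuousAt (by fun_prop)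

theorem integrable_mul_evalRat {f g : RatFunc ℝ} (hf : RatStable f) (hf' : infVal f < 1)
    (hg : RatStable g) (hg' : infVal g < 1) :
    Integrable fun ω : ℝ => evalRat (ω * Complex.I) f * evalRat (ω * Complex.I) g := by
  obtain ⟨c, hc0, hc⟩ := exists_decay_evalRat hf' hf
  obtain ⟨d, hd0, hd⟩ := exists_decay_evalRat hg' hg
  refine integrable_of_quadratic_decay ((continuous_evalRat hf).mul (continuous_evalRat hg))
    (c := c * d) fun ω => ?_
  rw [norm_mul]
  have hs : 0 ≤ ((ω : ℂ) * Complex.I).re := by simp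
  refine (mul_le_mul (hc _ hs) (hd _ hs) (norm_nonneg _) (by positivity)).trans (le_of_eq ?_)
  rw [div_mul_div_comm, Real.mul_self_sqrt (by positivity)]
  simp

theorem integrable_star_mul_evalRat {f g : RatFunc ℝ} (hf : RatStable f) (hf' : infVal f < 1)
    (hg : RatStable g) (hg' : infVal g < 1) :
    Integrable fun ω : ℝ => star (evalRat (ω * Complex.I) f) * evalRat (ω * Complex.I) g := by
  refine (integrable_mul_evalRat hf hf' hg hg').mono
    ((continuous_star.comp (continuous_evalRat hf)).mul
      (continuous_evalRat hg)).aestronglyMeasurable (ae_of_all _ fun ω => ?_)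
  simp

/-- A proper function that does not vanish at infinity is not square integrable. -/
theorem infVal_lt_one_of_lintegral_ne_top {f : RatFunc ℝ} (hp : RatProper f)
    (hint : ∫⁻ ω : ℝ, ENNReal.ofReal (‖evalRat (ω * Complex.I) f‖ ^ 2) ≠ ⊤) : infVal f < 1 := by
  rw [infVal_lt_one_iff_ratAtInfty hp]
  by_contra hne
  set a := ‖(ratAtInfty f : ℂ)‖ with ha
  have hapos : 0 < a := by simpa [ha] using hne
  have h1 : ∀ᶠ s in cobounded ℂ, a / 2 < ‖evalRat s f‖ :=
    (tendsto_evalRat_cobounded hp).norm.eventually (lt_mem_nhds (by linarith))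
  obtain ⟨r, _, hr⟩ := (Filter.hasBasis_cobounded_norm (E := ℂ)).eventually_iff.1 h1
  have hle : ∫⁻ _ in Set.Ici |r|, ENNReal.ofReal ((a / 2) ^ 2) ≤
      ∫⁻ ω : ℝ, ENNReal.ofReal (‖evalRat (ω * Complex.I) f‖ ^ 2) := by
    refine (setLIntegral_mono_ae' measurableSet_Ici (ae_of_all _ fun ω hω => ?_)).trans
      (setLIntegral_le_lintegral _ _)
    apply ENNReal.ofReal_le_ofReal
    have : a / 2 < ‖evalRat (ω * Complex.I) f‖ := hr (by
      have h3 : |r| ≤ ω := hω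
      simpa using (le_abs_self r).trans (h3.trans (le_abs_self ω)))
    exact pow_le_pow_left₀ (by linarith) this.le 2
  rw [setLIntegral_const, Real.volume_Ici, ENNReal.mul_top (by
    simpa using hapos.ne')] at hle
  exact hint (top_le_iff.1 hle)

end RationalFunctions

/-! ### Stable, proper and strictly proper transfer matrices -/

section TransferMatrices

variable {a b c n : Type*}

/-- A stable transfer matrix that vanishes at infinity. -/
def IsStrictTF (G : Matrix a b (RatFunc ℝ)) : Prop :=
  ∀ i j, infVal (G i j) < 1 ∧ RatStable (G i j)

/-- A real matrix as a constant transfer matrix. -/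
def cst (M : Matrix a b ℝ) : Matrix a b (RatFunc ℝ) := M.map RatFunc.C

theorem cst_add (M N : Matrix a b ℝ) : cst (M + N) = cst M + cst N := by
  ext i j; simp [cst]

theorem cst_sub (M N : Matrix a b ℝ) : cst (M - N) = cst M - cst N := by
  ext i j; simp [cst]

theorem cst_neg (M : Matrix a b ℝ) : cst (-M) = -cst M := by
  ext i j; simp [cst]

theorem cst_zero : cst (0 : Matrix a b ℝ) = 0 := by
  ext i j; simp [cst]

theorem cst_one [DecidableEq a] : cst (1 : Matrix a a ℝ) = 1 := by
  simp [cst]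

theorem cst_mul [Fintype b] (M : Matrix a b ℝ) (N : Matrix b c ℝ) :
    cst (M * N) = cst M * cst N := Matrix.map_mul

theorem cst_fromBlocks {a' b' : Type*} (M₁ : Matrix a b ℝ) (M₂ : Matrix a b' ℝ)
    (M₃ : Matrix a' b ℝ) (M₄ : Matrix a' b' ℝ) :
    cst (fromBlocks M₁ M₂ M₃ M₄) = fromBlocks (cst M₁) (cst M₂) (cst M₃) (cst M₄) :=
  fromBlocks_map _ _ _ _ _

theorem cst_fromRows {a' : Type*} (M : Matrix a b ℝ) (N : Matrix a' b ℝ) :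
    cst (fromRows M N) = fromRows (cst M) (cst N) := by
  ext (i | i) j <;> rfl

theorem cst_fromCols {b' : Type*} (M : Matrix a b ℝ) (N : Matrix a b' ℝ) :
    cst (fromCols M N) = fromCols (cst M) (cst N) := by
  ext i (j | j) <;> rfl

theorem isStableTF_cst (M : Matrix a b ℝ) : IsStableTF (cst M) := fun _ _ =>
  ⟨ratProper_iff.2 (infVal_C_le _), ratStable_C _⟩

theorem isStableTF_zero : IsStableTF (0 : Matrix a b (RatFunc ℝ)) := by
  simpa [cst_zero] using isStableTF_cst (0 : Matrix a b ℝ)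

theorem isStableTF_one [DecidableEq a] : IsStableTF (1 : Matrix a a (RatFunc ℝ)) := by
  simpa [cst_one] using isStableTF_cst (1 : Matrix a a ℝ)

theorem IsStableTF.add {F G : Matrix a b (RatFunc ℝ)} (hF : IsStableTF F) (hG : IsStableTF G) :
    IsStableTF (F + G) := fun i j =>
  ⟨ratProper_iff.2 (Valuation.map_add_le _ (ratProper_iff.1 (hF i j).1)
    (ratProper_iff.1 (hG i j).1)), (hF i j).2.add (hG i j).2⟩

theorem IsStableTF.mul [Fintype b] {F : Matrix a b (RatFunc ℝ)} {G : Matrix b c (RatFunc ℝ)}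
    (hF : IsStableTF F) (hG : IsStableTF G) : IsStableTF (F * G) := fun i j => by
  rw [Matrix.mul_apply]
  refine ⟨ratProper_iff.2 (Valuation.map_sum_le _ fun k _ => ?_),
    RatStable.sum fun k _ => (hF i k).2.mul (hG k j).2⟩
  rw [map_mul]
  exact mul_le_one' (ratProper_iff.1 (hF i k).1) (ratProper_iff.1 (hG k j).1)

theorem IsStableTF.neg {G : Matrix a b (RatFunc ℝ)} (hG : IsStableTF G) : IsStableTF (-G) := by
  intro i j
  have h : (-G) i j = RatFunc.C (-1) * G i j := by simp
  rw [h]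
  refine ⟨ratProper_iff.2 ?_, (ratStable_C _).mul (hG i j).2⟩
  rw [← h, neg_apply, Valuation.map_neg]
  exact ratProper_iff.1 (hG i j).1

theorem IsStableTF.sub {F G : Matrix a b (RatFunc ℝ)} (hF : IsStableTF F) (hG : IsStableTF G) :
    IsStableTF (F - G) := by
  rw [sub_eq_add_neg]; exact hF.add hG.neg

theorem IsStrictTF.isStableTF {G : Matrix a b (RatFunc ℝ)} (hG : IsStrictTF G) : IsStableTF G :=
  fun i j => ⟨ratProper_iff.2 (hG i j).1.le, (hG i j).2⟩

theorem IsStrictTF.add {F G : Matrix a b (RatFunc ℝ)} (hF : IsStrictTF F) (hG : IsStrictTF G) :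
    IsStrictTF (F + G) := fun i j =>
  ⟨Valuation.map_add_lt _ (hF i j).1 (hG i j).1, (hF i j).2.add (hG i j).2⟩

theorem IsStrictTF.neg {G : Matrix a b (RatFunc ℝ)} (hG : IsStrictTF G) : IsStrictTF (-G) :=
  fun i j => ⟨by rw [neg_apply, Valuation.map_neg]; exact (hG i j).1, (hG.isStableTF.neg i j).2⟩

theorem IsStrictTF.sub {F G : Matrix a b (RatFunc ℝ)} (hF : IsStrictTF F) (hG : IsStrictTF G) :
    IsStrictTF (F - G) := by
  rw [sub_eq_add_neg]; exact hF.add hG.neg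

theorem infVal_mul_apply_lt_one_of_left [Fintype b] {F : Matrix a b (RatFunc ℝ)}
    {G : Matrix b c (RatFunc ℝ)} (hF : ∀ i j, infVal (F i j) < 1) (hG : IsProperTF G) (i : a)
    (j : c) : infVal ((F * G) i j) < 1 := by
  rw [Matrix.mul_apply]
  refine Valuation.map_sum_lt _ one_ne_zero fun k _ => ?_
  rw [map_mul]
  exact mul_lt_one_of_lt_of_le (hF i k) (ratProper_iff.1 (hG k j))

theorem infVal_mul_apply_lt_one_of_right [Fintype b] {F : Matrix a b (RatFunc ℝ)}
    {G : Matrix b c (RatFunc ℝ)} (hF : IsProperTF F) (hG : ∀ i j, infVal (G i j) < 1) (i : a)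
    (j : c) : infVal ((F * G) i j) < 1 := by
  rw [Matrix.mul_apply]
  refine Valuation.map_sum_lt _ one_ne_zero fun k _ => ?_
  rw [map_mul, mul_comm]
  exact mul_lt_one_of_lt_of_le (hG k j) (ratProper_iff.1 (hF i k))

theorem IsStrictTF.mul_stable [Fintype b] {F : Matrix a b (RatFunc ℝ)} {G : Matrix b c (RatFunc ℝ)}
    (hF : IsStrictTF F) (hG : IsStableTF G) : IsStrictTF (F * G) := fun i j =>
  ⟨infVal_mul_apply_lt_one_of_left (fun i j => (hF i j).1) (fun i j => (hG i j).1) i j,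
    (hF.isStableTF.mul hG i j).2⟩

theorem IsStableTF.mul_strict [Fintype b] {F : Matrix a b (RatFunc ℝ)} {G : Matrix b c (RatFunc ℝ)}
    (hF : IsStableTF F) (hG : IsStrictTF G) : IsStrictTF (F * G) := fun i j =>
  ⟨infVal_mul_apply_lt_one_of_right (fun i j => (hF i j).1) (fun i j => (hG i j).1) i j,
    (hF.mul hG.isStableTF i j).2⟩

/-! ### Evaluation on the closed right half-plane -/

/-- A real matrix as a complex matrix. -/
def cplx (M : Matrix a b ℝ) : Matrix a b ℂ := M.map (algebraMap ℝ ℂ)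

theorem cplx_add (M N : Matrix a b ℝ) : cplx (M + N) = cplx M + cplx N := by
  ext i j; simp [cplx]

theorem cplx_neg (M : Matrix a b ℝ) : cplx (-M) = -cplx M := by
  ext i j; simp [cplx]

theorem cplx_mul [Fintype b] (M : Matrix a b ℝ) (N : Matrix b c ℝ) :
    cplx (M * N) = cplx M * cplx N := Matrix.map_mul

theorem conjTranspose_cplx (M : Matrix a b ℝ) : (cplx M)ᴴ = cplx Mᵀ := by
  ext i j; simp [cplx]

theorem trace_cplx [Fintype a] (M : Matrix a a ℝ) : (cplx M).trace = (M.trace : ℂ) := by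
  simp [cplx, Matrix.trace]

theorem evalTF_cst (M : Matrix a b ℝ) (s : ℂ) : evalTF (cst M) s = cplx M := by
  ext i j; simp [evalTF, cst, cplx]

theorem evalTF_one [DecidableEq a] (s : ℂ) : evalTF (1 : Matrix a a (RatFunc ℝ)) s = 1 := by
  ext i j
  by_cases h : i = j
  · subst h; simp [evalTF]
  · simp [evalTF, h]

theorem evalTF_add {F G : Matrix a b (RatFunc ℝ)} (hF : IsStableTF F) (hG : IsStableTF G) {s : ℂ}
    (hs : 0 ≤ s.re) : evalTF (F + G) s = evalTF F s + evalTF G s := by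
  ext i j; exact evalRat_add (hF i j).2 (hG i j).2 hs

theorem evalTF_mul [Fintype b] {F : Matrix a b (RatFunc ℝ)} {G : Matrix b c (RatFunc ℝ)}
    (hF : IsStableTF F) (hG : IsStableTF G) {s : ℂ} (hs : 0 ≤ s.re) :
    evalTF (F * G) s = evalTF F s * evalTF G s := by
  ext i j
  rw [Matrix.mul_apply]
  change evalRat s ((F * G) i j) = _
  rw [Matrix.mul_apply, evalRat_sum (fun k _ => (hF i k).2.mul (hG k j).2) hs]
  exact Finset.sum_congr rfl fun k _ => evalRat_mul (hF i k).2 (hG k j).2 hs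

theorem evalTF_neg {G : Matrix a b (RatFunc ℝ)} (hG : IsStableTF G) {s : ℂ}
    (hs : 0 ≤ s.re) : evalTF (-G) s = -evalTF G s := by
  have h := evalTF_add hG hG.neg hs
  rw [add_neg_cancel] at h
  have h0 : evalTF (0 : Matrix a b (RatFunc ℝ)) s = 0 := by ext i j; simp [evalTF]
  rw [h0] at h
  exact (neg_eq_of_add_eq_zero_right h.symm).symm

theorem evalTF_sub {F G : Matrix a b (RatFunc ℝ)} (hF : IsStableTF F) (hG : IsStableTF G) {s : ℂ}
    (hs : 0 ≤ s.re) : evalTF (F - G) s = evalTF F s - evalTF G s := by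
  rw [sub_eq_add_neg, evalTF_add hF hG.neg hs, evalTF_neg hG hs, sub_eq_add_neg]

/-! ### Resolvents -/

variable [Fintype n] [DecidableEq n]

/-- The resolvent `(sI - A)⁻¹` of a real matrix. -/
def resTF (A : Matrix n n ℝ) : Matrix n n (RatFunc ℝ) :=
  (Matrix.scalar n RatFunc.X - cst A)⁻¹

theorem scalar_sub_cst_eq (A : Matrix n n ℝ) :
    Matrix.scalar n RatFunc.X - cst A =
      (algebraMap (Polynomial ℝ) (RatFunc ℝ)).mapMatrix A.charmatrix := by
  ext i j
  by_cases h : i = j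
  · subst h; simp [cst]
  · simp [cst, h]

theorem det_scalar_sub_cst (A : Matrix n n ℝ) :
    (Matrix.scalar n RatFunc.X - cst A).det = algebraMap (Polynomial ℝ) (RatFunc ℝ) A.charpoly := by
  rw [scalar_sub_cst_eq, ← RingHom.map_det]; rfl

theorem isUnit_det_scalar_sub_cst (A : Matrix n n ℝ) :
    IsUnit (Matrix.scalar n RatFunc.X - cst A).det := by
  rw [det_scalar_sub_cst, isUnit_iff_ne_zero]
  exact RatFunc.algebraMap_ne_zero A.charpoly_monic.ne_zero

theorem X_smul_resTF (A : Matrix n n ℝ) :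
    (RatFunc.X : RatFunc ℝ) • resTF A = 1 + cst A * resTF A := by
  have h : (Matrix.scalar n RatFunc.X - cst A) * resTF A = 1 :=
    Matrix.mul_nonsing_inv _ (isUnit_det_scalar_sub_cst A)
  rw [← h, Matrix.sub_mul, scalar_apply, ← smul_one_eq_diagonal, Matrix.smul_mul, Matrix.one_mul]
  abel

theorem X_smul_resTF' (A : Matrix n n ℝ) :
    (RatFunc.X : RatFunc ℝ) • resTF A = 1 + resTF A * cst A := by
  have h : resTF A * (Matrix.scalar n RatFunc.X - cst A) = 1 :=
    Matrix.nonsing_inv_mul _ (isUnit_det_scalar_sub_cst A)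
  rw [← h, Matrix.mul_sub, scalar_apply, ← smul_one_eq_diagonal, Matrix.mul_smul, Matrix.mul_one]
  abel

/-- `x = (sI - A)⁻¹ b` is the unique solution of the state equation `s x = A x + b`. -/
theorem eq_resTF_mul_iff {A : Matrix n n ℝ} {x b' : Matrix n b (RatFunc ℝ)} :
    x = resTF A * b' ↔ (RatFunc.X : RatFunc ℝ) • x = cst A * x + b' := by
  constructor
  · rintro rfl
    rw [← Matrix.smul_mul, X_smul_resTF, Matrix.add_mul, Matrix.one_mul, Matrix.mul_assoc, add_comm]
  · intro h
    have h2 := congrArg (resTF A * ·) h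
    simp only [Matrix.mul_add, Matrix.mul_smul, ← Matrix.mul_assoc] at h2
    rw [← Matrix.smul_mul, X_smul_resTF', Matrix.add_mul, Matrix.one_mul] at h2
    rw [add_comm] at h2
    exact add_left_cancel h2

/-- Comparing orders at infinity in `s (sI - A)⁻¹ = I + A (sI - A)⁻¹`. -/
theorem infVal_resTF_lt_one (A : Matrix n n ℝ) (i j : n) : infVal (resTF A i j) < 1 := by
  obtain ⟨⟨k, l⟩, -, hmax⟩ := Finset.exists_max_image (Finset.univ : Finset (n × n))
    (fun x => infVal (resTF A x.1 x.2)) ⟨(i, j), Finset.mem_univ _⟩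
  refine (hmax (i, j) (Finset.mem_univ _)).trans_lt ?_
  by_contra hge
  rw [not_lt] at hge
  have h := congrFun (congrFun (X_smul_resTF A) k) l
  rw [Matrix.smul_apply, smul_eq_mul, Matrix.add_apply, Matrix.mul_apply] at h
  have hle : infVal ((1 : Matrix n n (RatFunc ℝ)) k l + ∑ x, cst A k x * resTF A x l) ≤
      infVal (resTF A k l) := by
    refine Valuation.map_add_le _ (le_trans ?_ hge) (Valuation.map_sum_le _ fun x _ => ?_)
    · rw [Matrix.one_apply]; split_ifs <;> simp
    · rw [map_mul]
      exact (mul_le_of_le_one_left' (infVal_C_le _)).trans (hmax (x, l) (Finset.mem_univ _))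
  rw [← h, map_mul] at hle
  have hpos : 0 < infVal (resTF A k l) := lt_of_lt_of_le zero_lt_one hge
  have := mul_lt_mul_of_pos_right one_lt_infVal_X hpos
  rw [one_mul] at this
  exact absurd hle (not_le.2 this)

theorem isHurwitz_iff {A : Matrix n n ℝ} :
    IsHurwitz A ↔ ∀ s : ℂ, 0 ≤ s.re → A.charpoly.eval₂ (algebraMap ℝ ℂ) s ≠ 0 := by
  unfold IsHurwitz
  refine ⟨fun h s hs h0 => absurd (h s ?_) (not_lt.2 hs), fun h s hs => ?_⟩
  · rw [mem_spectrum_iff_isRoot_charpoly, charpoly_map, Polynomial.IsRoot, Polynomial.eval_map]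
    exact h0
  · rw [mem_spectrum_iff_isRoot_charpoly, charpoly_map, Polynomial.IsRoot, Polynomial.eval_map] at hs
    by_contra hlt
    exact h s (not_lt.1 hlt) hs

theorem IsHurwitz.transpose {A : Matrix n n ℝ} (hA : IsHurwitz A) : IsHurwitz Aᵀ := by
  rw [isHurwitz_iff] at hA ⊢
  rwa [charpoly_transpose]

theorem IsHurwitz.fromBlocks_zero₁₂ {m : Type*} [Fintype m] [DecidableEq m] {A : Matrix n n ℝ}
    {D : Matrix m m ℝ} (hA : IsHurwitz A) (hD : IsHurwitz D) (B : Matrix m n ℝ) :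
    IsHurwitz (fromBlocks A 0 B D) := by
  rw [isHurwitz_iff] at hA hD ⊢
  intro s hs
  rw [charpoly_fromBlocks_zero₁₂, Polynomial.eval₂_mul]
  exact mul_ne_zero (hA s hs) (hD s hs)

theorem isStrictTF_resTF {A : Matrix n n ℝ} (hA : IsHurwitz A) : IsStrictTF (resTF A) := by
  intro i j
  refine ⟨infVal_resTF_lt_one A i j, ratStable_of_denom_dvd (d := A.charpoly) ?_
    (isHurwitz_iff.1 hA)⟩
  have : resTF A i j = algebraMap (Polynomial ℝ) (RatFunc ℝ) (A.charmatrix.adjugate i j) /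
      algebraMap (Polynomial ℝ) (RatFunc ℝ) A.charpoly := by
    rw [resTF, Matrix.inv_def, det_scalar_sub_cst, scalar_sub_cst_eq, ← RingHom.map_adjugate,
      Ring.inverse_eq_inv', Matrix.smul_apply, smul_eq_mul, div_eq_inv_mul]
    rfl
  rw [this]
  exact RatFunc.denom_div_dvd _ _

theorem transferFn_eq (A : Matrix n n ℝ) (B : Matrix n b ℝ) (C : Matrix a n ℝ) (D : Matrix a b ℝ) :
    transferFn A B C D = cst D + cst C * resTF A * cst B := rfl

theorem infVal_transferFn_lt_one (A : Matrix n n ℝ) (B : Matrix n b ℝ) (C : Matrix a n ℝ) (i : a)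
    (j : b) : infVal (transferFn A B C 0 i j) < 1 := by
  rw [transferFn_eq, cst_zero, zero_add]
  exact infVal_mul_apply_lt_one_of_left (infVal_mul_apply_lt_one_of_right
    (fun i j => (isStableTF_cst C i j).1) (infVal_resTF_lt_one A))
    (fun i j => (isStableTF_cst B i j).1) i j

/-- `I - N` is invertible when `N` vanishes at infinity: a kernel vector `v = N v` would have an
entry of maximal valuation, and `N` lowers all valuations. -/
theorem isUnit_det_one_sub {N : Matrix n n (RatFunc ℝ)} (hN : ∀ i j, infVal (N i j) < 1) :
    IsUnit (1 - N).det := by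
  rw [isUnit_iff_ne_zero]
  intro h0
  obtain ⟨v, hv, hv0⟩ := Matrix.exists_mulVec_eq_zero_iff.2 h0
  rw [Matrix.sub_mulVec, Matrix.one_mulVec, sub_eq_zero] at hv0
  obtain ⟨i, hi⟩ := Function.ne_iff.1 hv
  obtain ⟨k, -, hmax⟩ := Finset.exists_max_image Finset.univ (fun x => infVal (v x))
    ⟨i, Finset.mem_univ _⟩
  have hk : 0 < infVal (v k) := lt_of_lt_of_le
    (zero_lt_iff.2 ((Valuation.ne_zero_iff _).2 hi)) (hmax i (Finset.mem_univ _))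
  have hlt : infVal ((N *ᵥ v) k) < infVal (v k) := by
    rw [Matrix.mulVec, dotProduct]
    refine Valuation.map_sum_lt _ hk.ne' fun x _ => ?_
    rw [map_mul]
    calc infVal (N k x) * infVal (v x) ≤ infVal (N k x) * infVal (v k) :=
          mul_le_mul_right (hmax x (Finset.mem_univ _)) _
      _ < 1 * infVal (v k) := mul_lt_mul_of_pos_right (hN k x) hk
      _ = infVal (v k) := one_mul _
  rw [← hv0] at hlt
  exact lt_irrefl _ hlt

theorem smul_evalTF_resTF {A : Matrix n n ℝ} (hA : IsHurwitz A) {s : ℂ} (hs : 0 ≤ s.re) :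
    s • evalTF (resTF A) s = 1 + cplx A * evalTF (resTF A) s := by
  have hS := (isStrictTF_resTF hA).isStableTF
  rw [← evalTF_cst A s, ← evalTF_mul (isStableTF_cst A) hS hs, ← evalTF_one s,
    ← evalTF_add isStableTF_one ((isStableTF_cst A).mul hS) hs, ← X_smul_resTF]
  ext i j
  change _ = evalRat s (RatFunc.X * resTF A i j)
  rw [evalRat_mul ratStable_X (hS i j).2 hs]
  simp [evalTF, evalRat]

theorem smul_evalTF_resTF' {A : Matrix n n ℝ} (hA : IsHurwitz A) {s : ℂ} (hs : 0 ≤ s.re) :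
    s • evalTF (resTF A) s = 1 + evalTF (resTF A) s * cplx A := by
  have hS := (isStrictTF_resTF hA).isStableTF
  rw [← evalTF_cst A s, ← evalTF_mul hS (isStableTF_cst A) hs, ← evalTF_one s,
    ← evalTF_add isStableTF_one (hS.mul (isStableTF_cst A)) hs, ← X_smul_resTF']
  ext i j
  change _ = evalRat s (RatFunc.X * resTF A i j)
  rw [evalRat_mul ratStable_X (hS i j).2 hs]
  simp [evalTF, evalRat]

end TransferMatrices

/-! ### Block-lower-triangular matrices -/

section BlockLower

variable {a₁ a₂ b₁ b₂ c₁ c₂ F : Type*} [Field F]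

/-- The upper right block vanishes. -/
def IsLower (G : Matrix (a₁ ⊕ a₂) (b₁ ⊕ b₂) F) : Prop := G.toBlocks₁₂ = 0

theorem isLower_fromBlocks (A : Matrix a₁ b₁ F) (C : Matrix a₂ b₁ F) (D : Matrix a₂ b₂ F) :
    IsLower (fromBlocks A 0 C D) := by simp [IsLower]

theorem IsLower.add {M N : Matrix (a₁ ⊕ a₂) (b₁ ⊕ b₂) F} (hM : IsLower M) (hN : IsLower N) :
    IsLower (M + N) := by
  ext i j
  have h1 := congrFun (congrFun hM i) j
  have h2 := congrFun (congrFun hN i) j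
  simp only [toBlocks₁₂, of_apply, Matrix.zero_apply] at h1 h2
  simp [toBlocks₁₂, h1, h2]

theorem IsLower.sub {M N : Matrix (a₁ ⊕ a₂) (b₁ ⊕ b₂) F} (hM : IsLower M) (hN : IsLower N) :
    IsLower (M - N) := by
  ext i j
  have h1 := congrFun (congrFun hM i) j
  have h2 := congrFun (congrFun hN i) j
  simp only [toBlocks₁₂, of_apply, Matrix.zero_apply] at h1 h2
  simp [toBlocks₁₂, h1, h2]

theorem IsLower.mul [Fintype b₁] [Fintype b₂] {M : Matrix (a₁ ⊕ a₂) (b₁ ⊕ b₂) F}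
    {N : Matrix (b₁ ⊕ b₂) (c₁ ⊕ c₂) F} (hM : IsLower M) (hN : IsLower N) : IsLower (M * N) := by
  unfold IsLower at *
  rw [← fromBlocks_toBlocks M, ← fromBlocks_toBlocks N, fromBlocks_multiply, hM, hN]
  simp

theorem isLower_one [DecidableEq a₁] [DecidableEq a₂] :
    IsLower (1 : Matrix (a₁ ⊕ a₂) (a₁ ⊕ a₂) F) := by
  rw [← fromBlocks_one]; exact isLower_fromBlocks _ _ _

theorem IsLower.inv [Fintype a₁] [Fintype a₂] [DecidableEq a₁] [DecidableEq a₂]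
    {M : Matrix (a₁ ⊕ a₂) (a₁ ⊕ a₂) F} (hM : IsLower M) : IsLower M⁻¹ := by
  by_cases hu : IsUnit M.det
  · have h := Matrix.mul_nonsing_inv M hu
    generalize M⁻¹ = N at h ⊢
    rw [← fromBlocks_toBlocks M, hM] at h hu
    rw [det_fromBlocks_zero₁₂] at hu
    rw [← fromBlocks_toBlocks N, fromBlocks_multiply, ← fromBlocks_one, fromBlocks_inj] at h
    have h12 := h.2.1
    simp only [Matrix.zero_mul, add_zero] at h12
    have h1 := congrArg (M.toBlocks₁₁⁻¹ * ·) h12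
    simp only [← Matrix.mul_assoc, Matrix.mul_zero] at h1
    rwa [Matrix.nonsing_inv_mul _ (isUnit_of_mul_isUnit_left hu), Matrix.one_mul] at h1
  · rw [Matrix.nonsing_inv_apply_not_isUnit _ hu]
    rfl

theorem isLower_cst {M : Matrix (a₁ ⊕ a₂) (b₁ ⊕ b₂) ℝ} (hM : IsLower M) : IsLower (cst M) := by
  ext i j
  have h1 := congrFun (congrFun hM i) j
  simp only [toBlocks₁₂, of_apply, Matrix.zero_apply] at h1
  simp [toBlocks₁₂, cst, h1]

theorem isLower_resTF [Fintype a₁] [Fintype a₂] [DecidableEq a₁] [DecidableEq a₂]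
    {M : Matrix (a₁ ⊕ a₂) (a₁ ⊕ a₂) ℝ} (hM : IsLower M) : IsLower (resTF M) := by
  refine IsLower.inv (IsLower.sub ?_ (isLower_cst hM))
  ext i j
  simp [toBlocks₁₂]

end BlockLower

/-! ### Feedback loops in state-space form -/

/-- State-space data of a four-block plant
`ẋ = A x + B₁ w + B₂ u`, `z = C₁ x + D₁₂ u`, `y = C₂ x + D₂₁ w`. -/
structure StatePlant (n m k p q : Type*) where
  A : Matrix n n ℝ
  B₁ : Matrix n p ℝ
  B₂ : Matrix n m ℝ
  C₁ : Matrix q n ℝ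
  C₂ : Matrix k n ℝ
  D₁₂ : Matrix q m ℝ
  D₂₁ : Matrix k p ℝ

section ResolventIdentities

variable {n : Type*} [Fintype n] [DecidableEq n]

theorem resTF_eq_add_mul (A A' : Matrix n n ℝ) :
    resTF A' = resTF A + resTF A * cst (A' - A) * resTF A' := by
  have h : resTF A' = resTF A * (1 + cst (A' - A) * resTF A') := by
    rw [eq_resTF_mul_iff, X_smul_resTF, cst_sub, Matrix.sub_mul]
    abel
  rw [Matrix.mul_assoc]
  rwa [Matrix.mul_add, Matrix.mul_one] at h

theorem resTF_eq_add_mul' (A A' : Matrix n n ℝ) :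
    resTF A' = resTF A + resTF A' * cst (A' - A) * resTF A := by
  have h := resTF_eq_add_mul A' A
  rw [← neg_sub A' A, cst_neg, Matrix.mul_neg, Matrix.neg_mul, ← sub_eq_add_neg,
    eq_sub_iff_add_eq] at h
  exact h.symm

end ResolventIdentities

namespace StatePlant

variable {n m k p q r : Type*} [Fintype n] [DecidableEq n] [Fintype m] [DecidableEq m]
  [Fintype k] [DecidableEq k] [Fintype p] [DecidableEq p]
  (G : StatePlant n m k p q)

/-- The transfer matrix `(w, u) ↦ (z, y)`. -/
def tf : Matrix (q ⊕ k) (p ⊕ m) (RatFunc ℝ) :=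
  transferFn G.A (fromCols G.B₁ G.B₂) (fromRows G.C₁ G.C₂) (fromBlocks 0 G.D₁₂ G.D₂₁ 0)

/-- The map from the residual `v = u - K x̂` of the state feedback to `z`. -/
def ctrlTF (K : Matrix m n ℝ) : Matrix q m (RatFunc ℝ) :=
  cst (G.C₁ + G.D₁₂ * K) * resTF (G.A + G.B₂ * K) * cst G.B₂ + cst G.D₁₂

/-- The map from `w` to the estimation error `x - x̂` of the observer with gain `L`. -/
def errTF (L : Matrix n k ℝ) : Matrix n p (RatFunc ℝ) :=
  resTF (G.A + L * G.C₂) * cst (G.B₁ + L * G.D₂₁)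

/-- The map from `w` to the innovation `y - C₂ x̂` of the observer with gain `L`. -/
def innovTF (L : Matrix n k ℝ) : Matrix k p (RatFunc ℝ) :=
  cst G.C₂ * G.errTF L + cst G.D₂₁

/-- The map from `w` to `z` under the observer-based feedback `u = K x̂`. -/
def nomTF (K : Matrix m n ℝ) (L : Matrix n k ℝ) : Matrix q p (RatFunc ℝ) :=
  cst (G.C₁ + G.D₁₂ * K) * resTF (G.A + G.B₂ * K) *
    (cst G.B₁ - cst G.B₂ * cst K * G.errTF L) - cst G.D₁₂ * cst K * G.errTF L

/-- The Youla parameter of a controller, in the coordinates given by the gains `K` and `L`: the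
map from the innovation `y - C₂ x̂` to the residual `u - K x̂`. -/
def youla (K : Matrix m n ℝ) (L : Matrix n k ℝ) (Kc : Matrix m k (RatFunc ℝ)) :
    Matrix m k (RatFunc ℝ) :=
  ((1 - cst K * resTF (G.A + L * G.C₂) * cst G.B₂) * Kc +
      cst K * resTF (G.A + L * G.C₂) * cst L) * (1 - G.tf.toBlocks₂₂ * Kc)⁻¹ *
    (1 - cst G.C₂ * resTF G.A * cst L)

/-- The observer-based controller whose Youla parameter is
`(Kh - K) (sI - A - B₂ Kh - Lh C₂)⁻¹ (Lh - L)`. -/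
def controller (K Kh : Matrix m n ℝ) (L Lh : Matrix n k ℝ) : Matrix m k (RatFunc ℝ) :=
  transferFn
    (fromBlocks (G.A + G.B₂ * K + Lh * G.C₂) 0
      (G.B₂ * K - G.B₂ * Kh) (G.A + L * G.C₂ + G.B₂ * Kh))
    (fromRows (-Lh) (-L)) (fromCols (K - Kh) Kh) 0

/-- The Youla parameter of `controller`. -/
def paramTF (K Kh : Matrix m n ℝ) (L Lh : Matrix n k ℝ) : Matrix m k (RatFunc ℝ) :=
  cst (Kh - K) * resTF (G.A + G.B₂ * Kh + Lh * G.C₂) * cst (Lh - L)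

theorem tf_eq : G.tf = fromBlocks (cst G.C₁ * resTF G.A * cst G.B₁)
    (cst G.C₁ * resTF G.A * cst G.B₂ + cst G.D₁₂) (cst G.C₂ * resTF G.A * cst G.B₁ + cst G.D₂₁)
    (cst G.C₂ * resTF G.A * cst G.B₂) := by
  rw [tf, transferFn_eq, cst_fromBlocks, cst_fromRows, cst_fromCols, fromRows_mul,
    fromRows_mul_fromCols, fromBlocks_add]
  simp only [cst_zero, zero_add]
  rw [add_comm (cst G.D₁₂), add_comm (cst G.D₂₁)]

/-! The signals of the loop: exogenous inputs `w` and `u₁`, control `y₂`, measurement `y₁`,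
state `x` and state estimate `xh`, as columns of rational functions. -/

variable {G} {K Kh : Matrix m n ℝ} {L Lh : Matrix n k ℝ} {x xh x₁ x₂ : Matrix n r (RatFunc ℝ)}
  {w : Matrix p r (RatFunc ℝ)} {u₁ y₁ : Matrix k r (RatFunc ℝ)} {u₂ y₂ v : Matrix m r (RatFunc ℝ)}

theorem error_eq (hx : x = resTF G.A * (cst G.B₁ * w + cst G.B₂ * y₂))
    (hy : y₁ = cst G.C₂ * x + cst G.D₂₁ * w + u₁)
    (hxh : xh = resTF (G.A + L * G.C₂) * (cst G.B₂ * y₂ - cst L * y₁)) :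
    x - xh = resTF (G.A + L * G.C₂) * (cst (G.B₁ + L * G.D₂₁) * w + cst L * u₁) := by
  rw [eq_resTF_mul_iff] at *
  rw [smul_sub, hx, hxh, hy]
  simp only [cst_add, cst_mul, Matrix.mul_add, Matrix.add_mul, Matrix.mul_sub, Matrix.mul_assoc]
  abel

theorem state_eq (hx : x = resTF G.A * (cst G.B₁ * w + cst G.B₂ * y₂))
    (hv : y₂ = v + cst K * xh) :
    x = resTF (G.A + G.B₂ * K) *
      (cst G.B₁ * w + cst G.B₂ * v - cst G.B₂ * cst K * (x - xh)) := by
  rw [eq_resTF_mul_iff] at *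
  rw [hx, hv]
  simp only [cst_add, cst_mul, Matrix.mul_add, Matrix.add_mul, Matrix.mul_sub, Matrix.mul_assoc]
  abel

theorem output_eq (hv : y₂ = v + cst K * xh) :
    cst G.C₁ * x + cst G.D₁₂ * y₂ =
      cst (G.C₁ + G.D₁₂ * K) * x + cst G.D₁₂ * v - cst G.D₁₂ * cst K * (x - xh) := by
  rw [hv]
  simp only [cst_add, cst_mul, Matrix.mul_add, Matrix.add_mul, Matrix.mul_sub, Matrix.mul_assoc]
  abel

/-- Every closed-loop map is affine in the response of the residual `u - K x̂`. -/
theorem performance_eq {x : Matrix n p (RatFunc ℝ)} {y₁ : Matrix k p (RatFunc ℝ)}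
    {xh : Matrix n p (RatFunc ℝ)} {y₂ v : Matrix m p (RatFunc ℝ)}
    (hx : x = resTF G.A * (cst G.B₁ + cst G.B₂ * y₂))
    (hy : y₁ = cst G.C₂ * x + cst G.D₂₁)
    (hxh : xh = resTF (G.A + L * G.C₂) * (cst G.B₂ * y₂ - cst L * y₁))
    (hv : y₂ = v + cst K * xh) :
    cst G.C₁ * x + cst G.D₁₂ * y₂ = G.nomTF K L + G.ctrlTF K * v ∧
      y₁ - cst G.C₂ * xh = G.innovTF L := by
  have hx' : x = resTF G.A * (cst G.B₁ * (1 : Matrix p p (RatFunc ℝ)) + cst G.B₂ * y₂) := by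
    rw [Matrix.mul_one]; exact hx
  have he : x - xh = G.errTF L := by
    rw [error_eq (u₁ := 0) hx' (by rw [hy]; simp) hxh]
    simp [errTF]
  constructor
  · rw [output_eq hv, he, state_eq hx' hv, he, nomTF, ctrlTF]
    simp only [Matrix.mul_add, Matrix.add_mul, Matrix.mul_sub, Matrix.mul_assoc, Matrix.mul_one]
    abel
  · rw [innovTF, ← he, hy, Matrix.mul_sub]
    abel

/-! ### The Youla parameter of a stabilizing controller -/

theorem closedLoop_eq (T : Matrix (q ⊕ k) (p ⊕ m) (RatFunc ℝ)) (Kc : Matrix m k (RatFunc ℝ)) :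
    closedLoop T Kc = fromRows (fromCols T.toBlocks₁₁ 0 + T.toBlocks₁₂ *
        (Kc * fromCols ((1 - T.toBlocks₂₂ * Kc)⁻¹ * T.toBlocks₂₁)
          (fromCols (1 - T.toBlocks₂₂ * Kc)⁻¹ ((1 - T.toBlocks₂₂ * Kc)⁻¹ * T.toBlocks₂₂)) +
          fromCols 0 (fromCols 0 1)))
      (fromRows
        (fromCols ((1 - T.toBlocks₂₂ * Kc)⁻¹ * T.toBlocks₂₁)
          (fromCols (1 - T.toBlocks₂₂ * Kc)⁻¹ ((1 - T.toBlocks₂₂ * Kc)⁻¹ * T.toBlocks₂₂)))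
        (Kc * fromCols ((1 - T.toBlocks₂₂ * Kc)⁻¹ * T.toBlocks₂₁)
          (fromCols (1 - T.toBlocks₂₂ * Kc)⁻¹ ((1 - T.toBlocks₂₂ * Kc)⁻¹ * T.toBlocks₂₂)) +
          fromCols 0 (fromCols 0 1))) := rfl

theorem stable_of_closedLoop {T : Matrix (q ⊕ k) (p ⊕ m) (RatFunc ℝ)} {Kc : Matrix m k (RatFunc ℝ)}
    (h : IsStableTF (closedLoop T Kc)) :
    IsStableTF (1 - T.toBlocks₂₂ * Kc)⁻¹ ∧
    IsStableTF ((1 - T.toBlocks₂₂ * Kc)⁻¹ * T.toBlocks₂₂) ∧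
    IsStableTF (Kc * (1 - T.toBlocks₂₂ * Kc)⁻¹) ∧
    IsStableTF (Kc * ((1 - T.toBlocks₂₂ * Kc)⁻¹ * T.toBlocks₂₂)) := by
  rw [closedLoop_eq, mul_fromCols, mul_fromCols] at h
  refine ⟨fun i j => h (.inr (.inl i)) (.inr (.inl j)), fun i j => h (.inr (.inl i)) (.inr (.inr j)),
    fun i j => ?_, ?_⟩
  · simpa using h (.inr (.inr i)) (.inr (.inl j))
  · have h4 : IsStableTF (Kc * ((1 - T.toBlocks₂₂ * Kc)⁻¹ * T.toBlocks₂₂) + 1) := fun i j => by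
      simpa using h (.inr (.inr i)) (.inr (.inr j))
    simpa using h4.sub isStableTF_one

theorem isUnit_det_one_sub_tf {Kc : Matrix m k (RatFunc ℝ)} (hp : IsProperTF Kc) :
    IsUnit (1 - G.tf.toBlocks₂₂ * Kc).det := by
  refine isUnit_det_one_sub (infVal_mul_apply_lt_one_of_left (fun i j => ?_) hp)
  rw [tf_eq, toBlocks_fromBlocks₂₂]
  simpa [transferFn_eq, cst_zero] using infVal_transferFn_lt_one G.A G.B₂ G.C₂ i j

theorem isStableTF_youla {Kc : Matrix m k (RatFunc ℝ)}
    (hK : IsHurwitz (G.A + G.B₂ * K)) (hL : IsHurwitz (G.A + L * G.C₂))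
    (h : IsStableTF (closedLoop G.tf Kc)) : IsStableTF (G.youla K L Kc) := by
  obtain ⟨h1, h2, h3, h4⟩ := stable_of_closedLoop h
  have hΩ := (isStrictTF_resTF hK).isStableTF
  have hΛ := (isStrictTF_resTF hL).isStableTF
  have key : G.youla K L Kc =
      (Kc * (1 - G.tf.toBlocks₂₂ * Kc)⁻¹ - cst K * resTF (G.A + L * G.C₂) *
        (cst G.B₂ * (Kc * (1 - G.tf.toBlocks₂₂ * Kc)⁻¹) -
          cst L * (1 - G.tf.toBlocks₂₂ * Kc)⁻¹)) *
        (1 - cst G.C₂ * resTF (G.A + G.B₂ * K) * cst L) +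
      (Kc * ((1 - G.tf.toBlocks₂₂ * Kc)⁻¹ * G.tf.toBlocks₂₂) - cst K * resTF (G.A + L * G.C₂) *
        (cst G.B₂ * (Kc * ((1 - G.tf.toBlocks₂₂ * Kc)⁻¹ * G.tf.toBlocks₂₂)) -
          cst L * ((1 - G.tf.toBlocks₂₂ * Kc)⁻¹ * G.tf.toBlocks₂₂))) *
        (cst K * resTF (G.A + G.B₂ * K) * cst L) := by
    have hT : G.tf.toBlocks₂₂ = cst G.C₂ * resTF G.A * cst G.B₂ := by
      rw [tf_eq, toBlocks_fromBlocks₂₂]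
    have hr : 1 - cst G.C₂ * resTF G.A * cst L =
        (1 - cst G.C₂ * resTF (G.A + G.B₂ * K) * cst L) +
          G.tf.toBlocks₂₂ * (cst K * resTF (G.A + G.B₂ * K) * cst L) := by
      rw [hT]
      nth_rw 1 [resTF_eq_add_mul G.A (G.A + G.B₂ * K)]
      rw [add_sub_cancel_left, cst_mul]
      simp only [Matrix.mul_add, Matrix.add_mul, Matrix.mul_assoc]
      abel
    rw [youla, hr]
    generalize (1 - G.tf.toBlocks₂₂ * Kc)⁻¹ = S
    simp only [Matrix.mul_add, Matrix.add_mul, Matrix.mul_sub, Matrix.sub_mul, Matrix.mul_assoc,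
      Matrix.mul_one, Matrix.one_mul]
    abel
  rw [key]
  refine IsStableTF.add (IsStableTF.mul (h3.sub (((isStableTF_cst _).mul hΛ).mul
    (((isStableTF_cst _).mul h3).sub ((isStableTF_cst _).mul h1))))
    (isStableTF_one.sub (((isStableTF_cst _).mul hΩ).mul (isStableTF_cst _)))) ?_
  exact (h4.sub (((isStableTF_cst _).mul hΛ).mul
    (((isStableTF_cst _).mul h4).sub ((isStableTF_cst _).mul h2)))).mul
    (((isStableTF_cst _).mul hΩ).mul (isStableTF_cst _))

theorem tf₂₁_eq_mul_innovTF (L : Matrix n k ℝ) :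
    G.tf.toBlocks₂₁ = (1 - cst G.C₂ * resTF G.A * cst L) * G.innovTF L := by
  have h := resTF_eq_add_mul G.A (G.A + L * G.C₂)
  rw [add_sub_cancel_left, cst_mul] at h
  have h2 : resTF G.A * cst L * cst G.C₂ * resTF (G.A + L * G.C₂) =
      resTF (G.A + L * G.C₂) - resTF G.A := by
    nth_rw 2 [h]
    simp only [Matrix.mul_assoc]
    abel
  have h3 : cst G.C₂ * (resTF G.A * cst L * cst G.C₂ * resTF (G.A + L * G.C₂)) *
      cst (G.B₁ + L * G.D₂₁) = cst G.C₂ * (resTF (G.A + L * G.C₂) - resTF G.A) *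
      cst (G.B₁ + L * G.D₂₁) := by rw [h2]
  rw [tf_eq, toBlocks_fromBlocks₂₁, innovTF, errTF]
  simp only [cst_add, cst_mul, Matrix.mul_add, Matrix.mul_sub, Matrix.sub_mul, Matrix.mul_assoc,
    Matrix.one_mul] at h3 ⊢
  linear_combination (norm := abel) h3

theorem exists_loop_signals {Kc : Matrix m k (RatFunc ℝ)} (hp : IsProperTF Kc) (K : Matrix m n ℝ)
    (L : Matrix n k ℝ) : ∃ (y₁ : Matrix k p (RatFunc ℝ)) (xh : Matrix n p (RatFunc ℝ)),
      y₁ = (1 - G.tf.toBlocks₂₂ * Kc)⁻¹ * G.tf.toBlocks₂₁ ∧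
      xh = resTF (G.A + L * G.C₂) * (cst G.B₂ * (Kc * y₁) - cst L * y₁) ∧
      y₁ - cst G.C₂ * xh = G.innovTF L ∧
      lowerLFT G.tf Kc = G.nomTF K L + G.ctrlTF K * (Kc * y₁ - cst K * xh) := by
  have hS := Matrix.mul_nonsing_inv _ (isUnit_det_one_sub_tf (G := G) hp)
  set S := (1 - G.tf.toBlocks₂₂ * Kc)⁻¹ with hSdef
  set y₁ := S * G.tf.toBlocks₂₁ with hy₁
  set y₂ := Kc * y₁ with hy₂
  set x := resTF G.A * (cst G.B₁ + cst G.B₂ * y₂) with hx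
  set xh := resTF (G.A + L * G.C₂) * (cst G.B₂ * y₂ - cst L * y₁) with hxh
  have hloop : y₁ = cst G.C₂ * x + cst G.D₂₁ := by
    have h1 : (1 - G.tf.toBlocks₂₂ * Kc) * y₁ = G.tf.toBlocks₂₁ := by
      rw [hy₁, ← Matrix.mul_assoc, hS, Matrix.one_mul]
    rw [Matrix.sub_mul, Matrix.one_mul, sub_eq_iff_eq_add, Matrix.mul_assoc, ← hy₂] at h1
    rw [h1, tf_eq, toBlocks_fromBlocks₂₁, toBlocks_fromBlocks₂₂, hx]
    simp only [Matrix.mul_add, Matrix.mul_assoc]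
    abel
  have hperf := performance_eq (K := K) (v := y₂ - cst K * xh) hx hloop hxh (by abel)
  refine ⟨y₁, xh, rfl, hxh, hperf.2, ?_⟩
  rw [← hperf.1, lowerLFT, ← hSdef, Matrix.mul_assoc _ S, ← hy₁, Matrix.mul_assoc _ Kc, ← hy₂,
    tf_eq, toBlocks_fromBlocks₁₁, toBlocks_fromBlocks₁₂, hx]
  simp only [Matrix.mul_add, Matrix.add_mul, Matrix.mul_assoc]
  abel

/-- Every proper controller has closed-loop map `T₁₁ + T₁₂ Q T₂₁`, with `Q` its Youla
parameter. -/
theorem lowerLFT_eq_youla {Kc : Matrix m k (RatFunc ℝ)} (hp : IsProperTF Kc) (K : Matrix m n ℝ)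
    (L : Matrix n k ℝ) :
    lowerLFT G.tf Kc = G.nomTF K L + G.ctrlTF K * G.youla K L Kc * G.innovTF L := by
  obtain ⟨y₁, xh, hy₁, hxh, -, h⟩ := exists_loop_signals (G := G) hp K L
  rw [h, Matrix.mul_assoc, youla, Matrix.mul_assoc _ _ (G.innovTF L), ← tf₂₁_eq_mul_innovTF,
    Matrix.mul_assoc _ _ G.tf.toBlocks₂₁, ← hy₁, hxh]
  simp only [Matrix.mul_add, Matrix.add_mul, Matrix.mul_sub, Matrix.sub_mul, Matrix.mul_assoc, Matrix.one_mul]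
  abel

/-! ### The observer-based controllers -/

theorem controller_residual (hy₂ : y₂ = G.controller K Kh L Lh * y₁ + u₂)
    (hxh : xh = resTF (G.A + L * G.C₂) * (cst G.B₂ * y₂ - cst L * y₁)) :
    y₂ - cst K * xh = G.paramTF K Kh L Lh *
        (y₁ - cst G.C₂ * xh + cst G.C₂ * (resTF (G.A + L * G.C₂) * (cst G.B₂ * u₂))) + u₂ -
      cst K * (resTF (G.A + L * G.C₂) * (cst G.B₂ * u₂)) := by
  set ξ := resTF (fromBlocks (G.A + G.B₂ * K + Lh * G.C₂) 0
      (G.B₂ * K - G.B₂ * Kh) (G.A + L * G.C₂ + G.B₂ * Kh)) *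
      (cst (fromRows (-Lh) (-L)) * y₁) with hξ
  have hy : y₂ = cst (fromCols (K - Kh) Kh) * ξ + u₂ := by
    rw [hy₂, controller, transferFn_eq, cst_zero, zero_add, hξ]
    simp only [Matrix.mul_assoc]
  rw [eq_resTF_mul_iff] at hξ
  obtain ⟨x₁, x₂, hx⟩ : ∃ x₁ x₂ : Matrix n r (RatFunc ℝ), ξ = fromRows x₁ x₂ :=
    ⟨ξ.toRows₁, ξ.toRows₂, (fromRows_toRows ξ).symm⟩
  rw [hx] at hξ hy
  rw [cst_fromCols, fromCols_mul_fromRows] at hy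
  have hsm : (RatFunc.X : RatFunc ℝ) • fromRows x₁ x₂ =
      fromRows ((RatFunc.X : RatFunc ℝ) • x₁) ((RatFunc.X : RatFunc ℝ) • x₂) := by
    ext (i | i) j <;> rfl
  have hadd : ∀ (a b : Matrix n r (RatFunc ℝ)) (c d : Matrix n r (RatFunc ℝ)),
      fromRows a b + fromRows c d = fromRows (a + c) (b + d) := by
    intro a b c d; ext (i | i) j <;> rfl
  rw [hsm, cst_fromBlocks, cst_fromRows, fromBlocks_mul_fromRows, fromRows_mul, hadd] at hξ
  obtain ⟨h1, h2⟩ := fromRows_inj hξ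
  -- the second controller state is the state estimate, up to the effect of `u₂`
  have hε : xh - x₂ = resTF (G.A + L * G.C₂) * (cst G.B₂ * u₂) := by
    rw [eq_resTF_mul_iff] at hxh ⊢
    rw [smul_sub, hxh, h2, hy]
    simp only [cst_add, cst_sub, cst_neg, cst_mul, Matrix.mul_add, Matrix.add_mul, Matrix.mul_sub,
      Matrix.sub_mul, Matrix.neg_mul, Matrix.mul_assoc]
    abel
  have hδ : x₂ - x₁ = resTF (G.A + G.B₂ * Kh + Lh * G.C₂) *
      (cst (Lh - L) * (y₁ - cst G.C₂ * x₂)) := by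
    rw [eq_resTF_mul_iff, smul_sub, h1, h2]
    simp only [cst_add, cst_sub, cst_neg, cst_mul, cst_zero, Matrix.add_mul,
      Matrix.mul_sub, Matrix.sub_mul, Matrix.neg_mul, Matrix.mul_assoc, Matrix.zero_mul]
    abel
  have hx₂ : y₁ - cst G.C₂ * xh + cst G.C₂ * (resTF (G.A + L * G.C₂) * (cst G.B₂ * u₂)) =
      y₁ - cst G.C₂ * x₂ := by
    rw [← hε, Matrix.mul_sub]; abel
  rw [hx₂, paramTF, Matrix.mul_assoc, Matrix.mul_assoc, ← hδ, ← hε, hy]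
  simp only [cst_sub, Matrix.mul_sub, Matrix.sub_mul]
  abel

theorem isStableTF_fromRows {a a' b : Type*} {F : Matrix a b (RatFunc ℝ)}
    {F' : Matrix a' b (RatFunc ℝ)} (h : IsStableTF F) (h' : IsStableTF F') :
    IsStableTF (fromRows F F') := by
  rintro (i | i) j
  exacts [h i j, h' i j]

theorem isStableTF_fromCols {a b b' : Type*} {F : Matrix a b (RatFunc ℝ)}
    {F' : Matrix a b' (RatFunc ℝ)} (h : IsStableTF F) (h' : IsStableTF F') :
    IsStableTF (fromCols F F') := by
  rintro i (j | j)
  exacts [h i j, h' i j]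

theorem isStrictTF_paramTF (hh : IsHurwitz (G.A + G.B₂ * Kh + Lh * G.C₂)) :
    IsStrictTF (G.paramTF K Kh L Lh) :=
  ((isStableTF_cst _).mul_strict (isStrictTF_resTF hh)).mul_stable (isStableTF_cst _)

theorem isProperTF_controller : IsProperTF (G.controller K Kh L Lh) := fun i j =>
  ratProper_iff.2 (infVal_transferFn_lt_one _ _ _ i j).le

theorem lowerLFT_controller :
    lowerLFT G.tf (G.controller K Kh L Lh) =
      G.nomTF K L + G.ctrlTF K * G.paramTF K Kh L Lh * G.innovTF L := by
  obtain ⟨y₁, xh, -, hxh, hν, h⟩ := exists_loop_signals (G := G)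
    (isProperTF_controller (G := G) (K := K) (Kh := Kh) (L := L) (Lh := Lh)) K L
  have hres := controller_residual (u₂ := 0) (add_zero _).symm hxh
  simp only [Matrix.mul_zero, add_zero, sub_zero] at hres
  rw [h, hres, hν, Matrix.mul_assoc (G.ctrlTF K)]

/-- Internal stability: the residual is a stable image of the innovation, and all other signals
are stable images of the residual, of `w` and of the estimation error. -/
theorem isStableTF_closedLoop_controller (hK : IsHurwitz (G.A + G.B₂ * K))
    (hL : IsHurwitz (G.A + L * G.C₂)) (hh : IsHurwitz (G.A + G.B₂ * Kh + Lh * G.C₂)) :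
    IsStableTF (closedLoop G.tf (G.controller K Kh L Lh)) := by
  set Kc := G.controller K Kh L Lh with hKc
  have hu := isUnit_det_one_sub_tf (G := G) (Kc := Kc) isProperTF_controller
  have hS := Matrix.mul_nonsing_inv _ hu
  rw [closedLoop_eq]
  set S := (1 - G.tf.toBlocks₂₂ * Kc)⁻¹ with hSdef
  set y₁ := fromCols (S * G.tf.toBlocks₂₁) (fromCols S (S * G.tf.toBlocks₂₂)) with hy₁
  set u₂ : Matrix m (p ⊕ (k ⊕ m)) (RatFunc ℝ) := fromCols 0 (fromCols 0 1) with hu₂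
  set u₁ : Matrix k (p ⊕ (k ⊕ m)) (RatFunc ℝ) := fromCols 0 (fromCols 1 0) with hu₁
  set w : Matrix p (p ⊕ (k ⊕ m)) (RatFunc ℝ) := fromCols 1 0 with hw
  set y₂ := Kc * y₁ + u₂ with hy₂
  set x := resTF G.A * (cst G.B₁ * w + cst G.B₂ * y₂) with hx
  set xh := resTF (G.A + L * G.C₂) * (cst G.B₂ * y₂ - cst L * y₁) with hxh
  have hloop : y₁ = cst G.C₂ * x + cst G.D₂₁ * w + u₁ := by
    have h1 : (1 - G.tf.toBlocks₂₂ * Kc) * y₁ =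
        G.tf.toBlocks₂₁ * w + G.tf.toBlocks₂₂ * u₂ + u₁ := by
      rw [hy₁, mul_fromCols, mul_fromCols, ← Matrix.mul_assoc, hS, ← Matrix.mul_assoc, hS, hw, hu₁,
        hu₂]
      ext i (j | j | j) <;> simp [mul_fromCols]
    rw [Matrix.sub_mul, Matrix.one_mul, sub_eq_iff_eq_add, Matrix.mul_assoc] at h1
    rw [h1, tf_eq, toBlocks_fromBlocks₂₁, toBlocks_fromBlocks₂₂, hx, hy₂]
    simp only [Matrix.mul_add, Matrix.add_mul, Matrix.mul_assoc]
    abel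
  have hΩ := (isStrictTF_resTF hK).isStableTF
  have hΛ := (isStrictTF_resTF hL).isStableTF
  have sw : IsStableTF w := isStableTF_fromCols isStableTF_one isStableTF_zero
  have su₁ : IsStableTF u₁ :=
    isStableTF_fromCols isStableTF_zero (isStableTF_fromCols isStableTF_one isStableTF_zero)
  have su₂ : IsStableTF u₂ :=
    isStableTF_fromCols isStableTF_zero (isStableTF_fromCols isStableTF_zero isStableTF_one)
  have he := error_eq hx hloop hxh
  have se : IsStableTF (x - xh) := by
    rw [he]
    exact hΛ.mul (((isStableTF_cst _).mul sw).add ((isStableTF_cst _).mul su₁))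
  have hν : y₁ - cst G.C₂ * xh = cst G.C₂ * (x - xh) + cst G.D₂₁ * w + u₁ := by
    rw [Matrix.mul_sub]; nth_rw 1 [hloop]; abel
  have sν : IsStableTF (y₁ - cst G.C₂ * xh) := by
    rw [hν]
    exact (((isStableTF_cst _).mul se).add ((isStableTF_cst _).mul sw)).add su₁
  have sε : IsStableTF (resTF (G.A + L * G.C₂) * (cst G.B₂ * u₂)) :=
    hΛ.mul ((isStableTF_cst _).mul su₂)
  have sv : IsStableTF (y₂ - cst K * xh) := by
    rw [controller_residual hy₂ hxh]
    exact (((isStrictTF_paramTF hh).isStableTF.mul (sν.add ((isStableTF_cst _).mul sε))).add su₂).sub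
      ((isStableTF_cst _).mul sε)
  have hv : y₂ = (y₂ - cst K * xh) + cst K * xh := by abel
  have sx : IsStableTF x := by
    rw [state_eq hx hv]
    exact hΩ.mul ((((isStableTF_cst _).mul sw).add ((isStableTF_cst _).mul sv)).sub
      (((isStableTF_cst _).mul (isStableTF_cst _)).mul se))
  have sxh : IsStableTF xh := by
    have : xh = x - (x - xh) := by abel
    rw [this]; exact sx.sub se
  have sy₂ : IsStableTF y₂ := by
    rw [hv]; exact sv.add ((isStableTF_cst _).mul sxh)
  have sy₁ : IsStableTF y₁ := by
    rw [hloop]; exact (((isStableTF_cst _).mul sx).add ((isStableTF_cst _).mul sw)).add su₁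
  have hz : fromCols G.tf.toBlocks₁₁ 0 + G.tf.toBlocks₁₂ * y₂ = cst G.C₁ * x + cst G.D₁₂ * y₂ := by
    have h1 : fromCols G.tf.toBlocks₁₁ 0 = G.tf.toBlocks₁₁ * w := by
      rw [hw, mul_fromCols, Matrix.mul_one, Matrix.mul_zero]
    rw [h1, tf_eq, toBlocks_fromBlocks₁₁, toBlocks_fromBlocks₁₂, hx]
    simp only [Matrix.mul_add, Matrix.add_mul, Matrix.mul_assoc]
    abel
  rw [hz]
  exact isStableTF_fromRows (((isStableTF_cst _).mul sx).add ((isStableTF_cst _).mul sy₂))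
    (isStableTF_fromRows sy₁ sy₂)

theorem stabilizes_controller (hK : IsHurwitz (G.A + G.B₂ * K))
    (hL : IsHurwitz (G.A + L * G.C₂)) (hh : IsHurwitz (G.A + G.B₂ * Kh + Lh * G.C₂)) :
    Stabilizes G.tf (G.controller K Kh L Lh) := by
  refine ⟨?_, isStableTF_closedLoop_controller hK hL hh⟩
  have h0 : G.tf.toBlocks₂₂.map ratAtInfty = 0 := by
    ext i j
    have h := infVal_transferFn_lt_one G.A G.B₂ G.C₂ i j
    rw [tf_eq, toBlocks_fromBlocks₂₂]
    rw [transferFn_eq, cst_zero, zero_add] at h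
    exact (infVal_lt_one_iff_ratAtInfty (ratProper_iff.2 h.le)).1 h
  rw [h0, Matrix.zero_mul, sub_zero]
  exact isUnit_one

/-! ### Change of gains -/

theorem ctrlTF_eq_mul (K F : Matrix m n ℝ) : G.ctrlTF F = G.ctrlTF K *
    (1 + cst (F - K) * resTF (G.A + G.B₂ * F) * cst G.B₂) := by
  have h := resTF_eq_add_mul (G.A + G.B₂ * K) (G.A + G.B₂ * F)
  rw [add_sub_add_left_eq_sub, ← Matrix.mul_sub, cst_mul] at h
  have h2 : cst (G.C₁ + G.D₁₂ * K) * resTF (G.A + G.B₂ * F) * cst G.B₂ =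
      cst (G.C₁ + G.D₁₂ * K) * (resTF (G.A + G.B₂ * K) + resTF (G.A + G.B₂ * K) *
        (cst G.B₂ * cst (F - K)) * resTF (G.A + G.B₂ * F)) * cst G.B₂ := by
    rw [← h]
  rw [ctrlTF, ctrlTF]
  simp only [cst_add, cst_sub, cst_mul, Matrix.mul_add, Matrix.add_mul, Matrix.mul_sub,
    Matrix.sub_mul, Matrix.mul_assoc, Matrix.mul_one] at h2 ⊢
  linear_combination (norm := abel) h2

theorem innovTF_eq_mul (L H : Matrix n k ℝ) : G.innovTF H =
    (1 + cst G.C₂ * resTF (G.A + H * G.C₂) * cst (H - L)) * G.innovTF L := by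
  have h := resTF_eq_add_mul' (G.A + L * G.C₂) (G.A + H * G.C₂)
  rw [add_sub_add_left_eq_sub, ← Matrix.sub_mul, cst_mul] at h
  have h2 : cst G.C₂ * resTF (G.A + H * G.C₂) * cst (G.B₁ + L * G.D₂₁) =
      cst G.C₂ * (resTF (G.A + L * G.C₂) + resTF (G.A + H * G.C₂) *
        (cst (H - L) * cst G.C₂) * resTF (G.A + L * G.C₂)) * cst (G.B₁ + L * G.D₂₁) := by
    rw [← h]
  rw [innovTF, innovTF, errTF, errTF]
  simp only [cst_add, cst_sub, cst_mul, Matrix.mul_add, Matrix.add_mul, Matrix.mul_sub,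
    Matrix.sub_mul, Matrix.mul_assoc, Matrix.one_mul] at h2 ⊢
  linear_combination (norm := abel) h2

end StatePlant

/-! ### The inner product of `H₂` -/

section HardySpace

open MeasureTheory

section InnerProduct

variable {a b c d n : Type*} [Fintype a] [Fintype b] [Fintype c] [Fintype d]

/-- The real inner product whose norm is `h2Norm` on stable strictly proper transfer matrices. -/
def h2Inner (F G : Matrix a b (RatFunc ℝ)) : ℝ :=
  1 / (2 * Real.pi) *
    ∫ ω : ℝ, (((evalTF F (ω * Complex.I))ᴴ * evalTF G (ω * Complex.I)).trace).re

theorem trace_conjTranspose_mul_eq (M N : Matrix a b ℂ) :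
    (Mᴴ * N).trace = ∑ j, ∑ i, star (M i j) * N i j := by
  simp [Matrix.trace, Matrix.mul_apply]

theorem trace_conjTranspose_mul_self_re (M : Matrix a b ℂ) :
    ((Mᴴ * M).trace).re = ∑ j, ∑ i, ‖M i j‖ ^ 2 := by
  rw [trace_conjTranspose_mul_eq, Complex.re_sum]
  refine Finset.sum_congr rfl fun j _ => ?_
  rw [Complex.re_sum]
  refine Finset.sum_congr rfl fun i _ => ?_
  rw [← Complex.normSq_eq_norm_sq, Complex.normSq_apply]
  simp

theorem integrable_trace {F G : Matrix a b (RatFunc ℝ)} (hF : IsStrictTF F) (hG : IsStrictTF G) :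
    Integrable fun ω : ℝ =>
      (((evalTF F (ω * Complex.I))ᴴ * evalTF G (ω * Complex.I)).trace).re := by
  refine Integrable.re (f := fun ω : ℝ =>
    ((evalTF F (ω * Complex.I))ᴴ * evalTF G (ω * Complex.I)).trace) ?_
  simp_rw [trace_conjTranspose_mul_eq]
  exact integrable_finsetSum _ fun j _ => integrable_finsetSum _ fun i _ =>
    integrable_star_mul_evalRat (hF i j).2 (hF i j).1 (hG i j).2 (hG i j).1

theorem h2Inner_self_nonneg (F : Matrix a b (RatFunc ℝ)) : 0 ≤ h2Inner F F := by
  refine mul_nonneg (by positivity) (integral_nonneg fun ω => ?_)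
  change 0 ≤ Complex.re _
  rw [trace_conjTranspose_mul_self_re]
  positivity

theorem h2Norm_eq {F : Matrix a b (RatFunc ℝ)} (hF : IsStrictTF F) :
    h2Norm F = ENNReal.ofReal (h2Inner F F) ^ (1 / 2 : ℝ) := by
  rw [h2Norm, h2Inner, ENNReal.ofReal_mul (by positivity),
    ofReal_integral_eq_lintegral_ofReal (integrable_trace hF hF)]
  exact Filter.Eventually.of_forall fun ω => by
    change 0 ≤ Complex.re _
    rw [trace_conjTranspose_mul_self_re]
    positivity

theorem h2Norm_ne_top {F : Matrix a b (RatFunc ℝ)} (hF : IsStrictTF F) : h2Norm F ≠ ⊤ := by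
  rw [h2Norm_eq hF]
  exact ENNReal.rpow_ne_top_of_nonneg (by norm_num) ENNReal.ofReal_ne_top

theorem h2Norm_toReal_sq {F : Matrix a b (RatFunc ℝ)} (hF : IsStrictTF F) :
    (h2Norm F).toReal ^ 2 = h2Inner F F := by
  rw [h2Norm_eq hF, ← ENNReal.toReal_rpow, ENNReal.toReal_ofReal (h2Inner_self_nonneg F),
    ← Real.sqrt_eq_rpow, Real.sq_sqrt (h2Inner_self_nonneg F)]

theorem h2Inner_add_self {F G : Matrix a b (RatFunc ℝ)} (hF : IsStrictTF F) (hG : IsStrictTF G) :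
    h2Inner (F + G) (F + G) = h2Inner F F + 2 * h2Inner F G + h2Inner G G := by
  have h : ∀ ω : ℝ, (((evalTF (F + G) (ω * Complex.I))ᴴ *
      evalTF (F + G) (ω * Complex.I)).trace).re =
      ((((evalTF F (ω * Complex.I))ᴴ * evalTF F (ω * Complex.I)).trace).re +
      2 * (((evalTF F (ω * Complex.I))ᴴ * evalTF G (ω * Complex.I)).trace).re) +
      (((evalTF G (ω * Complex.I))ᴴ * evalTF G (ω * Complex.I)).trace).re := by
    intro ω
    rw [evalTF_add hF.isStableTF hG.isStableTF (by simp)]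
    generalize evalTF F (ω * Complex.I) = M
    generalize evalTF G (ω * Complex.I) = N
    have hsym : ((Nᴴ * M).trace).re = ((Mᴴ * N).trace).re := by
      rw [← Matrix.conjTranspose_conjTranspose M, ← Matrix.conjTranspose_mul, trace_conjTranspose,
        Matrix.conjTranspose_conjTranspose]
      simp
    simp only [Matrix.conjTranspose_add, Matrix.add_mul, Matrix.mul_add, Matrix.trace_add,
      Complex.add_re, hsym]
    ring
  have h1 := integral_add (integrable_trace hF hF) ((integrable_trace hF hG).const_mul 2)
  have h2 := integral_add ((integrable_trace hF hF).add ((integrable_trace hF hG).const_mul 2))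
    (integrable_trace hG hG)
  simp only [Pi.add_apply] at h2
  rw [h2Inner, integral_congr_ae (ae_of_all _ h), h2, h1, integral_const_mul]
  simp only [h2Inner]
  ring

theorem h2Inner_add_left {F F' G : Matrix a b (RatFunc ℝ)} (hF : IsStrictTF F)
    (hF' : IsStrictTF F') (hG : IsStrictTF G) :
    h2Inner (F + F') G = h2Inner F G + h2Inner F' G := by
  rw [h2Inner, h2Inner, h2Inner, ← mul_add,
    ← integral_add (integrable_trace hF hG) (integrable_trace hF' hG)]
  congr 2 with ω
  rw [evalTF_add hF.isStableTF hF'.isStableTF (by simp), Matrix.conjTranspose_add, Matrix.add_mul,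
    Matrix.trace_add, Complex.add_re]

theorem h2Inner_add_right {F G G' : Matrix a b (RatFunc ℝ)} (hF : IsStrictTF F)
    (hG : IsStrictTF G) (hG' : IsStrictTF G') :
    h2Inner F (G + G') = h2Inner F G + h2Inner F G' := by
  rw [h2Inner, h2Inner, h2Inner, ← mul_add,
    ← integral_add (integrable_trace hF hG) (integrable_trace hF hG')]
  congr 2 with ω
  rw [evalTF_add hG.isStableTF hG'.isStableTF (by simp), Matrix.mul_add,
    Matrix.trace_add, Complex.add_re]

/-- Adding an orthogonal transfer matrix does not decrease the norm. -/
theorem h2Norm_le_add {F G : Matrix a b (RatFunc ℝ)} (hF : IsStrictTF F) (hG : IsStrictTF G)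
    (h : h2Inner F G = 0) : h2Norm F ≤ h2Norm (F + G) := by
  rw [h2Norm_eq hF, h2Norm_eq (hF.add hG), h2Inner_add_self hF hG, h]
  refine ENNReal.rpow_le_rpow (ENNReal.ofReal_le_ofReal ?_) (by norm_num)
  have := h2Inner_self_nonneg G
  linarith

/-- If `tr (F* G)` agrees on the imaginary axis with `tr (Δ Z)` for stable strictly proper `Δ` and
`Z`, then `F` and `G` are orthogonal. -/
theorem h2Inner_eq_zero {F G : Matrix a b (RatFunc ℝ)} {Δ : Matrix c d (RatFunc ℝ)}
    {Z : Matrix d c (RatFunc ℝ)} (hΔ : IsStrictTF Δ) (hZ : IsStrictTF Z)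
    (h : ∀ ω : ℝ, ((evalTF F (ω * Complex.I))ᴴ * evalTF G (ω * Complex.I)).trace =
      (evalTF Δ (ω * Complex.I) * evalTF Z (ω * Complex.I)).trace) : h2Inner F G = 0 := by
  have hint : ∀ i j, Integrable fun ω : ℝ =>
      evalRat (ω * Complex.I) (Δ i j) * evalRat (ω * Complex.I) (Z j i) := fun i j =>
    integrable_mul_evalRat (hΔ i j).2 (hΔ i j).1 (hZ j i).2 (hZ j i).1
  have hexp : (fun ω : ℝ => (evalTF Δ (ω * Complex.I) * evalTF Z (ω * Complex.I)).trace) =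
      fun ω : ℝ => ∑ i, ∑ j, evalRat (ω * Complex.I) (Δ i j) * evalRat (ω * Complex.I) (Z j i) := by
    ext ω
    simp [Matrix.trace, Matrix.mul_apply, evalTF, evalRat]
  have h0 : ∫ ω : ℝ, (evalTF Δ (ω * Complex.I) * evalTF Z (ω * Complex.I)).trace = 0 := by
    rw [hexp, integral_finsetSum _ fun i _ => integrable_finsetSum _ fun j _ => hint i j]
    refine Finset.sum_eq_zero fun i _ => ?_
    rw [integral_finsetSum _ fun j _ => hint i j]
    exact Finset.sum_eq_zero fun j _ =>
      integral_mul_evalRat_eq_zero (hΔ i j).2 (hΔ i j).1 (hZ j i).2 (hZ j i).1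
  have hi : Integrable fun ω : ℝ =>
      (evalTF Δ (ω * Complex.I) * evalTF Z (ω * Complex.I)).trace := by
    rw [hexp]
    exact integrable_finsetSum _ fun i _ => integrable_finsetSum _ fun j _ => hint i j
  rw [h2Inner]
  simp_rw [h]
  have hre := integral_re hi
  simp only [RCLike.re_to_complex] at hre
  rw [hre, h0]
  simp

/-- A stable transfer matrix of finite norm vanishes at infinity. -/
theorem isStrictTF_of_h2Norm_ne_top {F : Matrix a b (RatFunc ℝ)} (hF : IsStableTF F)
    (h : h2Norm F ≠ ⊤) : IsStrictTF F := by
  intro i j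
  refine ⟨infVal_lt_one_of_lintegral_ne_top (hF i j).1 fun htop => h ?_, (hF i j).2⟩
  have : ∫⁻ ω : ℝ, ENNReal.ofReal
      (((evalTF F (ω * Complex.I))ᴴ * evalTF F (ω * Complex.I)).trace).re = ⊤ := by
    rw [eq_top_iff, ← htop]
    refine lintegral_mono fun ω => ENNReal.ofReal_le_ofReal ?_
    rw [trace_conjTranspose_mul_self_re]
    refine le_trans ?_ (Finset.single_le_sum (f := fun j =>
      ∑ i, ‖evalTF F (ω * Complex.I) i j‖ ^ 2) (fun j _ => by positivity) (Finset.mem_univ j))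
    exact Finset.single_le_sum (f := fun i => ‖evalTF F (ω * Complex.I) i j‖ ^ 2)
      (fun i _ => by positivity) (Finset.mem_univ i)
  rw [h2Norm, this, ENNReal.mul_top (by simp [Real.pi_pos]), ENNReal.top_rpow_of_pos (by norm_num)]

end InnerProduct

/-! ### Sylvester equations on the imaginary axis -/

section Sylvester

variable {n n' a b : Type*} [Fintype n] [DecidableEq n] [Fintype n'] [DecidableEq n']
  [Fintype a] [Fintype b]

/-- On the imaginary axis, a solution `Γ` of a Sylvester equation splits the product of the
resolvent of `A` with the adjoint resolvent of `A'` into partial fractions, one of them stable and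
the other antistable. -/
theorem resTF_mul_mul_conjTranspose {A : Matrix n n ℝ} {A' : Matrix n' n' ℝ} (hA : IsHurwitz A)
    (hA' : IsHurwitz A') {Γ N : Matrix n n' ℝ} (h : A * Γ + Γ * A'ᵀ + N = 0) (ω : ℝ) :
    evalTF (resTF A) (ω * Complex.I) * cplx N * (evalTF (resTF A') (ω * Complex.I))ᴴ =
      cplx Γ * (evalTF (resTF A') (ω * Complex.I))ᴴ + evalTF (resTF A) (ω * Complex.I) * cplx Γ := by
  have h1 := smul_evalTF_resTF' hA (s := ω * Complex.I) (by simp)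
  have h2 := congrArg conjTranspose (smul_evalTF_resTF' hA' (s := ω * Complex.I) (by simp))
  have hN : cplx N = -(cplx A * cplx Γ + cplx Γ * (cplx A')ᴴ) := by
    rw [conjTranspose_cplx, ← cplx_mul, ← cplx_mul, ← cplx_add, ← cplx_neg]
    congr 1
    exact (neg_eq_of_add_eq_zero_right h).symm
  rw [conjTranspose_smul, conjTranspose_add, conjTranspose_mul, conjTranspose_one] at h2
  have hs : star ((ω : ℂ) * Complex.I) = -((ω : ℂ) * Complex.I) := by simp
  rw [hs] at h2
  rw [hN]
  generalize evalTF (resTF A) (ω * Complex.I) = Λ at h1 ⊢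
  generalize (evalTF (resTF A') (ω * Complex.I))ᴴ = Λ' at h2 ⊢
  have e1 : Λ * cplx A = ((ω : ℂ) * Complex.I) • Λ - 1 := by rw [h1]; abel
  have e2 : (cplx A')ᴴ * Λ' = -((ω : ℂ) * Complex.I) • Λ' - 1 := by rw [h2]; abel
  have : Λ * -(cplx A * cplx Γ + cplx Γ * (cplx A')ᴴ) * Λ' =
      -((Λ * cplx A) * cplx Γ * Λ' + Λ * cplx Γ * ((cplx A')ᴴ * Λ')) := by
    simp only [Matrix.mul_add, Matrix.add_mul, Matrix.mul_neg, Matrix.neg_mul, Matrix.mul_assoc]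
  rw [this, e1, e2, neg_smul]
  simp only [Matrix.mul_sub, Matrix.sub_mul, Matrix.smul_mul, Matrix.mul_smul, Matrix.mul_one,
    Matrix.one_mul, Matrix.mul_neg, Matrix.mul_assoc]
  abel

/-- The dual of `resTF_mul_mul_conjTranspose`, with the adjoint resolvent on the left. -/
theorem conjTranspose_resTF_mul_mul {A : Matrix n n ℝ} {A' : Matrix n' n' ℝ} (hA : IsHurwitz A)
    (hA' : IsHurwitz A') {Γ N : Matrix n n' ℝ} (h : Aᵀ * Γ + Γ * A' + N = 0) (ω : ℝ) :
    (evalTF (resTF A) (ω * Complex.I))ᴴ * cplx N * evalTF (resTF A') (ω * Complex.I) =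
      cplx Γ * evalTF (resTF A') (ω * Complex.I) + (evalTF (resTF A) (ω * Complex.I))ᴴ * cplx Γ := by
  have h1 := smul_evalTF_resTF hA' (s := ω * Complex.I) (by simp)
  have h2 := congrArg conjTranspose (smul_evalTF_resTF hA (s := ω * Complex.I) (by simp))
  have hN : cplx N = -((cplx A)ᴴ * cplx Γ + cplx Γ * cplx A') := by
    rw [conjTranspose_cplx, ← cplx_mul, ← cplx_mul, ← cplx_add, ← cplx_neg]
    congr 1
    exact (neg_eq_of_add_eq_zero_right h).symm
  rw [conjTranspose_smul, conjTranspose_add, conjTranspose_mul, conjTranspose_one] at h2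
  have hs : star ((ω : ℂ) * Complex.I) = -((ω : ℂ) * Complex.I) := by simp
  rw [hs] at h2
  rw [hN]
  generalize evalTF (resTF A') (ω * Complex.I) = Λ at h1 ⊢
  generalize (evalTF (resTF A) (ω * Complex.I))ᴴ = Λ' at h2 ⊢
  have e1 : cplx A' * Λ = ((ω : ℂ) * Complex.I) • Λ - 1 := by rw [h1]; abel
  have e2 : Λ' * (cplx A)ᴴ = -((ω : ℂ) * Complex.I) • Λ' - 1 := by rw [h2]; abel
  have : Λ' * -((cplx A)ᴴ * cplx Γ + cplx Γ * cplx A') * Λ =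
      -((Λ' * (cplx A)ᴴ) * cplx Γ * Λ + Λ' * cplx Γ * (cplx A' * Λ)) := by
    simp only [Matrix.mul_add, Matrix.add_mul, Matrix.mul_neg, Matrix.neg_mul, Matrix.mul_assoc]
  rw [this, e1, e2, neg_smul]
  simp only [Matrix.mul_sub, Matrix.sub_mul, Matrix.smul_mul, Matrix.mul_smul, Matrix.mul_one,
    Matrix.one_mul, Matrix.neg_mul, Matrix.mul_assoc]
  abel

/-- Uniqueness for Sylvester equations: every polynomial satisfies `P(A) Γ = Γ P(-A')`, and the
characteristic polynomials of `A` and `-A'` are coprime. -/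
theorem eq_zero_of_sylvester {A : Matrix n n ℝ} {A' : Matrix n' n' ℝ} (hA : IsHurwitz A)
    (hA' : IsHurwitz A') {Γ : Matrix n n' ℝ} (h : A * Γ + Γ * A' = 0) : Γ = 0 := by
  have h' : A * Γ = Γ * (-A') := by
    rw [Matrix.mul_neg]; exact eq_neg_of_add_eq_zero_left h
  have hcomm : ∀ P : Polynomial ℝ, Polynomial.aeval A P * Γ = Γ * Polynomial.aeval (-A') P := by
    intro P
    induction P using Polynomial.induction_on with
    | C r =>
      rw [Polynomial.aeval_C, Polynomial.aeval_C, Algebra.algebraMap_eq_smul_one,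
        Algebra.algebraMap_eq_smul_one, Matrix.smul_mul, Matrix.mul_smul, Matrix.one_mul,
        Matrix.mul_one]
    | add p q hp hq => rw [map_add, map_add, Matrix.add_mul, Matrix.mul_add, hp, hq]
    | monomial k r hk =>
      rw [pow_succ, ← mul_assoc, map_mul _ _ Polynomial.X, map_mul (Polynomial.aeval (-A')) _
        Polynomial.X, Polynomial.aeval_X, Polynomial.aeval_X,
        Matrix.mul_assoc, h', ← Matrix.mul_assoc, hk, Matrix.mul_assoc]
  have hcop : IsCoprime A.charpoly (A'.charpoly.comp (-Polynomial.X)) := by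
    rw [Polynomial.isCoprime_iff_aeval_ne_zero_of_isAlgClosed ℝ ℂ]
    intro s
    rcases le_total 0 s.re with hs | hs
    · exact Or.inl (isHurwitz_iff.1 hA s hs)
    · refine Or.inr ?_
      rw [Polynomial.aeval_comp, map_neg, Polynomial.aeval_X]
      exact isHurwitz_iff.1 hA' (-s) (by simpa using hs)
  obtain ⟨u, v, huv⟩ := hcop
  have h1 := congrArg (fun P => Γ * Polynomial.aeval (-A') P) huv
  simp only [map_add, map_mul, Polynomial.aeval_comp, map_neg, Polynomial.aeval_X, neg_neg,
    Matrix.aeval_self_charpoly, mul_zero, add_zero, map_one, Matrix.mul_one] at h1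
  rw [← h1, ← map_mul, mul_comm, map_mul, ← Matrix.mul_assoc, ← hcomm, Matrix.aeval_self_charpoly,
    Matrix.zero_mul, Matrix.zero_mul]

/-- Up to a stable term of order `s⁻²`, the function `tr ((sI - A)⁻¹ M)` equals
`tr M / (s + 1)`. -/
theorem integral_re_trace_resTF_mul {A : Matrix n n ℝ} (hA : IsHurwitz A) (M : Matrix n n ℝ) :
    ∫ ω : ℝ, ((evalTF (resTF A) (ω * Complex.I) * cplx M).trace).re = Real.pi * M.trace := by
  have hΛ := isStrictTF_resTF hA
  set h : RatFunc ℝ := (resTF A * cst ((1 + A) * M)).trace with hh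
  have hentry := hΛ.mul_stable (isStableTF_cst ((1 + A) * M))
  have hst : RatStable h := RatStable.sum fun i _ => (hentry i i).2
  have hval : infVal h < 1 := Valuation.map_sum_lt _ one_ne_zero fun i _ => (hentry i i).1
  obtain ⟨c, hc0, hc⟩ := exists_decay_evalRat hval hst
  have hne : ∀ s : ℂ, 0 ≤ s.re → s + 1 ≠ 0 := by
    intro s hs h0
    have := congrArg Complex.re h0
    simp at this
    linarith
  have hev : ∀ s : ℂ, 0 ≤ s.re → (evalTF (resTF A) s * cplx M).trace =
      (s + 1)⁻¹ * M.trace + (s + 1)⁻¹ * evalRat s h := by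
    intro s hs
    have e1 : evalRat s h = (evalTF (resTF A) s * (cplx (1 + A) * cplx M)).trace := by
      rw [hh, Matrix.trace]
      simp only [Matrix.diag_apply]
      rw [evalRat_sum (fun i _ => (hentry i i).2) hs, ← cplx_mul,
        ← evalTF_cst ((1 + A) * M) s, ← evalTF_mul hΛ.isStableTF (isStableTF_cst _) hs]
      rfl
    have e2 : (s + 1) • evalTF (resTF A) s = 1 + evalTF (resTF A) s * cplx (1 + A) := by
      have h1 : cplx (1 : Matrix n n ℝ) = 1 := by simp [cplx]
      rw [add_smul, one_smul, smul_evalTF_resTF' hA hs, cplx_add, h1, Matrix.mul_add, Matrix.mul_one]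
      abel
    have e3 := congrArg (fun N => (N * cplx M).trace) e2
    simp only [Matrix.smul_mul, Matrix.add_mul, Matrix.one_mul, Matrix.trace_smul, Matrix.trace_add,
      trace_cplx, smul_eq_mul, Matrix.mul_assoc] at e3
    rw [← mul_add, e1, ← e3, inv_mul_cancel_left₀ (hne s hs)]
  have hd : ∀ s : ℂ, 0 ≤ s.re →
      DifferentiableAt ℂ (fun s : ℂ => (s + 1)⁻¹ * evalRat s h) s := fun s hs =>
    ((by fun_prop : DifferentiableAt ℂ (fun s : ℂ => s + 1) s).inv (hne s hs)).mul
      (differentiableAt_evalRat hst hs)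
  have hb : ∀ s : ℂ, 0 ≤ s.re → ‖(s + 1)⁻¹ * evalRat s h‖ ≤ c / (1 + ‖s‖ ^ 2) := by
    intro s hs
    have hpos : 0 < Real.sqrt (1 + ‖s‖ ^ 2) := Real.sqrt_pos.2 (by positivity)
    rw [norm_mul, norm_inv]
    refine (mul_le_mul (inv_anti₀ hpos (norm_add_one_le hs)) (hc s hs) (norm_nonneg _)
      (by positivity)).trans (le_of_eq ?_)
    rw [inv_mul_eq_div, div_div, Real.mul_self_sqrt (by positivity)]
  have hcont : Continuous fun ω : ℝ =>
      ((ω : ℂ) * Complex.I + 1)⁻¹ * evalRat (ω * Complex.I) h := by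
    rw [continuous_iff_continuousAt]
    intro ω
    exact ContinuousAt.comp (f := fun ω : ℝ => (ω : ℂ) * Complex.I)
      (hd _ (by simp)).continuousAt (by fun_prop)
  have hint : Integrable fun ω : ℝ => ((ω : ℂ) * Complex.I + 1)⁻¹ * evalRat (ω * Complex.I) h :=
    integrable_of_quadratic_decay hcont (c := c) fun ω => by
      simpa using hb (ω * Complex.I) (by simp)
  have hzero := integral_imaginary_axis_eq_zero hd hc0 hb
  have hre := integral_re hint
  simp only [RCLike.re_to_complex] at hre
  rw [hzero, Complex.zero_re] at hre
  have hsplit : ∀ ω : ℝ, ((evalTF (resTF A) (ω * Complex.I) * cplx M).trace).re =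
      M.trace * (1 + ω ^ 2)⁻¹ + (((ω : ℂ) * Complex.I + 1)⁻¹ * evalRat (ω * Complex.I) h).re := by
    intro ω
    rw [hev _ (by simp), Complex.add_re]
    congr 1
    rw [Complex.re_mul_ofReal, Complex.inv_re, mul_comm]
    congr 1
    simp [Complex.normSq_apply]
    ring
  have hint' : Integrable fun ω : ℝ =>
    (((ω : ℂ) * Complex.I + 1)⁻¹ * evalRat (ω * Complex.I) h).re := hint.re
  simp_rw [hsplit]
  rw [integral_add (integrable_inv_one_add_sq.const_mul _) hint', integral_const_mul,
    integral_univ_inv_one_add_sq, hre, add_zero, mul_comm]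

/-- The norm of `C (sI - A)⁻¹ B` in terms of the controllability Gramian. -/
theorem h2Inner_gramian {A : Matrix n n ℝ} (hA : IsHurwitz A) {B : Matrix n b ℝ} {C : Matrix a n ℝ}
    {Y : Matrix n n ℝ} (hY : A * Y + Y * Aᵀ + B * Bᵀ = 0) :
    h2Inner (cst C * resTF A * cst B) (cst C * resTF A * cst B) = (Y * (Cᵀ * C)).trace := by
  have hΛ := (isStrictTF_resTF hA).isStableTF
  have hpt : ∀ ω : ℝ, (((evalTF (cst C * resTF A * cst B) (ω * Complex.I))ᴴ *
      evalTF (cst C * resTF A * cst B) (ω * Complex.I)).trace).re =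
      ((evalTF (resTF A) (ω * Complex.I) * cplx ((Y + Yᵀ) * (Cᵀ * C))).trace).re := by
    intro ω
    have hL := resTF_mul_mul_conjTranspose hA hA hY ω
    rw [evalTF_mul ((isStableTF_cst C).mul hΛ) (isStableTF_cst B) (by simp),
      evalTF_mul (isStableTF_cst C) hΛ (by simp), evalTF_cst, evalTF_cst]
    generalize evalTF (resTF A) (ω * Complex.I) = Λ at hL ⊢
    have e1 : ((cplx C * Λ * cplx B)ᴴ * (cplx C * Λ * cplx B)).trace =
        (cplx C * (Λ * cplx (B * Bᵀ) * Λᴴ) * (cplx C)ᴴ).trace := by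
      rw [Matrix.trace_mul_comm, cplx_mul, ← conjTranspose_cplx]
      simp only [conjTranspose_mul, Matrix.mul_assoc]
    have e2 : (cplx C * (cplx Y * Λᴴ) * (cplx C)ᴴ).trace =
        star ((Λ * cplx (Yᵀ * (Cᵀ * C))).trace) := by
      rw [← trace_conjTranspose, Matrix.trace_mul_comm, conjTranspose_mul, conjTranspose_cplx,
        conjTranspose_cplx]
      simp only [transpose_mul, transpose_transpose, cplx_mul, Matrix.mul_assoc]
    have e3 : (cplx C * (Λ * cplx Y) * (cplx C)ᴴ).trace =
        (Λ * cplx (Y * (Cᵀ * C))).trace := by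
      rw [conjTranspose_cplx, Matrix.mul_assoc, Matrix.trace_mul_comm, cplx_mul, cplx_mul]
      simp only [Matrix.mul_assoc]
    rw [e1, hL, Matrix.mul_add, Matrix.add_mul, Matrix.trace_add, e2, e3, Matrix.add_mul, cplx_add,
      Matrix.mul_add, Matrix.trace_add, Complex.add_re, Complex.add_re]
    simp [add_comm]
  rw [h2Inner, integral_congr_ae (ae_of_all _ hpt), integral_re_trace_resTF_mul hA, Matrix.add_mul,
    Matrix.trace_add]
  have hsym : (Yᵀ * (Cᵀ * C)).trace = (Y * (Cᵀ * C)).trace := by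
    rw [← Matrix.trace_transpose, transpose_mul, transpose_mul, transpose_transpose,
      transpose_transpose, Matrix.trace_mul_comm]
  rw [hsym]
  field_simp
  ring

end Sylvester

end HardySpace

/-! ### Riccati equations -/

section Riccati

variable {n b c : Type*} [Fintype n] [DecidableEq n] [Fintype b] [DecidableEq b] [Fintype c]

/-- The stabilizing solution of the Riccati equation is symmetric: its antisymmetric part solves a
homogeneous Sylvester equation with Hurwitz coefficients. -/
theorem IsARE.transpose_eq {A : Matrix n n ℝ} {B : Matrix n b ℝ} {C : Matrix c n ℝ}
    {D : Matrix c b ℝ} {X : Matrix n n ℝ} {K : Matrix b n ℝ} (h : IsARE A B C D X K) : Xᵀ = X := by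
  obtain ⟨h1, h2, -⟩ := h
  have hsym : ((Dᵀ * D)⁻¹)ᵀ = (Dᵀ * D)⁻¹ := by
    rw [transpose_nonsing_inv, transpose_mul, transpose_transpose]
  set Ri := (Dᵀ * D)⁻¹ with hRi
  have h1t := congrArg transpose h1
  have hE : (A - B * Ri * (Bᵀ * X + Dᵀ * C))ᵀ * (Xᵀ - X) + (Xᵀ - X) *
      (A - B * Ri * (Bᵀ * X + Dᵀ * C)) = 0 := by
    simp only [transpose_add, transpose_sub, transpose_mul, transpose_transpose, transpose_zero,
      hsym, Matrix.mul_add, Matrix.add_mul, Matrix.mul_sub, Matrix.sub_mul, Matrix.mul_assoc]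
      at h1 h1t ⊢
    linear_combination (norm := abel) h1t - h1
  exact sub_eq_zero.1 (eq_zero_of_sylvester h2.transpose h2 hE)

theorem IsARE.isHurwitz {A : Matrix n n ℝ} {B : Matrix n b ℝ} {C : Matrix c n ℝ}
    {D : Matrix c b ℝ} {X : Matrix n n ℝ} {K : Matrix b n ℝ} (h : IsARE A B C D X K) :
    IsHurwitz (A + B * K) := by
  rw [h.2.2, Matrix.mul_neg, ← sub_eq_add_neg, ← Matrix.mul_assoc]
  exact h.2.1

theorem IsARE.gain_eq {A : Matrix n n ℝ} {B : Matrix n b ℝ} {C : Matrix c n ℝ}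
    {D : Matrix c b ℝ} {X : Matrix n n ℝ} {K : Matrix b n ℝ} (h : IsARE A B C D X K)
    (hR : IsUnit (Dᵀ * D).det) : Dᵀ * (C + D * K) = -(Bᵀ * X) := by
  rw [Matrix.mul_add, h.2.2, Matrix.mul_neg, Matrix.mul_neg, ← Matrix.mul_assoc, ← Matrix.mul_assoc,
    Matrix.mul_nonsing_inv _ hR, Matrix.one_mul]
  abel

/-- The Riccati equation as a Lyapunov equation for the closed loop. -/
theorem IsARE.lyapunov {A : Matrix n n ℝ} {B : Matrix n b ℝ} {C : Matrix c n ℝ}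
    {D : Matrix c b ℝ} {X : Matrix n n ℝ} {K : Matrix b n ℝ} (h : IsARE A B C D X K)
    (hR : IsUnit (Dᵀ * D).det) :
    (A + B * K)ᵀ * X + X * (A + B * K) + (C + D * K)ᵀ * (C + D * K) = 0 := by
  have hg := congrArg (Kᵀ * ·) (h.gain_eq hR)
  have h1 := h.1
  have hK : (X * B + Cᵀ * D) * (Dᵀ * D)⁻¹ * (Bᵀ * X + Dᵀ * C) = -((X * B + Cᵀ * D) * K) := by
    rw [h.2.2, Matrix.mul_neg, neg_neg, Matrix.mul_assoc]
  rw [hK] at h1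
  simp only [transpose_add, transpose_mul, Matrix.mul_add, Matrix.add_mul, Matrix.mul_neg,
    Matrix.mul_assoc] at h1 hg ⊢
  linear_combination (norm := abel) h1 + hg

end Riccati

namespace StatePlant

variable {n m k p q : Type*} [Fintype n] [DecidableEq n] [Fintype m] [DecidableEq m]
  [Fintype k] [DecidableEq k] [Fintype p] [DecidableEq p] [Fintype q]
  {G : StatePlant n m k p q} {K : Matrix m n ℝ} {L : Matrix n k ℝ}

/-! ### Stability and strict properness of the closed-loop factors -/

theorem isStableTF_ctrlTF (hK : IsHurwitz (G.A + G.B₂ * K)) : IsStableTF (G.ctrlTF K) :=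
  (((isStableTF_cst _).mul (isStrictTF_resTF hK).isStableTF).mul (isStableTF_cst _)).add
    (isStableTF_cst _)

theorem isStrictTF_errTF (hL : IsHurwitz (G.A + L * G.C₂)) : IsStrictTF (G.errTF L) :=
  (isStrictTF_resTF hL).mul_stable (isStableTF_cst _)

theorem isStableTF_innovTF (hL : IsHurwitz (G.A + L * G.C₂)) : IsStableTF (G.innovTF L) :=
  ((isStableTF_cst _).mul (isStrictTF_errTF hL).isStableTF).add (isStableTF_cst _)

theorem isStrictTF_nomTF (hK : IsHurwitz (G.A + G.B₂ * K)) (hL : IsHurwitz (G.A + L * G.C₂)) :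
    IsStrictTF (G.nomTF K L) :=
  (((isStableTF_cst _).mul_strict (isStrictTF_resTF hK)).mul_stable ((isStableTF_cst _).sub
    (((isStableTF_cst _).mul (isStableTF_cst _)).mul (isStrictTF_errTF hL).isStableTF))).sub
    (((isStableTF_cst _).mul (isStableTF_cst _)).mul_strict (isStrictTF_errTF hL))

/-- The direct feedthroughs `D₁₂` and `D₂₁` have full column and row rank, so `Q` vanishes at
infinity if `T₁₂ Q T₂₁` does. -/
theorem isStrictTF_of_mul (hK : IsHurwitz (G.A + G.B₂ * K)) (hL : IsHurwitz (G.A + L * G.C₂))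
    (hR : IsUnit (G.D₁₂ᵀ * G.D₁₂).det) (hV : IsUnit (G.D₂₁ * G.D₂₁ᵀ).det)
    {Q : Matrix m k (RatFunc ℝ)} (hQ : IsStableTF Q)
    (h : IsStrictTF (G.ctrlTF K * Q * G.innovTF L)) : IsStrictTF Q := by
  set T := cst (G.C₁ + G.D₁₂ * K) * resTF (G.A + G.B₂ * K) * cst G.B₂ with hT
  set T' := cst G.C₂ * G.errTF L with hT'
  have sT : IsStrictTF T :=
    ((isStableTF_cst _).mul_strict (isStrictTF_resTF hK)).mul_stable (isStableTF_cst _)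
  have sT' : IsStrictTF T' := (isStableTF_cst _).mul_strict (isStrictTF_errTF hL)
  have hc : G.ctrlTF K = T + cst G.D₁₂ := rfl
  have hi : G.innovTF L = T' + cst G.D₂₁ := rfl
  have e1 : cst (G.D₁₂ᵀ * G.D₁₂)⁻¹ * cst G.D₁₂ᵀ * cst G.D₁₂ = 1 := by
    rw [← cst_mul, ← cst_mul, Matrix.mul_assoc, Matrix.nonsing_inv_mul _ hR, cst_one]
  have e2 : cst G.D₂₁ * cst G.D₂₁ᵀ * cst (G.D₂₁ * G.D₂₁ᵀ)⁻¹ = 1 := by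
    rw [← cst_mul, ← cst_mul, Matrix.mul_nonsing_inv _ hV, cst_one]
  set a := cst (G.D₁₂ᵀ * G.D₁₂)⁻¹ * cst G.D₁₂ᵀ with ha
  set b := cst G.D₂₁ᵀ * cst (G.D₂₁ * G.D₂₁ᵀ)⁻¹ with hb
  have sa : IsStableTF a := (isStableTF_cst _).mul (isStableTF_cst _)
  have sb : IsStableTF b := (isStableTF_cst _).mul (isStableTF_cst _)
  have e3 : cst G.D₂₁ * b = 1 := by rw [hb, ← Matrix.mul_assoc, e2]
  have key : Q = a * (G.ctrlTF K * Q * G.innovTF L) * b - a * T * (Q * G.innovTF L * b) -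
      Q * T' * b := by
    have h3 : Q * G.innovTF L * b = Q * T' * b + Q := by
      rw [hi, Matrix.mul_add, Matrix.add_mul, Matrix.mul_assoc Q (cst G.D₂₁), e3, Matrix.mul_one]
    have h4 : a * (G.ctrlTF K * Q * G.innovTF L) * b =
        a * T * (Q * G.innovTF L * b) + (a * cst G.D₁₂) * (Q * G.innovTF L * b) := by
      rw [hc]
      simp only [Matrix.mul_add, Matrix.add_mul, Matrix.mul_assoc]
    rw [h4, e1, Matrix.one_mul, h3]
    abel
  rw [key]
  exact (((sa.mul_strict h).mul_stable sb).sub ((sa.mul_strict sT).mul_stable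
    ((hQ.mul (isStableTF_innovTF hL)).mul sb))).sub ((hQ.mul_strict sT').mul_stable sb)

/-! ### The factors on the imaginary axis -/

theorem evalTF_ctrlTF (hK : IsHurwitz (G.A + G.B₂ * K)) (ω : ℝ) :
    evalTF (G.ctrlTF K) (ω * Complex.I) = cplx (G.C₁ + G.D₁₂ * K) *
      evalTF (resTF (G.A + G.B₂ * K)) (ω * Complex.I) * cplx G.B₂ + cplx G.D₁₂ := by
  have hΩ := (isStrictTF_resTF hK).isStableTF
  have hs : 0 ≤ ((ω : ℂ) * Complex.I).re := by simp
  rw [ctrlTF, evalTF_add (((isStableTF_cst _).mul hΩ).mul (isStableTF_cst _)) (isStableTF_cst _) hs,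
    evalTF_mul ((isStableTF_cst _).mul hΩ) (isStableTF_cst _) hs,
    evalTF_mul (isStableTF_cst _) hΩ hs]
  simp only [evalTF_cst]

theorem evalTF_errTF (hL : IsHurwitz (G.A + L * G.C₂)) (ω : ℝ) :
    evalTF (G.errTF L) (ω * Complex.I) =
      evalTF (resTF (G.A + L * G.C₂)) (ω * Complex.I) * cplx (G.B₁ + L * G.D₂₁) := by
  rw [errTF, evalTF_mul (isStrictTF_resTF hL).isStableTF (isStableTF_cst _) (by simp), evalTF_cst]

theorem evalTF_innovTF (hL : IsHurwitz (G.A + L * G.C₂)) (ω : ℝ) :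
    evalTF (G.innovTF L) (ω * Complex.I) =
      cplx G.C₂ * evalTF (G.errTF L) (ω * Complex.I) + cplx G.D₂₁ := by
  have hE := (isStrictTF_errTF hL).isStableTF
  rw [innovTF, evalTF_add ((isStableTF_cst _).mul hE) (isStableTF_cst _) (by simp),
    evalTF_mul (isStableTF_cst _) hE (by simp), evalTF_cst, evalTF_cst]

theorem evalTF_nomTF (hK : IsHurwitz (G.A + G.B₂ * K)) (hL : IsHurwitz (G.A + L * G.C₂)) (ω : ℝ) :
    evalTF (G.nomTF K L) (ω * Complex.I) =
      cplx (G.C₁ + G.D₁₂ * K) * evalTF (resTF (G.A + G.B₂ * K)) (ω * Complex.I) *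
        (cplx G.B₁ - cplx G.B₂ * cplx K * evalTF (G.errTF L) (ω * Complex.I)) -
      cplx G.D₁₂ * cplx K * evalTF (G.errTF L) (ω * Complex.I) := by
  have hΩ := (isStrictTF_resTF hK).isStableTF
  have hE := (isStrictTF_errTF hL).isStableTF
  have hs : 0 ≤ ((ω : ℂ) * Complex.I).re := by simp
  have h1 : IsStableTF (cst G.B₂ * cst K * G.errTF L) :=
    ((isStableTF_cst _).mul (isStableTF_cst _)).mul hE
  have h2 : IsStableTF (cst G.D₁₂ * cst K * G.errTF L) :=
    ((isStableTF_cst _).mul (isStableTF_cst _)).mul hE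
  have h3 : IsStableTF (cst (G.C₁ + G.D₁₂ * K) * resTF (G.A + G.B₂ * K)) :=
    (isStableTF_cst _).mul hΩ
  rw [nomTF, evalTF_sub (h3.mul ((isStableTF_cst _).sub h1)) h2 hs,
    evalTF_mul h3 ((isStableTF_cst _).sub h1) hs, evalTF_sub (isStableTF_cst _) h1 hs,
    evalTF_mul (isStableTF_cst _) hΩ hs,
    evalTF_mul ((isStableTF_cst _).mul (isStableTF_cst _)) hE hs,
    evalTF_mul ((isStableTF_cst _).mul (isStableTF_cst _)) hE hs,
    evalTF_mul (isStableTF_cst _) (isStableTF_cst _) hs,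
    evalTF_mul (isStableTF_cst _) (isStableTF_cst _) hs]
  simp only [evalTF_cst]

variable {X Y : Matrix n n ℝ}

section Control

variable (hX : IsARE G.A G.B₂ G.C₁ G.D₁₂ X K) (hR : IsUnit (G.D₁₂ᵀ * G.D₁₂).det)
include hX hR

theorem ctrlTF_conj_mul_state (ω : ℝ) :
    (evalTF (G.ctrlTF K) (ω * Complex.I))ᴴ * (cplx (G.C₁ + G.D₁₂ * K) *
      evalTF (resTF (G.A + G.B₂ * K)) (ω * Complex.I)) =
    (cplx G.B₂)ᴴ * (evalTF (resTF (G.A + G.B₂ * K)) (ω * Complex.I))ᴴ * cplx X := by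
  have hf := conjTranspose_resTF_mul_mul hX.isHurwitz hX.isHurwitz (hX.lyapunov hR) ω
  have hg := congrArg cplx (hX.gain_eq hR)
  rw [cplx_neg, cplx_mul, cplx_mul, ← conjTranspose_cplx, ← conjTranspose_cplx] at hg
  rw [cplx_mul, ← conjTranspose_cplx] at hf
  rw [evalTF_ctrlTF hX.isHurwitz]
  generalize evalTF (resTF (G.A + G.B₂ * K)) (ω * Complex.I) = Ω at hf ⊢
  generalize cplx (G.C₁ + G.D₁₂ * K) = N at hf hg ⊢
  have h1 := congrArg ((cplx G.B₂)ᴴ * ·) hf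
  have h2 := congrArg (· * Ω) hg
  simp only [conjTranspose_add, conjTranspose_mul, Matrix.mul_add, Matrix.add_mul,
    Matrix.neg_mul, Matrix.mul_assoc] at h1 h2 ⊢
  linear_combination (norm := abel) h1 + h2

theorem ctrlTF_conj_mul_feedthrough (ω : ℝ) :
    (evalTF (G.ctrlTF K) (ω * Complex.I))ᴴ * cplx G.D₁₂ = cplx (G.D₁₂ᵀ * G.D₁₂) -
    (cplx G.B₂)ᴴ * (evalTF (resTF (G.A + G.B₂ * K)) (ω * Complex.I))ᴴ * cplx X * cplx G.B₂ := by
  have hg := congrArg (fun M => (cplx M)ᴴ) (hX.gain_eq hR)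
  simp only [cplx_neg, cplx_mul, ← conjTranspose_cplx, conjTranspose_neg, conjTranspose_mul,
    conjTranspose_conjTranspose] at hg
  rw [conjTranspose_cplx X, hX.transpose_eq] at hg
  rw [evalTF_ctrlTF hX.isHurwitz, cplx_mul, ← conjTranspose_cplx]
  generalize evalTF (resTF (G.A + G.B₂ * K)) (ω * Complex.I) = Ω
  generalize cplx (G.C₁ + G.D₁₂ * K) = N at hg ⊢
  have h2 := congrArg ((cplx G.B₂)ᴴ * Ωᴴ * ·) hg
  simp only [conjTranspose_add, conjTranspose_mul, Matrix.add_mul,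
    Matrix.mul_neg, Matrix.mul_assoc] at h2 ⊢
  linear_combination (norm := abel) h2

/-- `T₁₂` is inner up to the weight `R = D₁₂ᵀ D₁₂`. -/
theorem ctrlTF_conj_mul_self (ω : ℝ) :
    (evalTF (G.ctrlTF K) (ω * Complex.I))ᴴ * evalTF (G.ctrlTF K) (ω * Complex.I) =
      cplx (G.D₁₂ᵀ * G.D₁₂) := by
  have h1 := ctrlTF_conj_mul_state hX hR ω
  have h2 := ctrlTF_conj_mul_feedthrough hX hR ω
  nth_rw 2 [evalTF_ctrlTF hX.isHurwitz]
  rw [Matrix.mul_add, h2, ← Matrix.mul_assoc, h1]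
  abel

end Control

section Estimation

variable (hY : IsARE G.Aᵀ G.C₂ᵀ G.B₁ᵀ G.D₂₁ᵀ Y Lᵀ) (hV : IsUnit (G.D₂₁ * G.D₂₁ᵀ).det)
include hY

theorem isHurwitz_estimator : IsHurwitz (G.A + L * G.C₂) := by
  have := hY.isHurwitz.transpose
  rwa [transpose_add, transpose_mul, transpose_transpose, transpose_transpose,
    transpose_transpose] at this

include hV

theorem estimator_gain_eq : (G.B₁ + L * G.D₂₁) * G.D₂₁ᵀ = -(Y * G.C₂ᵀ) := by
  have h := congrArg transpose (hY.gain_eq (by rwa [transpose_transpose]))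
  simp only [transpose_mul, transpose_add, transpose_neg, transpose_transpose,
    hY.transpose_eq] at h
  exact h

theorem estimator_lyapunov : (G.A + L * G.C₂) * Y + Y * (G.A + L * G.C₂)ᵀ +
    (G.B₁ + L * G.D₂₁) * (G.B₁ + L * G.D₂₁)ᵀ = 0 := by
  have h := hY.lyapunov (by rwa [transpose_transpose])
  simp only [transpose_add, transpose_mul, transpose_transpose] at h ⊢
  exact h

theorem errTF_mul_innovTF_conj (ω : ℝ) :
    evalTF (G.errTF L) (ω * Complex.I) * (evalTF (G.innovTF L) (ω * Complex.I))ᴴ =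
      cplx Y * (evalTF (resTF (G.A + L * G.C₂)) (ω * Complex.I))ᴴ * (cplx G.C₂)ᴴ := by
  have hL := isHurwitz_estimator hY
  have hf := resTF_mul_mul_conjTranspose hL hL (estimator_lyapunov hY hV) ω
  have hg := congrArg cplx (estimator_gain_eq hY hV)
  rw [cplx_neg, cplx_mul, cplx_mul, ← conjTranspose_cplx, ← conjTranspose_cplx] at hg
  rw [cplx_mul, ← conjTranspose_cplx] at hf
  rw [evalTF_innovTF hL, evalTF_errTF hL]
  generalize evalTF (resTF (G.A + L * G.C₂)) (ω * Complex.I) = Λ at hf ⊢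
  generalize cplx (G.B₁ + L * G.D₂₁) = N at hf hg ⊢
  have h1 := congrArg (· * (cplx G.C₂)ᴴ) hf
  have h2 := congrArg (Λ * ·) hg
  simp only [conjTranspose_add, conjTranspose_mul, Matrix.mul_add, Matrix.add_mul,
    Matrix.mul_neg, Matrix.mul_assoc] at h1 h2 ⊢
  linear_combination (norm := abel) h1 + h2

/-- `T₂₁` is co-inner up to the weight `V = D₂₁ D₂₁ᵀ`. -/
theorem innovTF_mul_conj (ω : ℝ) :
    evalTF (G.innovTF L) (ω * Complex.I) * (evalTF (G.innovTF L) (ω * Complex.I))ᴴ =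
      cplx (G.D₂₁ * G.D₂₁ᵀ) := by
  have hL := isHurwitz_estimator hY
  have h1 := congrArg (cplx G.C₂ * ·) (errTF_mul_innovTF_conj hY hV ω)
  have hg := congrArg (fun M => (cplx M)ᴴ) (estimator_gain_eq hY hV)
  simp only [cplx_neg, cplx_mul, ← conjTranspose_cplx, conjTranspose_neg, conjTranspose_mul,
    conjTranspose_conjTranspose] at hg
  rw [conjTranspose_cplx Y, hY.transpose_eq] at hg
  have h2 := congrArg (· * (evalTF (resTF (G.A + L * G.C₂)) (ω * Complex.I))ᴴ * (cplx G.C₂)ᴴ) hg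
  rw [evalTF_innovTF hL, evalTF_errTF hL] at *
  rw [cplx_mul, ← conjTranspose_cplx]
  simp only [conjTranspose_add, conjTranspose_mul, Matrix.mul_add, Matrix.add_mul,
    Matrix.neg_mul, Matrix.mul_assoc] at h1 h2 ⊢
  linear_combination (norm := abel) h1 + h2

end Estimation

section Optimality

variable (hX : IsARE G.A G.B₂ G.C₁ G.D₁₂ X K) (hR : IsUnit (G.D₁₂ᵀ * G.D₁₂).det)
  (hY : IsARE G.Aᵀ G.C₂ᵀ G.B₁ᵀ G.D₂₁ᵀ Y Lᵀ) (hV : IsUnit (G.D₂₁ * G.D₂₁ᵀ).det)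
include hX hR hY hV

theorem innovTF_mul_nomTF_conj_mul_ctrlTF (ω : ℝ) :
    evalTF (G.innovTF L) (ω * Complex.I) * (evalTF (G.nomTF K L) (ω * Complex.I))ᴴ *
      evalTF (G.ctrlTF K) (ω * Complex.I) =
    evalTF (G.innovTF L * cst (G.B₁ᵀ * X) * resTF (G.A + G.B₂ * K) * cst G.B₂ -
      cst G.C₂ * resTF (G.A + L * G.C₂) * cst (Y * Kᵀ * (G.D₁₂ᵀ * G.D₁₂))) (ω * Complex.I) := by
  have hK := hX.isHurwitz
  have hL := isHurwitz_estimator hY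
  have hs : 0 ≤ ((ω : ℂ) * Complex.I).re := by simp
  have s1 := (isStableTF_innovTF hL).mul (isStableTF_cst (G.B₁ᵀ * X))
  have s2 := s1.mul (isStrictTF_resTF hK).isStableTF
  have s3 := (isStableTF_cst G.C₂).mul (isStrictTF_resTF hL).isStableTF
  rw [evalTF_sub (s2.mul (isStableTF_cst _)) (s3.mul (isStableTF_cst _)) hs,
    evalTF_mul s2 (isStableTF_cst _) hs, evalTF_mul s3 (isStableTF_cst _) hs,
    evalTF_mul s1 (isStrictTF_resTF hK).isStableTF hs,
    evalTF_mul (isStableTF_cst _) (isStrictTF_resTF hL).isStableTF hs,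
    evalTF_mul (isStableTF_innovTF hL) (isStableTF_cst _) hs]
  simp only [evalTF_cst]
  have h1 := ctrlTF_conj_mul_state hX hR ω
  have h2 := ctrlTF_conj_mul_feedthrough hX hR ω
  have h3 := errTF_mul_innovTF_conj hY hV ω
  have hr : (cplx (G.D₁₂ᵀ * G.D₁₂))ᴴ = cplx (G.D₁₂ᵀ * G.D₁₂) := by
    rw [conjTranspose_cplx, transpose_mul, transpose_transpose]
  have hx : (cplx X)ᴴ = cplx X := by rw [conjTranspose_cplx, hX.transpose_eq]
  have hy : (cplx Y)ᴴ = cplx Y := by rw [conjTranspose_cplx, hY.transpose_eq]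
  rw [cplx_mul _ X, ← conjTranspose_cplx, cplx_mul _ (G.D₁₂ᵀ * G.D₁₂), cplx_mul Y,
    ← conjTranspose_cplx K, evalTF_nomTF hK hL]
  generalize evalTF (G.ctrlTF K) (ω * Complex.I) = T at h1 h2 ⊢
  generalize evalTF (G.innovTF L) (ω * Complex.I) = T' at h3 ⊢
  generalize evalTF (G.errTF L) (ω * Complex.I) = E at h3 ⊢
  generalize evalTF (resTF (G.A + G.B₂ * K)) (ω * Complex.I) = Ω at h1 h2 ⊢
  generalize evalTF (resTF (G.A + L * G.C₂)) (ω * Complex.I) = Λ at h3 ⊢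
  generalize cplx (G.C₁ + G.D₁₂ * K) = N at h1 ⊢
  generalize cplx (G.D₁₂ᵀ * G.D₁₂) = r at h2 hr ⊢
  have key : Tᴴ * (N * Ω * (cplx G.B₁ - cplx G.B₂ * cplx K * E) - cplx G.D₁₂ * cplx K * E) * T'ᴴ =
      (cplx G.B₂)ᴴ * Ωᴴ * cplx X * cplx G.B₁ * T'ᴴ -
        r * cplx K * (cplx Y * Λᴴ * (cplx G.C₂)ᴴ) := by
    rw [← h3]
    have e1 := congrArg (· * (cplx G.B₁ - cplx G.B₂ * cplx K * E) * T'ᴴ) h1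
    have e2 := congrArg (· * cplx K * E * T'ᴴ) h2
    simp only [Matrix.mul_sub, Matrix.sub_mul, Matrix.mul_assoc] at e1 e2 ⊢
    linear_combination (norm := abel) e1 - e2
  have key2 := congrArg conjTranspose key
  simp only [conjTranspose_mul, conjTranspose_sub, conjTranspose_conjTranspose, hr, hx, hy,
    Matrix.mul_sub, Matrix.sub_mul, Matrix.mul_assoc] at key2 ⊢
  exact key2

/-- The nominal closed loop is orthogonal to all perturbations `T₁₂ Q T₂₁` with `Q` stable and
strictly proper. -/
theorem h2Inner_nomTF_eq_zero {Q : Matrix m k (RatFunc ℝ)} (hQ : IsStrictTF Q) :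
    h2Inner (G.nomTF K L) (G.ctrlTF K * Q * G.innovTF L) = 0 := by
  have hK := hX.isHurwitz
  have hL := isHurwitz_estimator hY
  have hT := isStableTF_ctrlTF hK
  have hT' := isStableTF_innovTF hL
  refine h2Inner_eq_zero (Δ := Q) hQ (Z := G.innovTF L * cst (G.B₁ᵀ * X) *
    resTF (G.A + G.B₂ * K) * cst G.B₂ -
      cst G.C₂ * resTF (G.A + L * G.C₂) * cst (Y * Kᵀ * (G.D₁₂ᵀ * G.D₁₂))) ?_ fun ω => ?_
  · exact (((hT'.mul (isStableTF_cst _)).mul_strict (isStrictTF_resTF hK)).mul_stable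
      (isStableTF_cst _)).sub
      (((isStableTF_cst _).mul_strict (isStrictTF_resTF hL)).mul_stable (isStableTF_cst _))
  · rw [← innovTF_mul_nomTF_conj_mul_ctrlTF hX hR hY hV, evalTF_mul (hT.mul hQ.isStableTF) hT'
      (by simp), evalTF_mul hT hQ.isStableTF (by simp)]
    rw [← Matrix.mul_assoc, ← Matrix.mul_assoc, Matrix.trace_mul_comm, ← Matrix.mul_assoc,
      ← Matrix.mul_assoc, Matrix.trace_mul_comm]

theorem evalTF_param_inner {Q Q' : Matrix m k (RatFunc ℝ)} (hQ : IsStableTF Q)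
    (hQ' : IsStableTF Q') (ω : ℝ) :
    ((evalTF (G.ctrlTF K * Q * G.innovTF L) (ω * Complex.I))ᴴ *
      evalTF (G.ctrlTF K * Q' * G.innovTF L) (ω * Complex.I)).trace =
    (evalTF Q' (ω * Complex.I) * (cplx (G.D₂₁ * G.D₂₁ᵀ) * (evalTF Q (ω * Complex.I))ᴴ *
      cplx (G.D₁₂ᵀ * G.D₁₂))).trace := by
  have hT := isStableTF_ctrlTF hX.isHurwitz
  have hT' := isStableTF_innovTF (isHurwitz_estimator hY)
  rw [evalTF_mul (hT.mul hQ) hT' (by simp), evalTF_mul hT hQ (by simp),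
    evalTF_mul (hT.mul hQ') hT' (by simp), evalTF_mul hT hQ' (by simp),
    ← ctrlTF_conj_mul_self hX hR ω, ← innovTF_mul_conj hY hV ω]
  generalize evalTF (G.ctrlTF K) (ω * Complex.I) = T
  generalize evalTF (G.innovTF L) (ω * Complex.I) = T'
  simp only [conjTranspose_mul]
  rw [← Matrix.mul_assoc, Matrix.trace_mul_comm]
  simp only [Matrix.mul_assoc]
  rw [← Matrix.mul_assoc, ← Matrix.mul_assoc, ← Matrix.mul_assoc, ← Matrix.mul_assoc,
    Matrix.trace_mul_comm]
  simp only [Matrix.mul_assoc]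

theorem h2Inner_param_self {Q : Matrix m k (RatFunc ℝ)} (hQ : IsStableTF Q) :
    h2Inner (G.ctrlTF K * Q * G.innovTF L) (G.ctrlTF K * Q * G.innovTF L) =
      h2Inner (cst G.D₁₂ * Q * cst G.D₂₁) (cst G.D₁₂ * Q * cst G.D₂₁) := by
  rw [h2Inner, h2Inner]
  congr 2 with ω
  rw [evalTF_param_inner hX hR hY hV hQ hQ, evalTF_mul ((isStableTF_cst _).mul hQ) (isStableTF_cst _)
    (by simp), evalTF_mul (isStableTF_cst _) hQ (by simp), evalTF_cst, evalTF_cst, cplx_mul, cplx_mul,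
    ← conjTranspose_cplx, ← conjTranspose_cplx]
  generalize evalTF Q (ω * Complex.I) = q
  simp only [conjTranspose_mul]
  congr 1
  conv_rhs => rw [← Matrix.mul_assoc, Matrix.trace_mul_comm]
  simp only [Matrix.mul_assoc]
  conv_rhs => rw [← Matrix.mul_assoc, ← Matrix.mul_assoc, ← Matrix.mul_assoc, ← Matrix.mul_assoc,
    Matrix.trace_mul_comm]
  simp only [Matrix.mul_assoc]

/-- Orthogonality of two perturbations of the nominal closed loop, when the para-conjugate of the
first one is stable on the range of the second. -/
theorem h2Inner_param_eq_zero {a b : Type*} [Fintype a] [Fintype b] {Q : Matrix m k (RatFunc ℝ)}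
    (hQ : IsStableTF Q) {P₁ : Matrix m a (RatFunc ℝ)} {P₂ : Matrix b k (RatFunc ℝ)}
    {Δ : Matrix a b (RatFunc ℝ)} {Z : Matrix b a (RatFunc ℝ)} (hP₁ : IsStableTF P₁)
    (hP₂ : IsStableTF P₂) (hΔ : IsStrictTF Δ) (hZ : IsStrictTF Z)
    (h : ∀ ω : ℝ, evalTF P₂ (ω * Complex.I) * cplx (G.D₂₁ * G.D₂₁ᵀ) *
      (evalTF Q (ω * Complex.I))ᴴ * cplx (G.D₁₂ᵀ * G.D₁₂) * evalTF P₁ (ω * Complex.I) =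
      evalTF Z (ω * Complex.I)) :
    h2Inner (G.ctrlTF K * Q * G.innovTF L) (G.ctrlTF K * (P₁ * Δ * P₂) * G.innovTF L) = 0 := by
  refine h2Inner_eq_zero hΔ hZ fun ω => ?_
  rw [evalTF_param_inner hX hR hY hV hQ ((hP₁.mul hΔ.isStableTF).mul hP₂), ← h,
    evalTF_mul (hP₁.mul hΔ.isStableTF) hP₂ (by simp), evalTF_mul hP₁ hΔ.isStableTF (by simp)]
  simp only [Matrix.mul_assoc]
  rw [Matrix.trace_mul_comm]
  simp only [Matrix.mul_assoc]

/-! ### The centralized problem -/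

theorem isStrictTF_lowerLFT_controller {Kh : Matrix m n ℝ} {Lh : Matrix n k ℝ}
    (hh : IsHurwitz (G.A + G.B₂ * Kh + Lh * G.C₂)) :
    IsStrictTF (lowerLFT G.tf (G.controller K Kh L Lh)) := by
  rw [lowerLFT_controller]
  exact (isStrictTF_nomTF hX.isHurwitz (isHurwitz_estimator hY)).add
    (((isStableTF_ctrlTF hX.isHurwitz).mul_strict (isStrictTF_paramTF hh)).mul_stable
      (isStableTF_innovTF (isHurwitz_estimator hY)))

theorem h2Norm_nomTF_le {Kc : Matrix m k (RatFunc ℝ)} (hKc : Kc ∈ centralizedControllers G.tf) :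
    h2Norm (G.nomTF K L) ≤ h2Norm (lowerLFT G.tf Kc) := by
  have hK := hX.isHurwitz
  have hL := isHurwitz_estimator hY
  by_cases htop : h2Norm (lowerLFT G.tf Kc) = ⊤
  · rw [htop]; exact le_top
  have hQ := isStableTF_youla hK hL hKc.2.2
  have hnom := isStrictTF_nomTF hK hL
  rw [lowerLFT_eq_youla hKc.1 K L] at htop ⊢
  have hst := (((isStableTF_ctrlTF hK).mul hQ).mul (isStableTF_innovTF hL))
  have hpert : IsStrictTF (G.ctrlTF K * G.youla K L Kc * G.innovTF L) := by
    have := (isStrictTF_of_h2Norm_ne_top (hnom.isStableTF.add hst) htop).sub hnom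
    rwa [add_sub_cancel_left] at this
  exact h2Norm_le_add hnom hpert
    (h2Inner_nomTF_eq_zero hX hR hY hV (isStrictTF_of_mul hK hL hR hV hQ hpert))

theorem exists_isH2Optimal_centralized : ∃ Kc, IsH2Optimal G.tf (centralizedControllers G.tf) Kc ∧
    lowerLFT G.tf Kc = G.nomTF K L := by
  have hK := hX.isHurwitz
  have hL := isHurwitz_estimator hY
  have hh : IsHurwitz (G.A + G.B₂ * K + (0 : Matrix n k ℝ) * G.C₂) := by simpa using hK
  have heq : lowerLFT G.tf (G.controller K K L 0) = G.nomTF K L := by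
    rw [lowerLFT_controller, paramTF, sub_self, cst_zero]
    simp
  refine ⟨G.controller K K L 0, ⟨⟨isProperTF_controller, stabilizes_controller hK hL hh⟩,
    fun K' hK' => ?_⟩, heq⟩
  rw [heq]
  exact h2Norm_nomTF_le hX hR hY hV hK'

theorem h2Norm_of_isH2Optimal_centralized {Kc : Matrix m k (RatFunc ℝ)}
    (h : IsH2Optimal G.tf (centralizedControllers G.tf) Kc) :
    h2Norm (lowerLFT G.tf Kc) = h2Norm (G.nomTF K L) := by
  obtain ⟨K', hK', heq⟩ := exists_isH2Optimal_centralized hX hR hY hV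
  rw [← heq]
  exact le_antisymm (h.2 K' hK'.1) (hK'.2 Kc h.1)

end Optimality

end StatePlant

/-! ### Para-conjugation of the parameter of the two-player controller -/

section ParaConjugate

variable {n n' m m' k k' : Type*} [Fintype n] [DecidableEq n] [Fintype n'] [DecidableEq n']
  [Fintype m] [Fintype m'] [Fintype k] [Fintype k']

/-- The conditions on `Γ` make the stable part of the product vanish, so that only the adjoint of a
stable transfer matrix remains. -/
theorem conj_mul_resTF_of_sylvester {A' : Matrix n' n' ℝ} {Ah : Matrix n n ℝ} (hA' : IsHurwitz A')
    (hAh : IsHurwitz Ah) {E : Matrix m m' ℝ} {N : Matrix m n' ℝ} {B : Matrix n' m' ℝ}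
    {R : Matrix m m ℝ} {Kd : Matrix m n ℝ} {Γ : Matrix n' n ℝ}
    (h1 : A'ᵀ * Γ + Γ * Ah + Nᵀ * R * Kd = 0) (h2 : Eᵀ * R * Kd = -(Bᵀ * Γ)) (ω : ℝ) :
    (evalTF (cst E + cst N * resTF A' * cst B) (ω * Complex.I))ᴴ * cplx R * cplx Kd *
      evalTF (resTF Ah) (ω * Complex.I) =
    (cplx B)ᴴ * (evalTF (resTF A') (ω * Complex.I))ᴴ * cplx Γ := by
  have hs : 0 ≤ ((ω : ℂ) * Complex.I).re := by simp
  have hΩ := (isStrictTF_resTF hA').isStableTF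
  have hf := conjTranspose_resTF_mul_mul hA' hAh h1 ω
  have hg := congrArg cplx h2
  rw [evalTF_add (isStableTF_cst _) (((isStableTF_cst _).mul hΩ).mul (isStableTF_cst _)) hs,
    evalTF_mul ((isStableTF_cst _).mul hΩ) (isStableTF_cst _) hs,
    evalTF_mul (isStableTF_cst _) hΩ hs]
  simp only [evalTF_cst, cplx_neg, cplx_mul, ← conjTranspose_cplx] at hf hg ⊢
  have e1 := congrArg ((cplx B)ᴴ * ·) hf
  have e2 := congrArg (· * evalTF (resTF Ah) (ω * Complex.I)) hg
  simp only [conjTranspose_add, conjTranspose_mul, Matrix.mul_add, Matrix.add_mul,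
    Matrix.neg_mul, Matrix.mul_assoc] at e1 e2 ⊢
  linear_combination (norm := abel) e1 + e2

/-- The dual of `conj_mul_resTF_of_sylvester`. -/
theorem resTF_mul_conj_of_sylvester {A' : Matrix n' n' ℝ} {Ah : Matrix n n ℝ} (hA' : IsHurwitz A')
    (hAh : IsHurwitz Ah) {E : Matrix k' k ℝ} {N : Matrix n' k ℝ} {C : Matrix k' n' ℝ}
    {V : Matrix k k ℝ} {Ld : Matrix n k ℝ} {Γ : Matrix n n' ℝ}
    (h1 : Ah * Γ + Γ * A'ᵀ + Ld * V * Nᵀ = 0) (h2 : Ld * V * Eᵀ = -(Γ * Cᵀ)) (ω : ℝ) :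
    evalTF (resTF Ah) (ω * Complex.I) * cplx Ld * cplx V *
      (evalTF (cst E + cst C * resTF A' * cst N) (ω * Complex.I))ᴴ =
    cplx Γ * (evalTF (resTF A') (ω * Complex.I))ᴴ * (cplx C)ᴴ := by
  have hs : 0 ≤ ((ω : ℂ) * Complex.I).re := by simp
  have hΩ := (isStrictTF_resTF hA').isStableTF
  have hf := resTF_mul_mul_conjTranspose hAh hA' h1 ω
  have hg := congrArg cplx h2
  rw [evalTF_add (isStableTF_cst _) (((isStableTF_cst _).mul hΩ).mul (isStableTF_cst _)) hs,
    evalTF_mul ((isStableTF_cst _).mul hΩ) (isStableTF_cst _) hs,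
    evalTF_mul (isStableTF_cst _) hΩ hs]
  simp only [evalTF_cst, cplx_neg, cplx_mul, ← conjTranspose_cplx] at hf hg ⊢
  have e1 := congrArg (· * (cplx C)ᴴ) hf
  have e2 := congrArg (evalTF (resTF Ah) (ω * Complex.I) * ·) hg
  simp only [conjTranspose_add, conjTranspose_mul, Matrix.mul_add, Matrix.add_mul,
    Matrix.mul_neg, Matrix.mul_assoc] at e1 e2 ⊢
  linear_combination (norm := abel) e1 + e2

end ParaConjugate

/-! ### Structure of the two-player plant -/

theorem fromCols_add_fromCols {R a b b' : Type*} [Add R] (F₁ F₂ : Matrix a b R)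
    (H₁ H₂ : Matrix a b' R) :
    fromCols F₁ H₁ + fromCols F₂ H₂ = fromCols (F₁ + F₂) (H₁ + H₂) := by
  ext i (j | j) <;> rfl

theorem fromRows_add_fromRows {R a a' b : Type*} [Add R] (F₁ F₂ : Matrix a b R)
    (H₁ H₂ : Matrix a' b R) :
    fromRows F₁ H₁ + fromRows F₂ H₂ = fromRows (F₁ + F₂) (H₁ + H₂) := by
  ext (i | i) j <;> rfl

/-- An intertwining relation for matrices passes to their resolvents. -/
theorem resTF_mul_cst_of_intertwine {n n' : Type*} [Fintype n] [DecidableEq n] [Fintype n']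
    [DecidableEq n'] {A : Matrix n n ℝ} {A' : Matrix n' n' ℝ} {E : Matrix n n' ℝ}
    (h : A * E = E * A') : resTF A * cst E = cst E * resTF A' := by
  symm
  rw [eq_resTF_mul_iff, ← Matrix.mul_smul, X_smul_resTF, Matrix.mul_add, Matrix.mul_one,
    ← Matrix.mul_assoc, ← Matrix.mul_assoc, ← cst_mul, ← cst_mul, h, add_comm]

/-- The dual of `resTF_mul_cst_of_intertwine`. -/
theorem cst_mul_resTF_of_intertwine {n n' : Type*} [Fintype n] [DecidableEq n] [Fintype n']
    [DecidableEq n'] {A : Matrix n n ℝ} {A' : Matrix n' n' ℝ} {E : Matrix n' n ℝ}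
    (h : E * A = A' * E) : cst E * resTF A = resTF A' * cst E := by
  rw [eq_resTF_mul_iff, ← Matrix.mul_smul, X_smul_resTF, Matrix.mul_add, Matrix.mul_one,
    ← Matrix.mul_assoc, ← Matrix.mul_assoc, ← cst_mul, ← cst_mul, h, add_comm]

/-- In coordinates given by block-lower-triangular gains, the Youla parameter inherits the
block-lower-triangular structure of the controller. -/
theorem StatePlant.isLower_youla {n₁ n₂ m₁ m₂ k₁ k₂ p q : Type*} [Fintype n₁] [DecidableEq n₁]
    [Fintype n₂] [DecidableEq n₂] [Fintype m₁] [DecidableEq m₁] [Fintype m₂] [DecidableEq m₂]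
    [Fintype k₁] [DecidableEq k₁] [Fintype k₂] [DecidableEq k₂] [Fintype p] [DecidableEq p]
    {G : StatePlant (n₁ ⊕ n₂) (m₁ ⊕ m₂) (k₁ ⊕ k₂) p q} (hA : IsLower G.A) (hB : IsLower G.B₂)
    (hC : IsLower G.C₂) {F : Matrix (m₁ ⊕ m₂) (n₁ ⊕ n₂) ℝ} {H : Matrix (n₁ ⊕ n₂) (k₁ ⊕ k₂) ℝ}
    (hF : IsLower F) (hH : IsLower H) {Kc : Matrix (m₁ ⊕ m₂) (k₁ ⊕ k₂) (RatFunc ℝ)}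
    (hKc : IsLower Kc) : IsLower (G.youla F H Kc) := by
  have hT : IsLower G.tf.toBlocks₂₂ := by
    rw [tf_eq, toBlocks_fromBlocks₂₂]
    exact ((isLower_cst hC).mul (isLower_resTF hA)).mul (isLower_cst hB)
  have hΛ := isLower_resTF (hA.add (hH.mul hC))
  have hFΛ := (isLower_cst hF).mul hΛ
  exact ((((isLower_one.sub (hFΛ.mul (isLower_cst hB))).mul hKc).add
    (hFΛ.mul (isLower_cst hH))).mul (isLower_one.sub (hT.mul hKc)).inv).mul
    (isLower_one.sub (((isLower_cst hC).mul (isLower_resTF hA)).mul (isLower_cst hH)))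

namespace TwoPlayerPlant

variable {n₁ n₂ m₁ m₂ k₁ k₂ p q : Type*} [Fintype n₁] [DecidableEq n₁]
    [Fintype n₂] [DecidableEq n₂] [Fintype m₁] [DecidableEq m₁] [Fintype m₂] [DecidableEq m₂]
    [Fintype k₁] [DecidableEq k₁] [Fintype k₂] [DecidableEq k₂] [Fintype p] [DecidableEq p]
    [Fintype q] (P : TwoPlayerPlant n₁ n₂ m₁ m₂ k₁ k₂ p q)

/-- The two-player plant without its block structure. -/
def toStatePlant : StatePlant (n₁ ⊕ n₂) (m₁ ⊕ m₂) (k₁ ⊕ k₂) p q :=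
  ⟨P.A, P.B₁, P.B₂, P.C₁, P.C₂, P.D₁₂, P.D₂₁⟩

theorem tf_toStatePlant : P.toStatePlant.tf = P.tf := rfl

variable {P} {X Y : Matrix (n₁ ⊕ n₂) (n₁ ⊕ n₂) ℝ} {K : Matrix (m₁ ⊕ m₂) (n₁ ⊕ n₂) ℝ}
  {L : Matrix (n₁ ⊕ n₂) (k₁ ⊕ k₂) ℝ} {Xt : Matrix n₂ n₂ ℝ} {J : Matrix m₂ n₂ ℝ}
  {Yt : Matrix n₁ n₁ ℝ} {M : Matrix n₁ k₁ ℝ} {Φ Ψ : Matrix n₂ n₁ ℝ}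

theorem Ahat_eq : P.Ahat (P.Khat J Φ) (P.Lhat M Ψ) = fromBlocks (P.A₁₁ + M * P.C₁₁) 0
    (P.A₂₁ + P.B₂₂ * -(P.R.toBlocks₂₂⁻¹ * (P.B₂₂ᵀ * Φ + P.S.toBlocks₁₂ᵀ)) +
      -((Ψ * P.C₁₁ᵀ + P.U.toBlocks₁₂ᵀ) * P.V.toBlocks₁₁⁻¹) * P.C₁₁)
    (P.A₂₂ + P.B₂₂ * J) := by
  simp [Ahat, A, B₂, C₂, Khat, Lhat, fromBlocks_multiply, fromBlocks_add]

/-- The matrix `[Φ - X₂₁, X̃ - X₂₂]` solves the Sylvester equation that relates the gain of the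
second player to the centralized gain. -/
theorem sylvester_control (hX : IsARE P.A P.B₂ P.C₁ P.D₁₂ X K)
    (hXt : IsARE P.A₂₂ P.B₂₂ P.C₁.toCols₂ P.D₁₂.toCols₂ Xt J)
    (hR : IsUnit (P.D₁₂ᵀ * P.D₁₂).det) (hR₂ : IsUnit (P.D₁₂.toCols₂ᵀ * P.D₁₂.toCols₂).det)
    (hΦ : (P.A₂₂ + P.B₂₂ * J)ᵀ * Φ + Φ * (P.A₁₁ + M * P.C₁₁)
      - (Xt - X.toBlocks₂₂) * (Ψ * P.C₁₁ᵀ + P.U.toBlocks₁₂ᵀ) * P.V.toBlocks₁₁⁻¹ * P.C₁₁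
      + (Xt * P.A₂₁ + Jᵀ * P.S.toBlocks₁₂ᵀ + P.Q.toBlocks₂₁ - X.toBlocks₂₁ * M * P.C₁₁) = 0) :
    (fromRows 0 1 : Matrix (m₁ ⊕ m₂) m₂ ℝ)ᵀ * (P.D₁₂ᵀ * P.D₁₂) * (P.Khat J Φ - K) =
      -(P.B₂₂ᵀ * fromCols (Φ - X.toBlocks₂₁) (Xt - X.toBlocks₂₂)) ∧
    (P.A₂₂ + P.B₂₂ * J)ᵀ * fromCols (Φ - X.toBlocks₂₁) (Xt - X.toBlocks₂₂) +
      fromCols (Φ - X.toBlocks₂₁) (Xt - X.toBlocks₂₂) * P.Ahat (P.Khat J Φ) (P.Lhat M Ψ) +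
      ((fromRows 0 1 : Matrix (m₁ ⊕ m₂) m₂ ℝ) * J - K * (fromRows 0 1 : Matrix (n₁ ⊕ n₂) n₂ ℝ))ᵀ *
        (P.D₁₂ᵀ * P.D₁₂) * (P.Khat J Φ - K) = 0 := by
  have hR22 : P.D₁₂.toCols₂ᵀ * P.D₁₂.toCols₂ = P.R.toBlocks₂₂ := rfl
  have hS22 : P.C₁.toCols₂ᵀ * P.D₁₂.toCols₂ = P.S.toBlocks₂₂ := rfl
  have hQ22 : P.C₁.toCols₂ᵀ * P.C₁.toCols₂ = P.Q.toBlocks₂₂ := rfl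
  have hS22' : P.D₁₂.toCols₂ᵀ * P.C₁.toCols₂ = P.S.toBlocks₂₂ᵀ := by
    rw [← hS22, transpose_mul, transpose_transpose]
  have hRdef : P.D₁₂ᵀ * P.D₁₂ = P.R := rfl
  have hSdef : P.C₁ᵀ * P.D₁₂ = P.S := rfl
  have hSdef' : P.D₁₂ᵀ * P.C₁ = P.Sᵀ := by rw [← hSdef, transpose_mul, transpose_transpose]
  have hQdef : P.C₁ᵀ * P.C₁ = P.Q := rfl
  have hg := hX.gain_eq hR
  rw [Matrix.mul_add, ← Matrix.mul_assoc, hRdef, hSdef'] at hg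
  have hRK : P.R * K = -(P.B₂ᵀ * X + P.Sᵀ) := by
    rw [neg_add, ← hg]; abel
  have hgt := hXt.gain_eq hR₂
  rw [Matrix.mul_add, ← Matrix.mul_assoc, hR22, hS22'] at hgt
  have hRsym : P.Rᵀ = P.R := by rw [← hRdef, transpose_mul, transpose_transpose]
  have hR22sym : P.R.toBlocks₂₂ᵀ = P.R.toBlocks₂₂ := by
    rw [← hR22, transpose_mul, transpose_transpose]
  have hKR : Kᵀ * P.R = -(X * P.B₂ + P.S) := by
    have := congrArg transpose hRK
    rwa [transpose_mul, hRsym, transpose_neg, transpose_add, transpose_mul, transpose_transpose,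
      transpose_transpose, hX.transpose_eq] at this
  have hJR : Jᵀ * P.R.toBlocks₂₂ = -(Xt * P.B₂₂ + P.S.toBlocks₂₂) := by
    have := congrArg transpose hgt
    rw [transpose_add, transpose_mul, transpose_neg, transpose_mul, transpose_transpose,
      transpose_transpose, hXt.transpose_eq, hR22sym] at this
    rw [neg_add, ← this]; abel
  have hare : (X * P.B₂ + P.S) * K = -(P.Aᵀ * X + X * P.A + P.Q) := by
    have h1 := hX.1
    rw [Matrix.mul_assoc, ← neg_neg (_⁻¹ * _), ← hX.2.2, hQdef, hSdef, Matrix.mul_neg,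
      sub_neg_eq_add] at h1
    rw [← sub_eq_zero, ← h1]; abel
  have haret : (Xt * P.B₂₂ + P.S.toBlocks₂₂) * J = -(P.A₂₂ᵀ * Xt + Xt * P.A₂₂ + P.Q.toBlocks₂₂) := by
    have h1 := hXt.1
    rw [Matrix.mul_assoc, ← neg_neg (_⁻¹ * _), ← hXt.2.2, hQ22, hS22, Matrix.mul_neg,
      sub_neg_eq_add] at h1
    rw [← sub_eq_zero, ← h1]; abel
  set N := -(P.R.toBlocks₂₂⁻¹ * (P.B₂₂ᵀ * Φ + P.S.toBlocks₁₂ᵀ)) with hN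
  have hRN : P.R.toBlocks₂₂ * N = -(P.B₂₂ᵀ * Φ + P.S.toBlocks₁₂ᵀ) := by
    rw [hN, Matrix.mul_neg, Matrix.mul_nonsing_inv_cancel_left _ _ (by rwa [← hR22])]
  have hKh : P.Khat J Φ = fromBlocks 0 0 N J := rfl
  have first : (fromRows 0 1 : Matrix (m₁ ⊕ m₂) m₂ ℝ)ᵀ * P.R * (P.Khat J Φ - K) =
      -(P.B₂₂ᵀ * fromCols (Φ - X.toBlocks₂₁) (Xt - X.toBlocks₂₂)) := by
    rw [Matrix.mul_sub, Matrix.mul_assoc _ P.R K, hRK, hKh, ← fromBlocks_toBlocks P.R,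
      ← fromBlocks_toBlocks X, ← fromBlocks_toBlocks P.S, B₂]
    simp only [fromBlocks_transpose, fromBlocks_multiply, fromBlocks_add, fromBlocks_neg,
      transpose_fromRows, fromCols_mul_fromBlocks, transpose_zero, transpose_one, Matrix.zero_mul,
      Matrix.one_mul, zero_add, mul_fromCols, Matrix.mul_zero, toBlocks_fromBlocks₂₁,
      toBlocks_fromBlocks₂₂]
    have hRJ : P.R.toBlocks₂₂ * J = -(P.B₂₂ᵀ * Xt) - P.S.toBlocks₂₂ᵀ := by rw [← hgt]; abel
    rw [hRN, hRJ]
    ext i (j | j)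
    · simp only [Matrix.mul_sub, Matrix.sub_apply, Matrix.neg_apply, Matrix.add_apply, fromCols_apply_inl]
      ring
    · simp only [Matrix.mul_sub, Matrix.sub_apply, Matrix.neg_apply, Matrix.add_apply, fromCols_apply_inr]
      ring
  refine ⟨first, ?_⟩
  have hNt : ((fromRows 0 1 : Matrix (m₁ ⊕ m₂) m₂ ℝ) * J -
      K * (fromRows 0 1 : Matrix (n₁ ⊕ n₂) n₂ ℝ))ᵀ * (P.D₁₂ᵀ * P.D₁₂) * (P.Khat J Φ - K) =
      -(Jᵀ * (P.B₂₂ᵀ * fromCols (Φ - X.toBlocks₂₁) (Xt - X.toBlocks₂₂))) +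
      (fromRows 0 1 : Matrix (n₁ ⊕ n₂) n₂ ℝ)ᵀ * ((X * P.B₂ + P.S) * P.Khat J Φ +
        (P.Aᵀ * X + X * P.A + P.Q)) := by
    rw [← Matrix.mul_neg, ← first, hRdef, transpose_sub, transpose_mul, transpose_mul,
      ← neg_neg (P.Aᵀ * X + X * P.A + P.Q), ← hare, ← sub_eq_add_neg, ← Matrix.mul_sub,
      ← neg_neg (X * P.B₂ + P.S), ← hKR]
    simp only [Matrix.sub_mul, Matrix.neg_mul, Matrix.mul_neg, Matrix.mul_assoc]
    abel
  rw [hNt, Ahat_eq, ← hN, hKh, A, B₂, ← fromBlocks_toBlocks X, ← fromBlocks_toBlocks P.S,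
    ← fromBlocks_toBlocks P.Q]
  simp only [fromBlocks_transpose, fromBlocks_multiply, fromBlocks_add, transpose_fromRows,
    fromCols_mul_fromBlocks, transpose_zero, transpose_one, Matrix.zero_mul,
    Matrix.one_mul, zero_add, mul_fromCols, Matrix.mul_zero, toBlocks_fromBlocks₂₁,
    toBlocks_fromBlocks₂₂]
  have hneg : ∀ (a : Matrix n₂ n₁ ℝ) (b : Matrix n₂ n₂ ℝ), -fromCols a b = fromCols (-a) (-b) := by
    intro a b; ext i (j | j) <;> rfl
  rw [hneg, fromCols_add_fromCols, fromCols_add_fromCols, fromCols_add_fromCols,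
    ← fromCols_zero (m := n₂) (n₁ := n₁) (n₂ := n₂)]
  congr 1
  · have e1 := congrArg (Jᵀ * ·) hRN
    have e2 := congrArg (· * N) hJR
    simp only [transpose_add, transpose_mul, Matrix.mul_add, Matrix.add_mul, Matrix.mul_sub,
      Matrix.sub_mul, Matrix.neg_mul, Matrix.mul_neg, Matrix.mul_assoc] at e1 e2 hΦ ⊢
    linear_combination (norm := abel) hΦ + e2 - e1
  · simp only [transpose_add, transpose_mul, Matrix.mul_add, Matrix.add_mul, Matrix.mul_sub,
      Matrix.sub_mul, Matrix.mul_assoc] at haret ⊢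
    linear_combination (norm := abel) haret

/-- The matrix `[Ỹ - Y₁₁; Ψ - Y₂₁]` solves the Sylvester equation that relates the observer gain
of the first player to the centralized gain. -/
theorem sylvester_estimation (hY : IsARE P.Aᵀ P.C₂ᵀ P.B₁ᵀ P.D₂₁ᵀ Y Lᵀ)
    (hYt : IsARE P.A₁₁ᵀ P.C₁₁ᵀ P.B₁ᵀ.toCols₁ P.D₂₁ᵀ.toCols₁ Yt Mᵀ)
    (hV : IsUnit (P.D₂₁ * P.D₂₁ᵀ).det) (hV₁ : IsUnit P.V.toBlocks₁₁.det)
    (hΨ : (P.A₂₂ + P.B₂₂ * J) * Ψ + Ψ * (P.A₁₁ + M * P.C₁₁)ᵀ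
      - P.B₂₂ * P.R.toBlocks₂₂⁻¹ * (P.B₂₂ᵀ * Φ + P.S.toBlocks₁₂ᵀ) * (Yt - Y.toBlocks₁₁)
      + (P.A₂₁ * Yt + P.U.toBlocks₁₂ᵀ * Mᵀ + P.W.toBlocks₂₁ - P.B₂₂ * J * Y.toBlocks₂₁) = 0) :
    (P.Lhat M Ψ - L) * (P.D₂₁ * P.D₂₁ᵀ) * (fromCols 1 0 : Matrix k₁ (k₁ ⊕ k₂) ℝ)ᵀ =
      -(fromRows (Yt - Y.toBlocks₁₁) (Ψ - Y.toBlocks₂₁) * P.C₁₁ᵀ) ∧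
    P.Ahat (P.Khat J Φ) (P.Lhat M Ψ) * fromRows (Yt - Y.toBlocks₁₁) (Ψ - Y.toBlocks₂₁) +
      fromRows (Yt - Y.toBlocks₁₁) (Ψ - Y.toBlocks₂₁) * (P.A₁₁ + M * P.C₁₁)ᵀ +
      (P.Lhat M Ψ - L) * (P.D₂₁ * P.D₂₁ᵀ) * (M * (fromCols 1 0 : Matrix k₁ (k₁ ⊕ k₂) ℝ) -
        (fromCols 1 0 : Matrix n₁ (n₁ ⊕ n₂) ℝ) * L)ᵀ = 0 := by
  have hV11 : P.D₂₁ᵀ.toCols₁ᵀ * P.D₂₁ᵀ.toCols₁ = P.V.toBlocks₁₁ := rfl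
  have hU11 : P.D₂₁ᵀ.toCols₁ᵀ * P.B₁ᵀ.toCols₁ = P.U.toBlocks₁₁ := rfl
  have hW11 : P.B₁ᵀ.toCols₁ᵀ * P.B₁ᵀ.toCols₁ = P.W.toBlocks₁₁ := rfl
  have hU11' : P.B₁ᵀ.toCols₁ᵀ * P.D₂₁ᵀ.toCols₁ = P.U.toBlocks₁₁ᵀ := by
    rw [← hU11, transpose_mul, transpose_transpose]
  have hVdef : P.D₂₁ * P.D₂₁ᵀ = P.V := rfl
  have hUdef : P.D₂₁ * P.B₁ᵀ = P.U := rfl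
  have hUdef' : P.B₁ * P.D₂₁ᵀ = P.Uᵀ := by rw [← hUdef, transpose_mul, transpose_transpose]
  have hWdef : P.B₁ * P.B₁ᵀ = P.W := rfl
  have hVL := hY.gain_eq (by rwa [transpose_transpose])
  rw [Matrix.mul_add, ← Matrix.mul_assoc, transpose_transpose, transpose_transpose, hVdef,
    hUdef] at hVL
  replace hVL : P.V * Lᵀ = -(P.C₂ * Y + P.U) := by
    rw [neg_add, ← hVL]; abel
  have hVM := hYt.gain_eq (by rwa [hV11])
  rw [Matrix.mul_add, ← Matrix.mul_assoc, hV11, hU11, transpose_transpose] at hVM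
  replace hVM : P.V.toBlocks₁₁ * Mᵀ = -(P.C₁₁ * Yt + P.U.toBlocks₁₁) := by
    rw [neg_add, ← hVM]; abel
  have hVsym : P.Vᵀ = P.V := by rw [← hVdef, transpose_mul, transpose_transpose]
  have hLV : L * P.V = -(Y * P.C₂ᵀ + P.Uᵀ) := by
    have := congrArg transpose hVL
    rwa [transpose_mul, hVsym, transpose_neg, transpose_add, transpose_mul, transpose_transpose,
      hY.transpose_eq] at this
  have hMV : M * P.V.toBlocks₁₁ = -(Yt * P.C₁₁ᵀ + P.U.toBlocks₁₁ᵀ) := by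
    have := congrArg transpose hVM
    rwa [transpose_mul, ← hV11, transpose_mul, transpose_neg, transpose_add, transpose_mul,
      transpose_transpose, transpose_transpose, hYt.transpose_eq] at this
  have hare : (Y * P.C₂ᵀ + P.Uᵀ) * Lᵀ = -(P.A * Y + Y * P.Aᵀ + P.W) := by
    have h1 := hY.1
    rw [Matrix.mul_assoc, ← neg_neg (_⁻¹ * _), ← hY.2.2, transpose_transpose, transpose_transpose,
      hWdef, hUdef', Matrix.mul_neg, sub_neg_eq_add] at h1
    rw [← sub_eq_zero, ← h1]; abel
  have haret : (Yt * P.C₁₁ᵀ + P.U.toBlocks₁₁ᵀ) * Mᵀ =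
      -(P.A₁₁ * Yt + Yt * P.A₁₁ᵀ + P.W.toBlocks₁₁) := by
    have h1 := hYt.1
    rw [Matrix.mul_assoc, ← neg_neg (_⁻¹ * _), ← hYt.2.2, transpose_transpose, hW11, hU11',
      Matrix.mul_neg, sub_neg_eq_add] at h1
    rw [← sub_eq_zero, ← h1]; abel
  set N := -((Ψ * P.C₁₁ᵀ + P.U.toBlocks₁₂ᵀ) * P.V.toBlocks₁₁⁻¹) with hN
  have hNV : N * P.V.toBlocks₁₁ = -(Ψ * P.C₁₁ᵀ + P.U.toBlocks₁₂ᵀ) := by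
    rw [hN, Matrix.neg_mul, Matrix.nonsing_inv_mul_cancel_right _ _ hV₁]
  have hLh : P.Lhat M Ψ = fromBlocks M 0 N 0 := rfl
  have first : (P.Lhat M Ψ - L) * P.V * (fromCols 1 0 : Matrix k₁ (k₁ ⊕ k₂) ℝ)ᵀ =
      -(fromRows (Yt - Y.toBlocks₁₁) (Ψ - Y.toBlocks₂₁) * P.C₁₁ᵀ) := by
    rw [Matrix.sub_mul, hLV, hLh, ← fromBlocks_toBlocks P.V, ← fromBlocks_toBlocks Y,
      ← fromBlocks_toBlocks P.U, C₂]
    simp only [fromBlocks_transpose, fromBlocks_multiply, fromBlocks_add, fromBlocks_neg,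
      transpose_fromCols, Matrix.sub_mul, fromBlocks_mul_fromRows, transpose_zero, transpose_one,
      Matrix.zero_mul, Matrix.mul_one, add_zero, fromRows_mul, Matrix.mul_zero,
      toBlocks_fromBlocks₁₁, toBlocks_fromBlocks₂₁]
    rw [hNV, hMV]
    ext (i | i) j
    · simp only [Matrix.sub_apply, Matrix.neg_apply, Matrix.add_apply, fromRows_apply_inl]
      ring
    · simp only [Matrix.sub_apply, Matrix.neg_apply, Matrix.add_apply, fromRows_apply_inr]
      ring
  refine ⟨first, ?_⟩
  have hNt : (P.Lhat M Ψ - L) * (P.D₂₁ * P.D₂₁ᵀ) * (M * (fromCols 1 0 : Matrix k₁ (k₁ ⊕ k₂) ℝ) -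
        (fromCols 1 0 : Matrix n₁ (n₁ ⊕ n₂) ℝ) * L)ᵀ =
      -(fromRows (Yt - Y.toBlocks₁₁) (Ψ - Y.toBlocks₂₁) * P.C₁₁ᵀ * Mᵀ) +
      (P.Lhat M Ψ * (P.C₂ * Y + P.U) + (P.A * Y + Y * P.Aᵀ + P.W)) *
        (fromCols 1 0 : Matrix n₁ (n₁ ⊕ n₂) ℝ)ᵀ := by
    rw [← Matrix.neg_mul, ← first, hVdef, transpose_sub, transpose_mul, transpose_mul,
      ← neg_neg (P.A * Y + Y * P.Aᵀ + P.W), ← hare, ← neg_neg (P.C₂ * Y + P.U), ← hVL,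
      ← neg_neg (Y * P.C₂ᵀ + P.Uᵀ), ← hLV]
    simp only [Matrix.mul_sub, Matrix.sub_mul, Matrix.add_mul, Matrix.neg_mul, Matrix.mul_neg,
      Matrix.mul_assoc]
    abel
  rw [hNt, Ahat_eq, ← hN, hLh, A, C₂, ← fromBlocks_toBlocks Y, ← fromBlocks_toBlocks P.U,
    ← fromBlocks_toBlocks P.W]
  simp only [fromBlocks_transpose, fromBlocks_multiply, fromBlocks_add, transpose_fromCols,
    fromBlocks_mul_fromRows, transpose_zero, transpose_one, Matrix.zero_mul, Matrix.mul_one,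
    add_zero, fromRows_mul, Matrix.mul_zero, toBlocks_fromBlocks₁₁, toBlocks_fromBlocks₂₁]
  have hneg : ∀ (a : Matrix n₁ n₁ ℝ) (b : Matrix n₂ n₁ ℝ), -fromRows a b = fromRows (-a) (-b) := by
    intro a b; ext (i | i) j <;> rfl
  rw [hneg, fromRows_add_fromRows, fromRows_add_fromRows, fromRows_add_fromRows,
    ← fromRows_zero (n := n₁) (m₁ := n₁) (m₂ := n₂)]
  congr 1
  · have e1 := congrArg (M * ·) hVM
    have e2 := congrArg (· * Mᵀ) hMV
    simp only [transpose_add, transpose_mul, Matrix.mul_add, Matrix.add_mul, Matrix.mul_sub,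
      Matrix.sub_mul, Matrix.neg_mul, Matrix.mul_neg, Matrix.mul_assoc] at e1 e2 haret ⊢
    linear_combination (norm := abel) haret + e1 - e2
  · have e1 := congrArg (N * ·) hVM
    have e2 := congrArg (· * Mᵀ) hNV
    simp only [transpose_add, transpose_mul, Matrix.mul_add, Matrix.add_mul, Matrix.mul_sub,
      Matrix.sub_mul, Matrix.neg_mul, Matrix.mul_neg, Matrix.mul_assoc] at e1 e2 hΨ ⊢
    linear_combination (norm := abel) hΨ + e1 - e2

end TwoPlayerPlant

/-! ### Perturbations orthogonal to the contribution of the parameter -/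

namespace StatePlant

variable {n m k p q : Type*} [Fintype n] [DecidableEq n] [Fintype m] [DecidableEq m]
  [Fintype k] [DecidableEq k] [Fintype p] [DecidableEq p] [Fintype q]
  {G : StatePlant n m k p q} {K Kh : Matrix m n ℝ} {L Lh : Matrix n k ℝ} {X Y : Matrix n n ℝ}

theorem conjTranspose_evalTF_paramTF (hh : IsHurwitz (G.A + G.B₂ * Kh + Lh * G.C₂)) (ω : ℝ) :
    (evalTF (G.paramTF K Kh L Lh) (ω * Complex.I))ᴴ = (cplx (Lh - L))ᴴ *
      (evalTF (resTF (G.A + G.B₂ * Kh + Lh * G.C₂)) (ω * Complex.I))ᴴ * (cplx (Kh - K))ᴴ := by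
  have hΛ := (isStrictTF_resTF hh).isStableTF
  rw [paramTF, evalTF_mul ((isStableTF_cst _).mul hΛ) (isStableTF_cst _) (by simp),
    evalTF_mul (isStableTF_cst _) hΛ (by simp), evalTF_cst, evalTF_cst, conjTranspose_mul,
    conjTranspose_mul, Matrix.mul_assoc]

section Orthogonality

variable (hX : IsARE G.A G.B₂ G.C₁ G.D₁₂ X K) (hR : IsUnit (G.D₁₂ᵀ * G.D₁₂).det)
  (hY : IsARE G.Aᵀ G.C₂ᵀ G.B₁ᵀ G.D₂₁ᵀ Y Lᵀ) (hV : IsUnit (G.D₂₁ * G.D₂₁ᵀ).det)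
  (hh : IsHurwitz (G.A + G.B₂ * Kh + Lh * G.C₂))
include hX hR hY hV hh

/-- If the left factor `P₁` of a perturbation is related to the gain `Kh - K` by a Sylvester
equation, then the para-conjugate of the parameter becomes stable upon multiplication by `R P₁`,
and the perturbation is orthogonal to the closed-loop contribution of the parameter. -/
theorem h2Inner_paramTF_eq_zero_of_left {a b n' : Type*} [Fintype a] [Fintype b] [Fintype n']
    [DecidableEq n'] {A' : Matrix n' n' ℝ} (hA' : IsHurwitz A') {E : Matrix m a ℝ}
    {N : Matrix m n' ℝ} {B : Matrix n' a ℝ} {Γ : Matrix n' n ℝ}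
    (h1 : Eᵀ * (G.D₁₂ᵀ * G.D₁₂) * (Kh - K) = -(Bᵀ * Γ))
    (h2 : A'ᵀ * Γ + Γ * (G.A + G.B₂ * Kh + Lh * G.C₂) + Nᵀ * (G.D₁₂ᵀ * G.D₁₂) * (Kh - K) = 0)
    {Δ : Matrix a b (RatFunc ℝ)} {P₂ : Matrix b k (RatFunc ℝ)} (hΔ : IsStrictTF Δ)
    (hP₂ : IsStableTF P₂) :
    h2Inner (G.ctrlTF K * G.paramTF K Kh L Lh * G.innovTF L)
      (G.ctrlTF K * ((cst E + cst N * resTF A' * cst B) * Δ * P₂) * G.innovTF L) = 0 := by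
  have hA := isStrictTF_resTF hA'
  have hP₁ : IsStableTF (cst E + cst N * resTF A' * cst B) :=
    (isStableTF_cst _).add (((isStableTF_cst _).mul hA.isStableTF).mul (isStableTF_cst _))
  have hM := hP₂.mul (isStableTF_cst ((G.D₂₁ * G.D₂₁ᵀ) * (Lh - L)ᵀ * Γᵀ))
  refine h2Inner_param_eq_zero hX hR hY hV (isStrictTF_paramTF hh).isStableTF hP₁ hP₂ hΔ
    (Z := P₂ * cst ((G.D₂₁ * G.D₂₁ᵀ) * (Lh - L)ᵀ * Γᵀ) * resTF A' * cst B)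
    ((hM.mul_strict hA).mul_stable (isStableTF_cst _)) fun ω => ?_
  have hr : (cplx (G.D₁₂ᵀ * G.D₁₂))ᴴ = cplx (G.D₁₂ᵀ * G.D₁₂) := by
    rw [conjTranspose_cplx, transpose_mul, transpose_transpose]
  have key := congrArg conjTranspose (conj_mul_resTF_of_sylvester hA' hh h2 h1 ω)
  rw [evalTF_mul (hM.mul hA.isStableTF) (isStableTF_cst _) (by simp),
    evalTF_mul hM hA.isStableTF (by simp), evalTF_mul hP₂ (isStableTF_cst _) (by simp),
    evalTF_cst, evalTF_cst, conjTranspose_evalTF_paramTF hh, cplx_mul _ Γᵀ,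
    cplx_mul _ (Lh - L)ᵀ, ← conjTranspose_cplx, ← conjTranspose_cplx]
  simp only [conjTranspose_mul, conjTranspose_conjTranspose, hr, Matrix.mul_assoc] at key ⊢
  rw [key]

/-- The dual of `h2Inner_paramTF_eq_zero_of_left`, for the right factor of a perturbation. -/
theorem h2Inner_paramTF_eq_zero_of_right {a b n' : Type*} [Fintype a] [Fintype b] [Fintype n']
    [DecidableEq n'] {A' : Matrix n' n' ℝ} (hA' : IsHurwitz A') {E : Matrix b k ℝ}
    {N : Matrix n' k ℝ} {C : Matrix b n' ℝ} {Γ : Matrix n n' ℝ}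
    (h1 : (Lh - L) * (G.D₂₁ * G.D₂₁ᵀ) * Eᵀ = -(Γ * Cᵀ))
    (h2 : (G.A + G.B₂ * Kh + Lh * G.C₂) * Γ + Γ * A'ᵀ + (Lh - L) * (G.D₂₁ * G.D₂₁ᵀ) * Nᵀ = 0)
    {Δ : Matrix a b (RatFunc ℝ)} {P₁ : Matrix m a (RatFunc ℝ)} (hΔ : IsStrictTF Δ)
    (hP₁ : IsStableTF P₁) :
    h2Inner (G.ctrlTF K * G.paramTF K Kh L Lh * G.innovTF L)
      (G.ctrlTF K * (P₁ * Δ * (cst E + cst C * resTF A' * cst N)) * G.innovTF L) = 0 := by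
  have hA := isStrictTF_resTF hA'
  have hP₂ : IsStableTF (cst E + cst C * resTF A' * cst N) :=
    (isStableTF_cst _).add (((isStableTF_cst _).mul hA.isStableTF).mul (isStableTF_cst _))
  have hM := (isStableTF_cst C).mul_strict hA
  have hc := isStableTF_cst (Γᵀ * (Kh - K)ᵀ * (G.D₁₂ᵀ * G.D₁₂))
  refine h2Inner_param_eq_zero hX hR hY hV (isStrictTF_paramTF hh).isStableTF hP₁ hP₂ hΔ
    (Z := cst C * resTF A' * cst (Γᵀ * (Kh - K)ᵀ * (G.D₁₂ᵀ * G.D₁₂)) * P₁)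
    ((hM.mul_stable hc).mul_stable hP₁) fun ω => ?_
  have hv : (cplx (G.D₂₁ * G.D₂₁ᵀ))ᴴ = cplx (G.D₂₁ * G.D₂₁ᵀ) := by
    rw [conjTranspose_cplx, transpose_mul, transpose_transpose]
  have key := congrArg conjTranspose (resTF_mul_conj_of_sylvester hA' hh h2 h1 ω)
  rw [evalTF_mul (hM.isStableTF.mul hc) hP₁ (by simp), evalTF_mul hM.isStableTF hc (by simp),
    evalTF_mul (isStableTF_cst _) hA.isStableTF (by simp), evalTF_cst, evalTF_cst,
    conjTranspose_evalTF_paramTF hh, cplx_mul _ (G.D₁₂ᵀ * G.D₁₂), cplx_mul _ (Kh - K)ᵀ,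
    ← conjTranspose_cplx, ← conjTranspose_cplx]
  simp only [conjTranspose_mul, conjTranspose_conjTranspose, hv, Matrix.mul_assoc] at key
  have e := congrArg (· * ((cplx (Kh - K))ᴴ * (cplx (G.D₁₂ᵀ * G.D₁₂) * evalTF P₁ (ω * Complex.I))))
    key
  simp only [Matrix.mul_assoc] at e ⊢
  exact e

end Orthogonality

end StatePlant

/-- A block-lower-triangular matrix is the sum of one that uses only the first measurement and one
that maps the second measurement to the second input. -/
theorem IsLower.eq_add {m₁ m₂ k₁ k₂ : Type*} [Fintype m₁] [DecidableEq m₁] [Fintype m₂]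
    [DecidableEq m₂] [Fintype k₁] [DecidableEq k₁] [Fintype k₂] [DecidableEq k₂]
    {Δ : Matrix (m₁ ⊕ m₂) (k₁ ⊕ k₂) (RatFunc ℝ)} (h : IsLower Δ) :
    Δ = Δ * cst (fromRows 1 0 : Matrix (k₁ ⊕ k₂) k₁ ℝ) *
        cst (fromCols 1 0 : Matrix k₁ (k₁ ⊕ k₂) ℝ) +
      cst (fromRows 0 1 : Matrix (m₁ ⊕ m₂) m₂ ℝ) *
        (cst (fromCols 0 1 : Matrix m₂ (m₁ ⊕ m₂) ℝ) * Δ *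
          cst (fromRows 0 1 : Matrix (k₁ ⊕ k₂) k₂ ℝ)) *
        cst (fromCols 0 1 : Matrix k₂ (k₁ ⊕ k₂) ℝ) := by
  obtain ⟨a, c, d, rfl⟩ : ∃ a c d, Δ = fromBlocks a 0 c d :=
    ⟨_, _, _, by rw [← show Δ.toBlocks₁₂ = 0 from h, fromBlocks_toBlocks]⟩
  simp only [cst_fromRows, cst_fromCols, cst_zero, cst_one, fromBlocks_mul_fromRows, Matrix.mul_one,
    Matrix.mul_zero, add_zero, zero_add, fromCols_mul_fromRows, fromRows_mul, Matrix.zero_mul,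
    Matrix.one_mul, fromCols_mul_fromBlocks, mul_fromCols]
  ext (i | i) (j | j) <;> simp

namespace TwoPlayerPlant

variable {n₁ n₂ m₁ m₂ k₁ k₂ p q : Type*} [Fintype n₁] [DecidableEq n₁]
    [Fintype n₂] [DecidableEq n₂] [Fintype m₁] [DecidableEq m₁] [Fintype m₂] [DecidableEq m₂]
    [Fintype k₁] [DecidableEq k₁] [Fintype k₂] [DecidableEq k₂] [Fintype p] [DecidableEq p]
    [Fintype q] {P : TwoPlayerPlant n₁ n₂ m₁ m₂ k₁ k₂ p q}
    {X Y : Matrix (n₁ ⊕ n₂) (n₁ ⊕ n₂) ℝ} {K Kh : Matrix (m₁ ⊕ m₂) (n₁ ⊕ n₂) ℝ}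
    {L Lh : Matrix (n₁ ⊕ n₂) (k₁ ⊕ k₂) ℝ} {Xt : Matrix n₂ n₂ ℝ} {J : Matrix m₂ n₂ ℝ}
    {Yt : Matrix n₁ n₁ ℝ} {M : Matrix n₁ k₁ ℝ} {Φ Ψ : Matrix n₂ n₁ ℝ}

/-- A block-diagonal change of the feedback gain, seen by the second player. -/
theorem change_gain_mul_inr (K : Matrix (m₁ ⊕ m₂) (n₁ ⊕ n₂) ℝ) (F₁ : Matrix m₁ n₁ ℝ)
    (J : Matrix m₂ n₂ ℝ) :
    (1 + cst (fromBlocks F₁ 0 0 J - K) * resTF (P.A + P.B₂ * fromBlocks F₁ 0 0 J) * cst P.B₂) *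
        cst (fromRows 0 1 : Matrix (m₁ ⊕ m₂) m₂ ℝ) =
      cst (fromRows 0 1 : Matrix (m₁ ⊕ m₂) m₂ ℝ) +
        cst ((fromRows 0 1 : Matrix (m₁ ⊕ m₂) m₂ ℝ) * J -
          K * (fromRows 0 1 : Matrix (n₁ ⊕ n₂) n₂ ℝ)) *
          resTF (P.A₂₂ + P.B₂₂ * J) * cst P.B₂₂ := by
  have hB : P.B₂ * (fromRows 0 1 : Matrix (m₁ ⊕ m₂) m₂ ℝ) =
      (fromRows 0 1 : Matrix (n₁ ⊕ n₂) n₂ ℝ) * P.B₂₂ := by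
    simp [B₂, fromBlocks_mul_fromRows, fromRows_mul]
  have hF : fromBlocks F₁ 0 0 J * (fromRows 0 1 : Matrix (n₁ ⊕ n₂) n₂ ℝ) =
      (fromRows 0 1 : Matrix (m₁ ⊕ m₂) m₂ ℝ) * J := by
    simp [fromBlocks_mul_fromRows, fromRows_mul]
  have hA : (P.A + P.B₂ * fromBlocks F₁ 0 0 J) * (fromRows 0 1 : Matrix (n₁ ⊕ n₂) n₂ ℝ) =
      (fromRows 0 1 : Matrix (n₁ ⊕ n₂) n₂ ℝ) * (P.A₂₂ + P.B₂₂ * J) := by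
    rw [Matrix.add_mul, Matrix.mul_assoc, hF, ← Matrix.mul_assoc, hB]
    simp [A, fromBlocks_mul_fromRows, fromRows_mul, fromRows_add_fromRows]
  rw [Matrix.add_mul, Matrix.one_mul, Matrix.mul_assoc _ (cst P.B₂), ← cst_mul, hB, cst_mul,
    Matrix.mul_assoc (cst _) (resTF _), ← Matrix.mul_assoc (resTF _),
    resTF_mul_cst_of_intertwine hA, ← hF, ← Matrix.sub_mul]
  simp only [cst_mul, Matrix.mul_assoc]

/-- A block-diagonal change of the observer gain, seen by the first player. -/
theorem inl_mul_change_gain (L : Matrix (n₁ ⊕ n₂) (k₁ ⊕ k₂) ℝ) (M : Matrix n₁ k₁ ℝ)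
    (H₂ : Matrix n₂ k₂ ℝ) :
    cst (fromCols 1 0 : Matrix k₁ (k₁ ⊕ k₂) ℝ) *
        (1 + cst P.C₂ * resTF (P.A + fromBlocks M 0 0 H₂ * P.C₂) * cst (fromBlocks M 0 0 H₂ - L)) =
      cst (fromCols 1 0 : Matrix k₁ (k₁ ⊕ k₂) ℝ) +
        cst P.C₁₁ * resTF (P.A₁₁ + M * P.C₁₁) *
          cst (M * (fromCols 1 0 : Matrix k₁ (k₁ ⊕ k₂) ℝ) -
            (fromCols 1 0 : Matrix n₁ (n₁ ⊕ n₂) ℝ) * L) := by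
  have hC : (fromCols 1 0 : Matrix k₁ (k₁ ⊕ k₂) ℝ) * P.C₂ =
      P.C₁₁ * (fromCols 1 0 : Matrix n₁ (n₁ ⊕ n₂) ℝ) := by
    simp [C₂, fromCols_mul_fromBlocks, mul_fromCols]
  have hH : (fromCols 1 0 : Matrix n₁ (n₁ ⊕ n₂) ℝ) * fromBlocks M 0 0 H₂ =
      M * (fromCols 1 0 : Matrix k₁ (k₁ ⊕ k₂) ℝ) := by
    simp [fromCols_mul_fromBlocks, mul_fromCols]
  have hA : (fromCols 1 0 : Matrix n₁ (n₁ ⊕ n₂) ℝ) * (P.A + fromBlocks M 0 0 H₂ * P.C₂) =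
      (P.A₁₁ + M * P.C₁₁) * (fromCols 1 0 : Matrix n₁ (n₁ ⊕ n₂) ℝ) := by
    rw [Matrix.mul_add, ← Matrix.mul_assoc, hH, Matrix.mul_assoc, hC]
    simp [A, fromCols_mul_fromBlocks, mul_fromCols, fromCols_add_fromCols]
  rw [Matrix.mul_add, Matrix.mul_one, ← Matrix.mul_assoc, ← Matrix.mul_assoc, ← cst_mul, hC,
    cst_mul, Matrix.mul_assoc (cst P.C₁₁), cst_mul_resTF_of_intertwine hA, ← hH, ← Matrix.mul_sub]
  simp only [cst_mul, Matrix.mul_assoc]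

/-- The two-player controller is block lower triangular: `K̂` does not feed the first input and
`L̂` does not use the second measurement. -/
theorem isLower_Kopt (K : Matrix (m₁ ⊕ m₂) (n₁ ⊕ n₂) ℝ) (L : Matrix (n₁ ⊕ n₂) (k₁ ⊕ k₂) ℝ)
    (J : Matrix m₂ n₂ ℝ) (M : Matrix n₁ k₁ ℝ) (Φ Ψ : Matrix n₂ n₁ ℝ) :
    IsLower (P.Kopt K (P.Khat J Φ) L (P.Lhat M Ψ)) := by
  set Kh := P.Khat J Φ with hKh
  set Lh := P.Lhat M Ψ with hLh
  set ξ := resTF (P.A + P.B₂ * K + Lh * P.C₂) * cst (-Lh) with hξ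
  set η := resTF (P.A + L * P.C₂ + P.B₂ * Kh) * (cst (P.B₂ * K - P.B₂ * Kh) * ξ + cst (-L)) with hη
  have h : resTF (fromBlocks (P.A + P.B₂ * K + Lh * P.C₂) 0
      (P.B₂ * K - P.B₂ * Kh) (P.A + L * P.C₂ + P.B₂ * Kh)) * cst (fromRows (-Lh) (-L)) =
      fromRows ξ η := by
    symm
    rw [eq_resTF_mul_iff] at hξ hη ⊢
    have hsm : (RatFunc.X : RatFunc ℝ) • fromRows ξ η =
        fromRows ((RatFunc.X : RatFunc ℝ) • ξ) ((RatFunc.X : RatFunc ℝ) • η) := by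
      ext (i | i) j <;> rfl
    rw [hsm, hξ, hη, cst_fromBlocks, cst_fromRows, fromBlocks_mul_fromRows, fromRows_add_fromRows,
      cst_zero, Matrix.zero_mul, add_zero]
    congr 1
    abel
  have hK : P.Kopt K Kh L Lh = cst (K - Kh) * resTF (P.A + P.B₂ * K + Lh * P.C₂) * cst (-Lh) +
      cst Kh * η := by
    rw [Kopt, transferFn_eq, cst_zero, zero_add, Matrix.mul_assoc, h, cst_fromCols,
      fromCols_mul_fromRows, Matrix.mul_assoc]
  rw [hK]
  refine IsLower.add ?_ ?_
  · ext i j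
    have : ∀ l, cst (-Lh) l (Sum.inr j) = 0 := by
      rintro (l | l) <;> simp [hLh, Lhat, cst]
    simp [toBlocks₁₂, Matrix.mul_apply (N := cst (-Lh)), this]
  · ext i j
    have : ∀ l, cst Kh (Sum.inl i) l = 0 := by
      rintro (l | l) <;> simp [hKh, Khat, cst]
    simp [toBlocks₁₂, Matrix.mul_apply (M := cst Kh), this]

end TwoPlayerPlant

/-! ### The two-player problem -/

namespace TwoPlayerPlant

variable {n₁ n₂ m₁ m₂ k₁ k₂ p q : Type*} [Fintype n₁] [DecidableEq n₁]
    [Fintype n₂] [DecidableEq n₂] [Fintype m₁] [DecidableEq m₁] [Fintype m₂] [DecidableEq m₂]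
    [Fintype k₁] [DecidableEq k₁] [Fintype k₂] [DecidableEq k₂] [Fintype p] [DecidableEq p]
    [Fintype q] {P : TwoPlayerPlant n₁ n₂ m₁ m₂ k₁ k₂ p q}
    {X Y : Matrix (n₁ ⊕ n₂) (n₁ ⊕ n₂) ℝ} {K : Matrix (m₁ ⊕ m₂) (n₁ ⊕ n₂) ℝ}
    {L : Matrix (n₁ ⊕ n₂) (k₁ ⊕ k₂) ℝ} {Xt : Matrix n₂ n₂ ℝ} {J : Matrix m₂ n₂ ℝ}
    {Yt : Matrix n₁ n₁ ℝ} {M : Matrix n₁ k₁ ℝ} {Φ Ψ : Matrix n₂ n₁ ℝ}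

theorem isHurwitz_first
    (hYt : IsARE P.A₁₁ᵀ P.C₁₁ᵀ P.B₁ᵀ.toCols₁ P.D₂₁ᵀ.toCols₁ Yt Mᵀ) :
    IsHurwitz (P.A₁₁ + M * P.C₁₁) := by
  have := hYt.isHurwitz.transpose
  rwa [transpose_add, transpose_mul, transpose_transpose, transpose_transpose,
    transpose_transpose] at this

section

variable (hR : IsUnit (P.D₁₂ᵀ * P.D₁₂).det) (hV : IsUnit (P.D₂₁ * P.D₂₁ᵀ).det)
    (hR₂ : IsUnit (P.D₁₂.toCols₂ᵀ * P.D₁₂.toCols₂).det) (hV₁ : IsUnit P.V.toBlocks₁₁.det)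
    (hX : IsARE P.A P.B₂ P.C₁ P.D₁₂ X K) (hY : IsARE P.Aᵀ P.C₂ᵀ P.B₁ᵀ P.D₂₁ᵀ Y Lᵀ)
    (hXt : IsARE P.A₂₂ P.B₂₂ P.C₁.toCols₂ P.D₁₂.toCols₂ Xt J)
    (hYt : IsARE P.A₁₁ᵀ P.C₁₁ᵀ P.B₁ᵀ.toCols₁ P.D₂₁ᵀ.toCols₁ Yt Mᵀ)
    (hΦΨ : P.CoupledEquations X Y Xt J Yt M Φ Ψ)
include hXt hYt

/-- `Â` is block lower triangular with the closed-loop matrices of the two small Riccati equations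
on its diagonal. -/
theorem isHurwitz_Ahat : IsHurwitz (P.Ahat (P.Khat J Φ) (P.Lhat M Ψ)) := by
  rw [Ahat_eq]
  exact (isHurwitz_first hYt).fromBlocks_zero₁₂ hXt.isHurwitz _

include hR hV hR₂ hV₁ hX hY hΦΨ

/-- The contribution of the parameter of the two-player controller is orthogonal to every
perturbation by a block-lower-triangular Youla parameter, taken with respect to block-diagonal
stabilizing gains. -/
theorem h2Inner_paramTF_lower_eq_zero {F₁ : Matrix m₁ n₁ ℝ} {H₂ : Matrix n₂ k₂ ℝ}
    (hF : IsHurwitz (P.A + P.B₂ * fromBlocks F₁ 0 0 J))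
    (hH : IsHurwitz (P.A + fromBlocks M 0 0 H₂ * P.C₂))
    {Δ : Matrix (m₁ ⊕ m₂) (k₁ ⊕ k₂) (RatFunc ℝ)} (hΔ : IsStrictTF Δ) (hlow : IsLower Δ) :
    h2Inner (P.toStatePlant.ctrlTF K * P.toStatePlant.paramTF K (P.Khat J Φ) L (P.Lhat M Ψ) *
        P.toStatePlant.innovTF L)
      (P.toStatePlant.ctrlTF (fromBlocks F₁ 0 0 J) * Δ *
        P.toStatePlant.innovTF (fromBlocks M 0 0 H₂)) = 0 := by
  have hh : IsHurwitz (P.toStatePlant.A + P.toStatePlant.B₂ * P.Khat J Φ +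
    P.Lhat M Ψ * P.toStatePlant.C₂) := isHurwitz_Ahat hXt hYt
  have hK : IsHurwitz (P.toStatePlant.A + P.toStatePlant.B₂ * K) := hX.isHurwitz
  have hL : IsHurwitz (P.toStatePlant.A + L * P.toStatePlant.C₂) :=
    StatePlant.isHurwitz_estimator (G := P.toStatePlant) hY
  have hT := StatePlant.isStableTF_ctrlTF hK
  have hT' := StatePlant.isStableTF_innovTF hL
  obtain ⟨s1, s2⟩ := sylvester_control hX hXt hR hR₂ hΦΨ.1
  obtain ⟨t1, t2⟩ := sylvester_estimation hY hYt hV hV₁ hΦΨ.2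
  set g := 1 + cst (fromBlocks F₁ 0 0 J - K) * resTF (P.A + P.B₂ * fromBlocks F₁ 0 0 J) *
    cst P.B₂ with hg
  set g' := 1 + cst P.C₂ * resTF (P.A + fromBlocks M 0 0 H₂ * P.C₂) *
    cst (fromBlocks M 0 0 H₂ - L) with hg'
  have sg : IsStableTF g := isStableTF_one.add (((isStableTF_cst _).mul
    (isStrictTF_resTF hF).isStableTF).mul (isStableTF_cst _))
  have sg' : IsStableTF g' := isStableTF_one.add (((isStableTF_cst _).mul
    (isStrictTF_resTF hH).isStableTF).mul (isStableTF_cst _))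
  have e1 := change_gain_mul_inr (P := P) K F₁ J
  have e2 := inl_mul_change_gain (P := P) L M H₂
  rw [← hg] at e1
  rw [← hg'] at e2
  set Δ₁ := Δ * cst (fromRows 1 0 : Matrix (k₁ ⊕ k₂) k₁ ℝ) with hΔ₁
  set Δ₂ := cst (fromCols 0 1 : Matrix m₂ (m₁ ⊕ m₂) ℝ) * Δ *
          cst (fromRows 0 1 : Matrix (k₁ ⊕ k₂) k₂ ℝ) with hΔ₂
  have sΔ₁ : IsStrictTF Δ₁ := hΔ.mul_stable (isStableTF_cst _)
  have sΔ₂ : IsStrictTF Δ₂ := ((isStableTF_cst _).mul_strict hΔ).mul_stable (isStableTF_cst _)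
  -- `Δ₁` is handled by the estimation of the first player, `Δ₂` by the control of the second
  have hsplit : g * Δ * g' = g * Δ₁ * (cst (fromCols 1 0 : Matrix k₁ (k₁ ⊕ k₂) ℝ) * g') +
      g * cst (fromRows 0 1 : Matrix (m₁ ⊕ m₂) m₂ ℝ) * Δ₂ *
        (cst (fromCols 0 1 : Matrix k₂ (k₁ ⊕ k₂) ℝ) * g') := by
    nth_rw 1 [hlow.eq_add]
    rw [← hΔ₁, ← hΔ₂]
    simp only [Matrix.mul_add, Matrix.add_mul, Matrix.mul_assoc]
  have hc : P.toStatePlant.ctrlTF (fromBlocks F₁ 0 0 J) = P.toStatePlant.ctrlTF K * g :=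
    StatePlant.ctrlTF_eq_mul K _
  have hi : P.toStatePlant.innovTF (fromBlocks M 0 0 H₂) = g' * P.toStatePlant.innovTF L :=
    StatePlant.innovTF_eq_mul L _
  have hre : P.toStatePlant.ctrlTF (fromBlocks F₁ 0 0 J) * Δ *
      P.toStatePlant.innovTF (fromBlocks M 0 0 H₂) =
      P.toStatePlant.ctrlTF K * (g * Δ₁ * (cst (fromCols 1 0 : Matrix k₁ (k₁ ⊕ k₂) ℝ) * g')) *
        P.toStatePlant.innovTF L +
      P.toStatePlant.ctrlTF K * (g * cst (fromRows 0 1 : Matrix (m₁ ⊕ m₂) m₂ ℝ) * Δ₂ *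
        (cst (fromCols 0 1 : Matrix k₂ (k₁ ⊕ k₂) ℝ) * g')) * P.toStatePlant.innovTF L := by
    rw [← Matrix.add_mul, ← Matrix.mul_add, ← hsplit, hc, hi]
    simp only [Matrix.mul_assoc]
  have z1 := StatePlant.h2Inner_paramTF_eq_zero_of_right (G := P.toStatePlant) hX hR hY hV hh
    (isHurwitz_first hYt) t1 t2 sΔ₁ sg
  have z2 := StatePlant.h2Inner_paramTF_eq_zero_of_left (G := P.toStatePlant) hX hR hY hV hh
    hXt.isHurwitz s1 s2 sΔ₂
    ((isStableTF_cst (fromCols 0 1 : Matrix k₂ (k₁ ⊕ k₂) ℝ)).mul sg')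
  rw [← e2] at z1
  rw [← e1] at z2
  rw [hre, h2Inner_add_right
    ((hT.mul_strict (StatePlant.isStrictTF_paramTF hh)).mul_stable hT')
    ((hT.mul_strict ((sg.mul_strict sΔ₁).mul_stable ((isStableTF_cst _).mul sg'))).mul_stable hT')
    ((hT.mul_strict (((sg.mul (isStableTF_cst _)).mul_strict sΔ₂).mul_stable
      ((isStableTF_cst _).mul sg'))).mul_stable hT'), z1, z2, add_zero]

/-- No admissible controller beats the two-player controller. In terms of Youla parameters with
respect to block-diagonal gains, the difference of the two closed loops is `T₁₂ Δ T₂₁` with `Δ`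
stable and block lower triangular; if its norm is finite, `Δ` is strictly proper, and the
difference is orthogonal to the closed loop of the two-player controller. -/
theorem h2Norm_Kopt_le {F₁ : Matrix m₁ n₁ ℝ} {H₂ : Matrix n₂ k₂ ℝ}
    (hF₁ : IsHurwitz (P.A₁₁ + P.B₁₁ * F₁)) (hH₂ : IsHurwitz (P.A₂₂ + H₂ * P.C₂₂))
    {K' : Matrix (m₁ ⊕ m₂) (k₁ ⊕ k₂) (RatFunc ℝ)} (hK' : K' ∈ twoPlayerControllers P.tf) :
    h2Norm (lowerLFT P.tf (P.Kopt K (P.Khat J Φ) L (P.Lhat M Ψ))) ≤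
      h2Norm (lowerLFT P.tf K') := by
  have hh : IsHurwitz (P.toStatePlant.A + P.toStatePlant.B₂ * P.Khat J Φ +
    P.Lhat M Ψ * P.toStatePlant.C₂) := isHurwitz_Ahat hXt hYt
  have hK : IsHurwitz (P.toStatePlant.A + P.toStatePlant.B₂ * K) := hX.isHurwitz
  have hL : IsHurwitz (P.toStatePlant.A + L * P.toStatePlant.C₂) :=
    StatePlant.isHurwitz_estimator (G := P.toStatePlant) hY
  have hF : IsHurwitz (P.A + P.B₂ * fromBlocks F₁ 0 0 J) := by
    simpa [A, B₂, fromBlocks_multiply, fromBlocks_add] using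
      hF₁.fromBlocks_zero₁₂ hXt.isHurwitz (P.A₂₁ + P.B₂₁ * F₁)
  have hH : IsHurwitz (P.A + fromBlocks M 0 0 H₂ * P.C₂) := by
    simpa [A, C₂, fromBlocks_multiply, fromBlocks_add] using
      (isHurwitz_first hYt).fromBlocks_zero₁₂ hH₂ (P.A₂₁ + H₂ * P.C₂₁)
  set F := fromBlocks F₁ 0 0 J with hFdef
  set H := fromBlocks M 0 0 H₂ with hHdef
  by_cases htop : h2Norm (lowerLFT P.tf K') = ⊤
  · rw [htop]; exact le_top
  set Ko := P.Kopt K (P.Khat J Φ) L (P.Lhat M Ψ) with hKo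
  have hKop : IsProperTF Ko := StatePlant.isProperTF_controller (G := P.toStatePlant)
  have hKos : Stabilizes P.toStatePlant.tf Ko := StatePlant.stabilizes_controller (G := P.toStatePlant) hK hL hh
  obtain ⟨hp, hlow, hst⟩ := hK'
  have hA : IsLower P.toStatePlant.A := isLower_fromBlocks _ _ _
  have hB : IsLower P.toStatePlant.B₂ := isLower_fromBlocks _ _ _
  have hC : IsLower P.toStatePlant.C₂ := isLower_fromBlocks _ _ _
  have hFl : IsLower F := isLower_fromBlocks _ _ _
  have hHl : IsLower H := isLower_fromBlocks _ _ _
  set Δ := P.toStatePlant.youla F H K' - P.toStatePlant.youla F H Ko with hΔ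
  have sΔ : IsStableTF Δ := (StatePlant.isStableTF_youla (G := P.toStatePlant) hF hH hst.2).sub
    (StatePlant.isStableTF_youla (G := P.toStatePlant) hF hH hKos.2)
  have lΔ : IsLower Δ := (StatePlant.isLower_youla (G := P.toStatePlant) hA hB hC hFl hHl hlow).sub
    (StatePlant.isLower_youla (G := P.toStatePlant) hA hB hC hFl hHl (isLower_Kopt K L J M Φ Ψ))
  have hstrict : IsStrictTF (lowerLFT P.tf Ko) :=
    StatePlant.isStrictTF_lowerLFT_controller (G := P.toStatePlant) hX hR hY hV hh
  have hdiff : lowerLFT P.tf K' = lowerLFT P.tf Ko +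
      P.toStatePlant.ctrlTF F * Δ * P.toStatePlant.innovTF H := by
    rw [← tf_toStatePlant, StatePlant.lowerLFT_eq_youla (G := P.toStatePlant) hp F H,
      StatePlant.lowerLFT_eq_youla (G := P.toStatePlant) hKop F H, hΔ, Matrix.mul_sub, Matrix.sub_mul]
    abel
  have sP : IsStableTF (P.toStatePlant.ctrlTF F * Δ * P.toStatePlant.innovTF H) :=
    ((StatePlant.isStableTF_ctrlTF (G := P.toStatePlant) hF).mul sΔ).mul (StatePlant.isStableTF_innovTF (G := P.toStatePlant) hH)
  have hP : IsStrictTF (P.toStatePlant.ctrlTF F * Δ * P.toStatePlant.innovTF H) := by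
    rw [hdiff] at htop
    have := (isStrictTF_of_h2Norm_ne_top (hstrict.isStableTF.add sP) htop).sub hstrict
    rwa [add_sub_cancel_left] at this
  have hΔs : IsStrictTF Δ := StatePlant.isStrictTF_of_mul (G := P.toStatePlant) hF hH hR hV sΔ hP
  rw [hdiff]
  refine h2Norm_le_add hstrict hP ?_
  have hT := StatePlant.isStableTF_ctrlTF (G := P.toStatePlant) hK
  have hT' := StatePlant.isStableTF_innovTF (G := P.toStatePlant) hL
  have hdec : lowerLFT P.tf Ko = P.toStatePlant.nomTF K L + P.toStatePlant.ctrlTF K *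
      P.toStatePlant.paramTF K (P.Khat J Φ) L (P.Lhat M Ψ) * P.toStatePlant.innovTF L :=
    StatePlant.lowerLFT_controller (G := P.toStatePlant)
  have hre : P.toStatePlant.ctrlTF F * Δ * P.toStatePlant.innovTF H =
      P.toStatePlant.ctrlTF K * ((1 + cst (F - K) * resTF (P.A + P.B₂ * F) * cst P.B₂) * Δ *
        (1 + cst P.C₂ * resTF (P.A + H * P.C₂) * cst (H - L))) * P.toStatePlant.innovTF L := by
    have hc : P.toStatePlant.ctrlTF F = P.toStatePlant.ctrlTF K *
      (1 + cst (F - K) * resTF (P.A + P.B₂ * F) * cst P.B₂) := StatePlant.ctrlTF_eq_mul (G := P.toStatePlant) K _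
    have hi : P.toStatePlant.innovTF H = (1 + cst P.C₂ * resTF (P.A + H * P.C₂) * cst (H - L)) *
      P.toStatePlant.innovTF L := StatePlant.innovTF_eq_mul (G := P.toStatePlant) L _
    rw [hc, hi]
    simp only [Matrix.mul_assoc]
  have sQ : IsStrictTF ((1 + cst (F - K) * resTF (P.A + P.B₂ * F) * cst P.B₂) * Δ *
      (1 + cst P.C₂ * resTF (P.A + H * P.C₂) * cst (H - L))) :=
    (IsStableTF.mul_strict (isStableTF_one.add (((isStableTF_cst _).mul
      (isStrictTF_resTF hF).isStableTF).mul (isStableTF_cst _))) hΔs).mul_stable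
      (isStableTF_one.add (((isStableTF_cst _).mul
        (isStrictTF_resTF hH).isStableTF).mul (isStableTF_cst _)))
  have z1 := h2Inner_paramTF_lower_eq_zero hR hV hR₂ hV₁ hX hY hXt hYt hΦΨ hF hH hΔs lΔ
  have z2 := StatePlant.h2Inner_nomTF_eq_zero (G := P.toStatePlant) hX hR hY hV sQ
  rw [← hre] at z2
  rw [hdec, h2Inner_add_left (StatePlant.isStrictTF_nomTF (G := P.toStatePlant) hK hL)
    ((hT.mul_strict (StatePlant.isStrictTF_paramTF (G := P.toStatePlant) hh)).mul_stable hT') hP,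
    z1, z2, add_zero]

end

end TwoPlayerPlant

/-! ### The additional cost -/

namespace StatePlant

variable {n m k p q : Type*} [Fintype n] [DecidableEq n] [Fintype m] [DecidableEq m]
  [Fintype k] [DecidableEq k] [Fintype p] [DecidableEq p] [Fintype q]
  {G : StatePlant n m k p q} {K Kh : Matrix m n ℝ} {L Lh : Matrix n k ℝ} {X Y : Matrix n n ℝ}

theorem cst_mul_paramTF_mul_cst : cst G.D₁₂ * G.paramTF K Kh L Lh * cst G.D₂₁ =
    transferFn (G.A + G.B₂ * Kh + Lh * G.C₂) ((Lh - L) * G.D₂₁) (G.D₁₂ * (Kh - K)) 0 := by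
  rw [transferFn_eq, cst_zero, zero_add, paramTF, cst_mul, cst_mul]
  simp only [Matrix.mul_assoc]

/-- The excess cost of an observer-based controller over the centralized optimum. -/
theorem h2Norm_lowerLFT_controller_sq_sub (hX : IsARE G.A G.B₂ G.C₁ G.D₁₂ X K)
    (hR : IsUnit (G.D₁₂ᵀ * G.D₁₂).det) (hY : IsARE G.Aᵀ G.C₂ᵀ G.B₁ᵀ G.D₂₁ᵀ Y Lᵀ)
    (hV : IsUnit (G.D₂₁ * G.D₂₁ᵀ).det) (hh : IsHurwitz (G.A + G.B₂ * Kh + Lh * G.C₂)) :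
    (h2Norm (lowerLFT G.tf (G.controller K Kh L Lh))).toReal ^ 2 -
        (h2Norm (G.nomTF K L)).toReal ^ 2 =
      h2Inner (cst (G.D₁₂ * (Kh - K)) * resTF (G.A + G.B₂ * Kh + Lh * G.C₂) *
          cst ((Lh - L) * G.D₂₁))
        (cst (G.D₁₂ * (Kh - K)) * resTF (G.A + G.B₂ * Kh + Lh * G.C₂) *
          cst ((Lh - L) * G.D₂₁)) := by
  have hK := hX.isHurwitz
  have hL := isHurwitz_estimator hY
  have hQ := isStrictTF_paramTF (K := K) (L := L) hh
  have hnom := isStrictTF_nomTF hK hL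
  have hpert := ((isStableTF_ctrlTF hK).mul_strict hQ).mul_stable (isStableTF_innovTF hL)
  have e : cst (G.D₁₂ * (Kh - K)) * resTF (G.A + G.B₂ * Kh + Lh * G.C₂) *
      cst ((Lh - L) * G.D₂₁) = cst G.D₁₂ * G.paramTF K Kh L Lh * cst G.D₂₁ := by
    rw [cst_mul_paramTF_mul_cst, transferFn_eq, cst_zero, zero_add]
  rw [e, ← h2Inner_param_self hX hR hY hV hQ.isStableTF, lowerLFT_controller,
    h2Norm_toReal_sq (hnom.add hpert), h2Norm_toReal_sq hnom, h2Inner_add_self hnom hpert,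
    h2Inner_nomTF_eq_zero hX hR hY hV hQ]
  ring

end StatePlant

/-- The two Gramians of a stable system give the same cost. -/
theorem trace_gramian_eq {n : Type*} [Fintype n] {A X Y M N : Matrix n n ℝ}
    (hY : A * Y + Y * Aᵀ + M = 0) (hX : Aᵀ * X + X * A + N = 0) :
    (Y * N).trace = (X * M).trace := by
  have hN : N = -(Aᵀ * X + X * A) := (neg_eq_of_add_eq_zero_right hX).symm
  have hM : M = -(A * Y + Y * Aᵀ) := (neg_eq_of_add_eq_zero_right hY).symm
  rw [hN, hM, Matrix.mul_neg, Matrix.mul_neg, Matrix.trace_neg, Matrix.trace_neg, Matrix.mul_add,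
    Matrix.mul_add, Matrix.trace_add, Matrix.trace_add, ← Matrix.mul_assoc, ← Matrix.mul_assoc,
    ← Matrix.mul_assoc, ← Matrix.mul_assoc, Matrix.trace_mul_comm (Y * Aᵀ),
    Matrix.trace_mul_comm (Y * X), Matrix.mul_assoc X A Y, ← Matrix.mul_assoc A Y X,
    Matrix.trace_mul_comm (A * Y) X, Matrix.mul_assoc]
  abel

end

theorem mainTheorem3 {n₁ n₂ m₁ m₂ k₁ k₂ p q : ℕ}
    (P : TwoPlayerPlant (Fin n₁) (Fin n₂) (Fin m₁) (Fin m₂) (Fin k₁) (Fin k₂) (Fin p) (Fin q))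
    (hn₁ : n₁ ≠ 0) (hn₂ : n₂ ≠ 0)
    (hmin : IsMinimalRealization P.A P.B P.C P.D)
    (hA1 : (P.D₁₂ᵀ * P.D₁₂).PosDef)
    (hA2 : IsStabilizable P.A₁₁ P.B₁₁ ∧ IsStabilizable P.A₂₂ P.B₂₂)
    (hA3 : ∀ ω : ℝ, (pencil P.A P.B₂ P.C₁ P.D₁₂ ω).rank = (n₁ + n₂) + (m₁ + m₂))
    (hA4 : (P.D₂₁ * P.D₂₁ᵀ).PosDef)
    (hA5 : IsDetectable P.C₁₁ P.A₁₁ ∧ IsDetectable P.C₂₂ P.A₂₂)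
    (hA6 : ∀ ω : ℝ, (pencil P.A P.B₁ P.C₂ P.D₂₁ ω).rank = (n₁ + n₂) + (k₁ + k₂))
    -- the solutions of the four algebraic Riccati equations, with their gains
    (X Y : Matrix (Fin n₁ ⊕ Fin n₂) (Fin n₁ ⊕ Fin n₂) ℝ)
    (K : Matrix (Fin m₁ ⊕ Fin m₂) (Fin n₁ ⊕ Fin n₂) ℝ)
    (L : Matrix (Fin n₁ ⊕ Fin n₂) (Fin k₁ ⊕ Fin k₂) ℝ)
    (Xt : Matrix (Fin n₂) (Fin n₂) ℝ) (J : Matrix (Fin m₂) (Fin n₂) ℝ)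
    (Yt : Matrix (Fin n₁) (Fin n₁) ℝ) (M : Matrix (Fin n₁) (Fin k₁) ℝ)
    (hX : IsARE P.A P.B₂ P.C₁ P.D₁₂ X K)
    (hY : IsARE P.Aᵀ P.C₂ᵀ P.B₁ᵀ P.D₂₁ᵀ Y Lᵀ)
    (hXt : IsARE P.A₂₂ P.B₂₂ P.C₁.toCols₂ P.D₁₂.toCols₂ Xt J)
    (hYt : IsARE P.A₁₁ᵀ P.C₁₁ᵀ P.B₁ᵀ.toCols₁ P.D₂₁ᵀ.toCols₁ Yt Mᵀ)
    -- the solution of the coupled linear equations, and the gains it determines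
    (Φ Ψ : Matrix (Fin n₂) (Fin n₁) ℝ)
    (hΦΨ : P.CoupledEquations X Y Xt J Yt M Φ Ψ)
    (Kh : Matrix (Fin m₁ ⊕ Fin m₂) (Fin n₁ ⊕ Fin n₂) ℝ) (hKh : Kh = P.Khat J Φ)
    (Lh : Matrix (Fin n₁ ⊕ Fin n₂) (Fin k₁ ⊕ Fin k₂) ℝ) (hLh : Lh = P.Lhat M Ψ)
    (Ah : Matrix (Fin n₁ ⊕ Fin n₂) (Fin n₁ ⊕ Fin n₂) ℝ) (hAh : Ah = P.Ahat Kh Lh)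
    -- the solutions of the two Lyapunov equations
    (Xh Yh : Matrix (Fin n₁ ⊕ Fin n₂) (Fin n₁ ⊕ Fin n₂) ℝ)
    (hYh : Ah * (Yh - Y) + (Yh - Y) * Ahᵀ + (Lh - L) * P.V * (Lh - L)ᵀ = 0)
    (hXh : Ahᵀ * (Xh - X) + (Xh - X) * Ah + (Kh - K)ᵀ * P.R * (Kh - K) = 0) :
    -- the controller is optimal for the two-player problem, and a centralized optimum exists
    IsH2Optimal P.tf (twoPlayerControllers P.tf) (P.Kopt K Kh L Lh) ∧
    (∃ Kcen, IsH2Optimal P.tf (centralizedControllers P.tf) Kcen) ∧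
    -- the additional cost of the former over any of the latter
    ∀ Kcen, IsH2Optimal P.tf (centralizedControllers P.tf) Kcen →
      h2Norm (lowerLFT P.tf (P.Kopt K Kh L Lh)) ≠ ⊤ ∧
      h2Norm (lowerLFT P.tf Kcen) ≠ ⊤ ∧
      h2Norm (transferFn Ah ((Lh - L) * P.D₂₁) (P.D₁₂ * (Kh - K)) 0) ≠ ⊤ ∧
      (h2Norm (lowerLFT P.tf (P.Kopt K Kh L Lh))).toReal ^ 2
          - (h2Norm (lowerLFT P.tf Kcen)).toReal ^ 2
        = (h2Norm (transferFn Ah ((Lh - L) * P.D₂₁) (P.D₁₂ * (Kh - K)) 0)).toReal ^ 2 ∧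
      (h2Norm (lowerLFT P.tf (P.Kopt K Kh L Lh))).toReal ^ 2
          - (h2Norm (lowerLFT P.tf Kcen)).toReal ^ 2
        = ((Yh - Y) * ((Kh - K)ᵀ * P.R * (Kh - K))).trace ∧
      (h2Norm (lowerLFT P.tf (P.Kopt K Kh L Lh))).toReal ^ 2
          - (h2Norm (lowerLFT P.tf Kcen)).toReal ^ 2
        = ((Xh - X) * ((Lh - L) * P.V * (Lh - L)ᵀ)).trace := by

  have hR : IsUnit (P.D₁₂ᵀ * P.D₁₂).det := hA1.det_pos.ne'.isUnit
  have hV : IsUnit (P.D₂₁ * P.D₂₁ᵀ).det := hA4.det_pos.ne'.isUnit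
  have hR₂ : IsUnit (P.D₁₂.toCols₂ᵀ * P.D₁₂.toCols₂).det :=
    (hA1.submatrix Sum.inr_injective).det_pos.ne'.isUnit
  have hV₁ : IsUnit P.V.toBlocks₁₁.det :=
    (hA4.submatrix Sum.inl_injective).det_pos.ne'.isUnit
  subst hKh hLh hAh
  -- the diagonal blocks not governed by `J` and `M` need only some stabilizing gains
  obtain ⟨F₁, hF₁⟩ := hA2.1
  obtain ⟨H₂, hH₂⟩ := hA5.2
  have hK : IsHurwitz (P.toStatePlant.A + P.toStatePlant.B₂ * K) := hX.isHurwitz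
  have hL : IsHurwitz (P.toStatePlant.A + L * P.toStatePlant.C₂) :=
    StatePlant.isHurwitz_estimator (G := P.toStatePlant) hY
  have hh : IsHurwitz (P.toStatePlant.A + P.toStatePlant.B₂ * P.Khat J Φ +
    P.Lhat M Ψ * P.toStatePlant.C₂) := TwoPlayerPlant.isHurwitz_Ahat hXt hYt
  have hnorm : IsStrictTF (transferFn (P.Ahat (P.Khat J Φ) (P.Lhat M Ψ)) ((P.Lhat M Ψ - L) * P.D₂₁)
      (P.D₁₂ * (P.Khat J Φ - K)) 0) := by
    rw [transferFn_eq, cst_zero, zero_add]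
    exact ((isStableTF_cst _).mul_strict (isStrictTF_resTF hh)).mul_stable (isStableTF_cst _)
  refine ⟨⟨⟨StatePlant.isProperTF_controller (G := P.toStatePlant),
    TwoPlayerPlant.isLower_Kopt K L J M Φ Ψ,
    StatePlant.stabilizes_controller (G := P.toStatePlant) hK hL hh⟩, fun K' hK' =>
    TwoPlayerPlant.h2Norm_Kopt_le hR hV hR₂ hV₁ hX hY hXt hYt hΦΨ hF₁ hH₂ hK'⟩, ?_, ?_⟩
  · obtain ⟨Kc, hKc, -⟩ := StatePlant.exists_isH2Optimal_centralized (G := P.toStatePlant) hX hR hY hV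
    exact ⟨Kc, hKc⟩
  · intro Kcen hKcen
    have hcen : h2Norm (lowerLFT P.tf Kcen) = h2Norm (P.toStatePlant.nomTF K L) :=
      StatePlant.h2Norm_of_isH2Optimal_centralized (G := P.toStatePlant) hX hR hY hV hKcen
    have hopt : IsStrictTF (lowerLFT P.tf (P.Kopt K (P.Khat J Φ) L (P.Lhat M Ψ))) :=
      StatePlant.isStrictTF_lowerLFT_controller (G := P.toStatePlant) hX hR hY hV hh
    have hΔ := StatePlant.h2Norm_lowerLFT_controller_sq_sub (G := P.toStatePlant) hX hR hY hV hh
    have hgram := h2Inner_gramian (C := P.D₁₂ * (P.Khat J Φ - K)) (B := (P.Lhat M Ψ - L) * P.D₂₁)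
      (TwoPlayerPlant.isHurwitz_Ahat (Φ := Φ) (Ψ := Ψ) hXt hYt) (Y := Yh - Y)
      (by rw [← hYh, transpose_mul, TwoPlayerPlant.V]; simp only [Matrix.mul_assoc])
    have hKd : (P.D₁₂ * (P.Khat J Φ - K))ᵀ * (P.D₁₂ * (P.Khat J Φ - K)) =
        (P.Khat J Φ - K)ᵀ * P.R * (P.Khat J Φ - K) := by
      rw [transpose_mul, TwoPlayerPlant.R]
      simp only [Matrix.mul_assoc]
    rw [hKd] at hgram
    rw [hcen, ← trace_gramian_eq hYh hXh, ← hgram, h2Norm_toReal_sq hnorm, transferFn_eq, cst_zero,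
      zero_add]
    exact ⟨h2Norm_ne_top hopt, h2Norm_ne_top (StatePlant.isStrictTF_nomTF hK hL),
      by rw [transferFn_eq, cst_zero, zero_add] at hnorm; exact h2Norm_ne_top hnorm, hΔ, hΔ, hΔ⟩
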